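/- Let $\kappa$ be a field of characteristic $0$, $G$ a finite abelian group and $\beta\colon G\times G\to\kappa^*$ a symmetric bicharacter, i.e. $\beta(ab,c)=\beta(a,c)\beta(b,c)$, $\beta(a,bc)=\beta(a,b)\beta(a,c)$ and $\beta(a,b)\beta(b,a)=1$. Let $V=\bigoplus_{a\in G}V_a$ be a finite-dimensional $G$-graded $\kappa$-vector space with a nondegenerate $\beta$-skew-symmetric bilinear form: $\langle V_a,V_b\rangle=0$ unless $a=b^{-1}$, and $\langle v,w\rangle=-\beta(b,a)\langle w,v\rangle$ for $v\in V_a$, $w\in V_b$. Let $\mathfrak g=\mathfrak{spo}(V,\beta)=\bigoplus_a\mathfrak g_a$, where $\mathfrak g_a$ is the set of $x\in\mathrm{End}(V)$ with $xV_b\subseteq V_{ab}$ for all $b$ and $\langle xu,v\rangle+\beta(b,a)\langle u,xv\rangle=0$ for all $b$, $u\in V_b$, $v\in V$. It acts on $V^{\otimes k}$ by $x(v_1\otimes\cdots\otimes v_k)=\sum_i\beta(b_1\cdots b_{i-1},a)\,v_1\otimes\cdots\otimes xv_i\otimes\cdots\otimes v_k$ for $x\in\mathfrak g_a$, $v_j\in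 V_{b_j}$. $\mathrm{End}_{\mathfrak g}(V^{\otimes k})$ denotes the algebra of linear maps preserving the $G$-grading and commuting with this action. A $k$-diagram $d$ is a perfect matching of $k$ top vertices $1,\dots,k$ and $k$ bottom vertices $1',\dots,k'$. Number the vertices $1',\dots,k',k,\dots,1$ (counterclockwise from the bottom left corner) as $1,\dots,2k$; let $(\ell_i,r_i)$, $\ell_i<r_i$, $\ell_1<\cdots<\ell_k$, be the edges of $d$ in this numbering and $\pi_d\in S_{2k}$ the permutation sending $1,\dots,2k$ to $\ell_1,\dots,\ell_k,r_k,\dots,r_1$. Let $\check R_i$ act on $V^{\otimes 2k}$ in the positions $i,i+1$ by $v\otimes w\mapsto-\beta(b,a)\,w\otimes v$ ($v\in V_a$, $w\in V_b$), and put $\check R_d=\check R_{i_1}\cdots\check R_{i_p}$ for a reduced expression $\pi_d=s_{i_1}\cdots s_{i_p}$. Let $F\colon V\to V^*$, $v\mapsto\langle v,\cdot\rangle$. Identify $(V^*)^{\otimes k}$ with $(V^{\otimes k})^*$ by $(f_1\otimes\cdots\otimes f_k)(v_1\otimes\cdots\otimes v_k)=f_k(v_1)\cdots f_1(v_k)$,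 and let $\widetilde{\mathrm{pr}}_k\colon\kappa\to V^{\otimes k}\otimes(V^*)^{\otimes k}$ and $\widetilde{\mathrm{ev}}_k\colon(V^*)^{\otimes k}\otimes V^{\otimes k}\to\kappa$ be the resulting coevaluation and evaluation. Let $\Psi_d\colon V^{\otimes k}\to V^{\otimes k}$ be the composite $$V^{\otimes k}\xrightarrow{\widetilde{\mathrm{pr}}_k\otimes\mathrm{id}}V^{\otimes k}\otimes(V^*)^{\otimes k}\otimes V^{\otimes k}\xrightarrow{\mathrm{id}\otimes(F^{-1})^{\otimes k}\otimes\mathrm{id}}V^{\otimes 2k}\otimes V^{\otimes k}\xrightarrow{\check R_d\otimes\mathrm{id}}V^{\otimes 2k}\otimes V^{\otimes k}\xrightarrow{\mathrm{id}\otimes F^{\otimes k}\otimes\mathrm{id}}V^{\otimes k}\otimes(V^*)^{\otimes k}\otimes V^{\otimes k}\xrightarrow{\mathrm{id}\otimes\widetilde{\mathrm{ev}}_k}V^{\otimes k}.$$ (a) For every $k$-diagram $d$, $\Psi_d\in\mathrm{End}_{\mathfrak g}(V^{\otimes k})$. If $B$ is a homogeneous basis of $V$, $F_{v,w}=\langle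 v,w\rangle$ for $v,w\in B$, and $(F^{-1}_{v,w})$ is the inverse matrix, then for all $a_1,\dots,a_k\in B$ $$(a_1\otimes\cdots\otimes a_k)\Psi_d=\sum_{b_1,\dots,b_k\in B}d_{\underline a,\underline b}\;b_1\otimes\cdots\otimes b_k,$$ where, labelling the top vertices of $d$ by $a_1,\dots,a_k$ and the bottom vertices by $b_1,\dots,b_k$, the weight $d_{\underline a,\underline b}$ is the product of the following factors: $F_{a,a'}$ for each horizontal top edge with left label $a$ and right label $a'$; $F^{-1}_{b,b'}$ for each horizontal bottom edge with left label $b$ and right label $b'$; $\delta_{a,b}$ for each vertical edge $(a,b)$; and one factor for each pair of crossing edges (edges whose ends alternate along the boundary of the diagram): if $x,y$ are the last two, in this order, of their four ends counted counterclockwise from the bottom left corner, and $\deg x$, $\deg y$ are the degrees of their labels, the factor is $-\beta(\deg x,\deg y)$, except that it is $-\beta(\deg y,\deg x)$ when $x$ is a bottom vertex and $y$ is a top vertex. (b) Let $m=\dim V_{(0)}$ and $n=\dim V_{(1)}$, where $V_{(0)}=\bigoplus_{\beta(c,c)=1}V_c$ and $V_{(1)}=\bigoplus_{\beta(c,c)=-1}V_c$.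 Let $B_k(\eta)$ be the Brauer algebra with basis the $k$-diagrams and product $d_1d_2=\eta^{c}d$, where $d$ consists of the paths of $d_1$ placed above $d_2$, and $c$ is the number of closed loops. Then $d\mapsto\Psi_d$ extends to a unital homomorphism of $\kappa$-algebras $\Psi\colon B_k(n-m)\to\mathrm{End}_{\mathfrak g}(V^{\otimes k})$, where endomorphisms are written on the right (so that $\Psi_{d_1d_2}$ is first $\Psi_{d_1}$, then $\Psi_{d_2}$). -/

import Mathlib

namespace SpoColor

open scoped TensorProduct

/-! ### One-factors, diagrams and the Brauer algebra -/

/-- A perfect matching (graph in which every vertex lies on precisely one edge) on the vertex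
set `X`, encoded by the map sending a vertex to the other end of its edge. -/
@[ext]
structure Matching (X : Type*) where
  mate : X → X
  mate_mate : ∀ x, mate (mate x) = x
  mate_ne : ∀ x, mate x ≠ x

/-- A `k`-diagram. Vertex `Sum.inl i` is the `i`-th top vertex, `Sum.inr i` the `i`-th bottom
vertex, both rows being numbered from left to right. -/
abbrev Diagram (k : ℕ) := Matching (Fin k ⊕ Fin k)

/-- A `2k`-one-factor: a perfect matching on a row of `2k` vertices. -/
abbrev OneFactor (k : ℕ) := Matching (Fin (k + k))

/-- The relabelling `(1', …, k', k, …, 1) ↦ (1, …, 2k)` of the vertices of a `k`-diagram. -/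
def unfoldVertex (k : ℕ) : Fin k ⊕ Fin k ≃ Fin (k + k) :=
  (Equiv.sumComm (Fin k) (Fin k)).trans
    ((Equiv.sumCongr (Equiv.refl (Fin k)) Fin.revPerm).trans finSumFinEquiv)

/-- The unfolding map from `k`-diagrams to `2k`-one-factors. -/
def unfold {k : ℕ} (d : Diagram k) : OneFactor k where
  mate x := unfoldVertex k (d.mate ((unfoldVertex k).symm x))
  mate_mate x := by simp [d.mate_mate]
  mate_ne x h := d.mate_ne ((unfoldVertex k).symm x) (by
    rw [Equiv.eq_symm_apply]; exact h)

/-- The diagram all of whose edges join a top vertex to the bottom vertex below it. -/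
def Diagram.id (k : ℕ) : Diagram k where
  mate := Sum.swap
  mate_mate := Sum.swap_swap
  mate_ne x := by cases x <;> simp

section Stack

variable {k : ℕ}

/-- Vertices of the graph with `d₁` stacked above `d₂`: a top, a middle and a bottom row.
`upper` embeds the vertices of `d₁`, and `lower` those of `d₂`; the bottom row of `d₁` is
identified with the top row of `d₂`. `outer` embeds the top and the bottom row. -/
def upper : Fin k ⊕ Fin k → Fin k ⊕ Fin k ⊕ Fin k := Sum.map _root_.id Sum.inl
def lower : Fin k ⊕ Fin k → Fin k ⊕ Fin k ⊕ Fin k := Sum.inr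
def outer : Fin k ⊕ Fin k → Fin k ⊕ Fin k ⊕ Fin k := Sum.map _root_.id Sum.inr

/-- The graph obtained by placing `d₁` above `d₂`. (Two parallel edges, which form a closed loop
through two middle vertices, become one edge; this does not affect connectivity.) -/
def stack (d₁ d₂ : Diagram k) : SimpleGraph (Fin k ⊕ Fin k ⊕ Fin k) :=
  SimpleGraph.fromRel fun x y =>
    (∃ z, x = upper z ∧ y = upper (d₁.mate z)) ∨ (∃ z, x = lower z ∧ y = lower (d₂.mate z))

def upperExt (d₁ : Diagram k) : Fin k ⊕ Fin k ⊕ Fin k → Fin k ⊕ Fin k ⊕ Fin k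
  | .inl t => upper (d₁.mate (.inl t))
  | .inr (.inl m) => upper (d₁.mate (.inr m))
  | .inr (.inr b) => .inr (.inr b)

def lowerExt (d₂ : Diagram k) : Fin k ⊕ Fin k ⊕ Fin k → Fin k ⊕ Fin k ⊕ Fin k
  | .inl t => .inl t
  | .inr z => .inr (d₂.mate z)

theorem upperExt_upper (d₁ : Diagram k) (z) : upperExt d₁ (upper z) = upper (d₁.mate z) := by
  rcases z with z | z <;> rfl

theorem upper_injective : Function.Injective (upper (k := k)) :=
  Function.injective_id.sumMap Sum.inl_injective

theorem outer_injective : Function.Injective (outer (k := k)) :=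
  Function.injective_id.sumMap Sum.inr_injective

theorem upperExt_invol (d₁ : Diagram k) : Function.Involutive (upperExt d₁) := by
  rintro (t | m | b)
  · exact (upperExt_upper d₁ (d₁.mate (.inl t))).trans (by rw [d₁.mate_mate]; rfl)
  · exact (upperExt_upper d₁ (d₁.mate (.inr m))).trans (by rw [d₁.mate_mate]; rfl)
  · rfl

theorem lowerExt_invol (d₂ : Diagram k) : Function.Involutive (lowerExt d₂) := by
  rintro (t | z)
  · rfl
  · simp [lowerExt, d₂.mate_mate]

theorem upperExt_fixed (d₁ : Diagram k) (x) : upperExt d₁ x = x ↔ ∃ b, x = .inr (.inr b) := by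
  rcases x with t | m | b
  · exact iff_of_false (fun h => d₁.mate_ne _ (upper_injective (a₂ := .inl t) h)) (by simp)
  · exact iff_of_false (fun h => d₁.mate_ne _ (upper_injective (a₂ := .inr m) h)) (by simp)
  · simp [upperExt]

theorem lowerExt_fixed (d₂ : Diagram k) (x) : lowerExt d₂ x = x ↔ ∃ t, x = .inl t := by
  rcases x with t | z
  · simp [lowerExt]
  · simpa [lowerExt] using d₂.mate_ne z

theorem stack_reachable_upperExt (d₁ d₂ : Diagram k) (x) :
    (stack d₁ d₂).Reachable x (upperExt d₁ x) := by
  by_cases h : x = upperExt d₁ x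
  · rw [← h]
  · refine SimpleGraph.Adj.reachable ?_
    refine (SimpleGraph.fromRel_adj _ _ _).2 ⟨h, .inl (.inl ?_)⟩
    rcases x with t | m | b
    · exact ⟨.inl t, rfl, rfl⟩
    · exact ⟨.inr m, rfl, rfl⟩
    · exact absurd rfl h

theorem stack_reachable_lowerExt (d₁ d₂ : Diagram k) (x) :
    (stack d₁ d₂).Reachable x (lowerExt d₂ x) := by
  by_cases h : x = lowerExt d₂ x
  · rw [← h]
  · refine SimpleGraph.Adj.reachable ?_
    refine (SimpleGraph.fromRel_adj _ _ _).2 ⟨h, .inl (.inr ?_)⟩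
    rcases x with t | z
    · exact absurd rfl h
    · exact ⟨z, rfl, rfl⟩

theorem stack_adj (d₁ d₂ : Diagram k) {x y} (h : (stack d₁ d₂).Adj x y) :
    y = upperExt d₁ x ∨ y = lowerExt d₂ x := by
  obtain ⟨-, (⟨z, rfl, rfl⟩ | ⟨z, rfl, rfl⟩) | (⟨z, rfl, rfl⟩ | ⟨z, rfl, rfl⟩)⟩ :=
    (SimpleGraph.fromRel_adj _ _ _).1 h
  · exact .inl (upperExt_upper _ _).symm
  · exact .inr rfl
  · exact .inl (by rw [upperExt_upper, d₁.mate_mate])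
  · exact .inr (by simp [lowerExt, lower, d₂.mate_mate])

/-- A property that is stable along the edges holds on a whole component. -/
theorem stack_reachable_induction (d₁ d₂ : Diagram k) {P : Fin k ⊕ Fin k ⊕ Fin k → Prop}
    (h₁ : ∀ x, P x → P (upperExt d₁ x)) (h₂ : ∀ x, P x → P (lowerExt d₂ x)) {x y}
    (h : (stack d₁ d₂).Reachable x y) (hx : P x) : P y := by
  obtain ⟨w⟩ := h
  induction w with
  | nil => exact hx
  | cons hadj _ ih =>
    refine ih ?_
    rcases stack_adj d₁ d₂ hadj with rfl | rfl
    · exact h₁ _ hx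
    · exact h₂ _ hx

/-- Two involutions of a finite set without common fixed point: in the orbit of a point fixed by
one of them there is exactly one further point fixed by one of them. -/
theorem exists_other_end {X : Type*} [Finite X] (α β : Equiv.Perm X)
    (hα : ∀ x, α (α x) = x) (hβ : ∀ x, β (β x) = x) (hno : ∀ x, α x = x → β x ≠ x)
    (x : X) (hx : α x = x) :
    (∀ i : ℤ, (∃ j : ℤ, α (((α * β) ^ i) x) = ((α * β) ^ j) x) ∧
      (∃ j : ℤ, β (((α * β) ^ i) x) = ((α * β) ^ j) x)) ∧
    ∃ i : ℤ, (((α * β) ^ i) x ≠ x ∧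
        (α (((α * β) ^ i) x) = ((α * β) ^ i) x ∨ β (((α * β) ^ i) x) = ((α * β) ^ i) x)) ∧
      ∀ j : ℤ, ((α * β) ^ j) x ≠ x →
        (α (((α * β) ^ j) x) = ((α * β) ^ j) x ∨ β (((α * β) ^ j) x) = ((α * β) ^ j) x) →
        ((α * β) ^ j) x = ((α * β) ^ i) x := by
  have hα' : α * α = 1 := Equiv.ext hα
  have hβ' : β * β = 1 := Equiv.ext hβ
  have hαi : α⁻¹ = α := inv_eq_of_mul_eq_one_left hα'
  have hβi : β⁻¹ = β := inv_eq_of_mul_eq_one_left hβ'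
  set f := α * β with hf
  have hconj : α * f * α⁻¹ = f⁻¹ := by
    rw [hf, mul_inv_rev, hαi, hβi, ← mul_assoc, hα', one_mul]
  have hA : ∀ i : ℤ, α ((f ^ i) x) = (f ^ (-i)) x := by
    intro i
    have h1 : α * f ^ i = f ^ (-i) * α := by
      rw [zpow_neg, ← inv_zpow, ← hconj, conj_zpow]; simp
    calc α ((f ^ i) x) = (α * f ^ i) x := rfl
      _ = (f ^ (-i)) (α x) := by rw [h1]; rfl
      _ = _ := by rw [hx]
  have hB : ∀ i : ℤ, β ((f ^ i) x) = (f ^ (-(i + 1))) x := by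
    intro i
    rw [← hA (i + 1), add_comm, zpow_add, zpow_one]
    simp [hf, hα]
  set N : ℤ := (MulAction.period f x : ℤ) with hN
  have hNpos : 0 < N := by
    rw [hN]
    exact_mod_cast MulAction.period_pos_of_orderOf_pos (orderOf_pos f) x
  have hper : ∀ i : ℤ, (f ^ i) x = x ↔ N ∣ i := fun i =>
    MulAction.zpow_smul_eq_iff_period_dvd (g := f) (a := x)
  have heq : ∀ i j : ℤ, (f ^ i) x = (f ^ j) x ↔ N ∣ i - j := by
    intro i j
    rw [← hper, sub_eq_neg_add, zpow_add, Equiv.Perm.mul_apply, zpow_neg,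
      Equiv.Perm.inv_eq_iff_eq]
  have hN1 : N ≠ 1 := by
    intro h
    refine hno x hx ?_
    have := hB 0
    simp only [zpow_zero, Equiv.Perm.one_apply] at this
    rw [this, hper, h]
    exact one_dvd _
  refine ⟨fun i => ⟨⟨_, hA i⟩, ⟨_, hB i⟩⟩, ?_⟩
  simp only [hA, hB, heq, Ne, hper]
  rcases Int.even_or_odd' N with ⟨t, ht | ht⟩
  · refine ⟨t, ⟨?_, .inl ?_⟩, ?_⟩
    · rintro ⟨u, hu⟩
      have : u * 2 = 1 := by
        have : t * (u * 2) = t * 1 := by rw [ht] at hu; linarith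
        exact mul_left_cancel₀ (by omega) this
      omega
    · exact ⟨-1, by rw [ht]; ring⟩
    · rintro j hj (⟨u, hu⟩ | ⟨u, hu⟩)
      · have hj2 : j = t * (-u) := by rw [ht] at hu; linarith
        rcases Int.even_or_odd' u with ⟨v, hv | hv⟩
        · exact absurd ⟨-v, by rw [hj2, ht, hv]; ring⟩ hj
        · exact ⟨-v - 1, by rw [hj2, ht, hv]; ring⟩
      · exfalso
        rw [ht] at hu
        have : 2 * (t * u + j) = -1 := by linarith
        omega
  · have ht0 : t ≠ 0 := by rintro rfl; exact hN1 (by omega)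
    refine ⟨t, ⟨?_, .inr ?_⟩, ?_⟩
    · intro h
      have := Int.le_of_dvd (by omega) h
      omega
    · exact ⟨-1, by rw [ht]; ring⟩
    · have hcop : IsCoprime N 2 := ⟨1, -t, by rw [ht]; ring⟩
      rintro j hj (h | h)
      · refine absurd (hcop.dvd_of_dvd_mul_left (?_ : N ∣ 2 * j)) hj
        obtain ⟨u, hu⟩ := h
        exact ⟨-u, by linarith⟩
      · refine hcop.dvd_of_dvd_mul_left (?_ : N ∣ 2 * (j - t))
        obtain ⟨u, hu⟩ := h
        exact ⟨-u - 1, by linarith⟩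

theorem outer_iff (d₁ d₂ : Diagram k) (x) :
    (upperExt d₁ x = x ∨ lowerExt d₂ x = x) ↔ ∃ z, outer z = x := by
  rw [upperExt_fixed, lowerExt_fixed]
  rcases x with t | m | b <;> simp [outer]

/-- Every top or bottom vertex is joined by a path of the stacked graph to precisely one other
top or bottom vertex. -/
theorem stack_existsUnique (d₁ d₂ : Diagram k) (x : Fin k ⊕ Fin k) :
    ∃! y, y ≠ x ∧ (stack d₁ d₂).Reachable (outer x) (outer y) := by
  have key : ∀ (α β : Equiv.Perm (Fin k ⊕ Fin k ⊕ Fin k)),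
      ((⇑α = upperExt d₁ ∧ ⇑β = lowerExt d₂) ∨ (⇑α = lowerExt d₂ ∧ ⇑β = upperExt d₁)) →
      α (outer x) = outer x →
      ∃! y, y ≠ x ∧ (stack d₁ d₂).Reachable (outer x) (outer y) := by
    intro α β hαβ hx
    have hinv : (∀ x, α (α x) = x) ∧ (∀ x, β (β x) = x) ∧ (∀ x, α x = x → β x ≠ x) ∧
        (∀ y, (α y = y ∨ β y = y) ↔ ∃ z, outer z = y) ∧
        (∀ y, (stack d₁ d₂).Reachable y (α y)) ∧ (∀ y, (stack d₁ d₂).Reachable y (β y)) := by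
      rcases hαβ with ⟨h1, h2⟩ | ⟨h1, h2⟩
      · rw [h1, h2]
        refine ⟨upperExt_invol d₁, lowerExt_invol d₂, ?_, outer_iff d₁ d₂,
          stack_reachable_upperExt d₁ d₂, stack_reachable_lowerExt d₁ d₂⟩
        intro y
        rw [Ne, upperExt_fixed, lowerExt_fixed]
        rintro ⟨b, rfl⟩
        simp
      · rw [h1, h2]
        refine ⟨lowerExt_invol d₂, upperExt_invol d₁, ?_, fun y => or_comm.trans (outer_iff d₁ d₂ y),
          stack_reachable_lowerExt d₁ d₂, stack_reachable_upperExt d₁ d₂⟩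
        intro y
        rw [Ne, upperExt_fixed, lowerExt_fixed]
        rintro ⟨b, rfl⟩
        simp
    obtain ⟨hα, hβ, hno, hout, hr1, hr2⟩ := hinv
    obtain ⟨hcl, i, ⟨hi1, hi2⟩, huniq⟩ := exists_other_end α β hα hβ hno (outer x) hx
    have hreach : ∀ n : ℤ, (stack d₁ d₂).Reachable (outer x) (((α * β) ^ n) (outer x)) := by
      intro n
      induction n with
      | zero => exact SimpleGraph.Reachable.refl _
      | succ n ih =>
        rw [add_comm, zpow_add, zpow_one]
        exact ih.trans ((hr2 _).trans (hr1 _))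
      | pred n ih =>
        rw [sub_eq_neg_add, zpow_add, zpow_neg_one]
        refine ih.trans ?_
        set z := ((α * β) ^ (-(n : ℤ))) (outer x)
        have : ((α * β)⁻¹ * (α * β) ^ (-(n : ℤ))) (outer x) = β (α z) := by
          rw [Equiv.Perm.mul_apply, Equiv.Perm.inv_eq_iff_eq]
          simp [z, hα, hβ]
        rw [this]
        exact (hr1 _).trans (hr2 _)
    have horb : ∀ y, (stack d₁ d₂).Reachable (outer x) y →
        ∃ n : ℤ, y = ((α * β) ^ n) (outer x) := by
      intro y hy
      have hs : (∀ y, (∃ n : ℤ, y = ((α * β) ^ n) (outer x)) →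
            ∃ n : ℤ, α y = ((α * β) ^ n) (outer x)) ∧
          (∀ y, (∃ n : ℤ, y = ((α * β) ^ n) (outer x)) →
            ∃ n : ℤ, β y = ((α * β) ^ n) (outer x)) :=
        ⟨by rintro _ ⟨n, rfl⟩; exact (hcl n).1, by rintro _ ⟨n, rfl⟩; exact (hcl n).2⟩
      refine stack_reachable_induction d₁ d₂ (P := fun y => ∃ n : ℤ, y = ((α * β) ^ n) (outer x))
        ?_ ?_ hy ⟨0, rfl⟩
      · rcases hαβ with ⟨h1, h2⟩ | ⟨h1, h2⟩
        · rw [← h1]; exact hs.1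
        · rw [← h2]; exact hs.2
      · rcases hαβ with ⟨h1, h2⟩ | ⟨h1, h2⟩
        · rw [← h2]; exact hs.2
        · rw [← h1]; exact hs.1
    obtain ⟨y, hy⟩ := (hout _).1 hi2
    refine ⟨y, ⟨?_, ?_⟩, ?_⟩
    · rintro rfl; exact hi1 hy.symm
    · rw [hy]; exact hreach i
    · rintro z ⟨hz, hz'⟩
      obtain ⟨n, hn⟩ := horb _ hz'
      apply outer_injective
      rw [hy, hn]
      apply huniq
      · rw [← hn]; exact fun h => hz (outer_injective h)
      · rw [← hn]; exact (hout _).2 ⟨z, rfl⟩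
  rcases x with t | b
  · exact key ((lowerExt_invol d₂).toPerm) ((upperExt_invol d₁).toPerm) (.inr ⟨rfl, rfl⟩) rfl
  · exact key ((upperExt_invol d₁).toPerm) ((lowerExt_invol d₂).toPerm) (.inl ⟨rfl, rfl⟩) rfl

/-- The diagram whose edges are the paths of `d₁` placed above `d₂`, closed loops removed. -/
noncomputable def Diagram.comp (d₁ d₂ : Diagram k) : Diagram k where
  mate x := (stack_existsUnique d₁ d₂ x).choose
  mate_mate x := by
    have h1 := (stack_existsUnique d₁ d₂ x).choose_spec.1
    exact ((stack_existsUnique d₁ d₂ _).choose_spec.2 x ⟨h1.1.symm, h1.2.symm⟩).symm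
  mate_ne x := (stack_existsUnique d₁ d₂ x).choose_spec.1.1

theorem Diagram.comp_reachable (d₁ d₂ : Diagram k) (x) :
    (stack d₁ d₂).Reachable (outer x) (outer ((Diagram.comp d₁ d₂).mate x)) :=
  (stack_existsUnique d₁ d₂ x).choose_spec.1.2

/-- The number of closed loops of `d₁` placed above `d₂`: the connected components that contain
no top and no bottom vertex. -/
noncomputable def Diagram.loops (d₁ d₂ : Diagram k) : ℕ :=
  Nat.card {c : (stack d₁ d₂).ConnectedComponent //
    ∀ x, (stack d₁ d₂).connectedComponentMk (outer x) ≠ c}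

end Stack

section Assoc

/-! Associativity of diagram multiplication, by counting the two-colourings of the vertices that
are constant along edges. -/

variable {k : ℕ}

def Compat {X : Type*} (d : Matching X) (f : X → Bool) : Prop := ∀ x, f (d.mate x) = f x

open Classical in
noncomputable def colourMatrix (d : Diagram k) : Matrix (Fin k → Bool) (Fin k → Bool) ℕ :=
  Matrix.of fun a b => if Compat d (Sum.elim a b) then 1 else 0

theorem colouring_iff (d₁ d₂ : Diagram k) (f : Fin k ⊕ Fin k ⊕ Fin k → Bool) :
    (Compat d₁ (f ∘ upper) ∧ Compat d₂ (f ∘ lower)) ↔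
      ∀ x y, (stack d₁ d₂).Reachable x y → f x = f y := by
  constructor
  · rintro ⟨h1, h2⟩ x y hxy
    refine stack_reachable_induction d₁ d₂ (P := fun y => f x = f y) ?_ ?_ hxy rfl
    · rintro (t | m | b) h
      · exact h.trans (h1 (.inl t)).symm
      · exact h.trans (h1 (.inr m)).symm
      · exact h
    · rintro (t | z) h
      · exact h
      · exact h.trans (h2 z).symm
  · intro h
    refine ⟨fun z => (h _ _ ?_).symm, fun z => (h _ _ ?_).symm⟩
    · have := stack_reachable_upperExt d₁ d₂ (upper z)
      rwa [upperExt_upper] at this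
    · exact stack_reachable_lowerExt d₁ d₂ (lower z)

theorem card_colourings (d₁ d₂ : Diagram k) (a : Fin k ⊕ Fin k → Bool)
    (ha : Compat (Diagram.comp d₁ d₂) a) :
    Nat.card {f : Fin k ⊕ Fin k ⊕ Fin k → Bool //
      (Compat d₁ (f ∘ upper) ∧ Compat d₂ (f ∘ lower)) ∧ f ∘ outer = a} =
      2 ^ Diagram.loops d₁ d₂ := by
  classical
  set Γ := stack d₁ d₂ with hΓ
  set L := {c : Γ.ConnectedComponent // ∀ x, Γ.connectedComponentMk (outer x) ≠ c} with hL
  have hreach : ∀ x y, Γ.connectedComponentMk (outer x) = Γ.connectedComponentMk (outer y) →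
      a x = a y := by
    intro x y h
    by_cases hxy : y = x
    · rw [hxy]
    · have := (stack_existsUnique d₁ d₂ x).unique
        ⟨hxy, SimpleGraph.ConnectedComponent.exact h⟩
        ⟨(Diagram.comp d₁ d₂).mate_ne x, Diagram.comp_reachable d₁ d₂ x⟩
      rw [this, ha]
  let g : (L → Bool) → Γ.ConnectedComponent → Bool := fun φ c =>
    if h : ∀ x, Γ.connectedComponentMk (outer x) ≠ c then φ ⟨c, h⟩
    else a (not_forall_not.1 h).choose
  have hg : ∀ φ x, g φ (Γ.connectedComponentMk (outer x)) = a x := by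
    intro φ x
    have h : ¬ ∀ y, Γ.connectedComponentMk (outer y) ≠ Γ.connectedComponentMk (outer x) :=
      fun h => h x rfl
    simp only [g, dif_neg h]
    exact hreach _ _ (not_forall_not.1 h).choose_spec
  let e : {f : Fin k ⊕ Fin k ⊕ Fin k → Bool //
      (Compat d₁ (f ∘ upper) ∧ Compat d₂ (f ∘ lower)) ∧ f ∘ outer = a} ≃ (L → Bool) :=
    { toFun := fun f c => c.1.lift f.1 (fun v w p _ => (colouring_iff d₁ d₂ f.1).1 f.2.1 v w p.reachable)
      invFun := fun φ => ⟨fun x => g φ (Γ.connectedComponentMk x), by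
        refine ⟨(colouring_iff d₁ d₂ _).2 fun x y h => ?_, ?_⟩
        · show g φ _ = g φ _
          rw [SimpleGraph.ConnectedComponent.sound h]
        · funext x
          exact hg φ x⟩
      left_inv := by
        rintro ⟨f, hf, hfa⟩
        apply Subtype.ext
        funext x
        by_cases h : ∀ z, Γ.connectedComponentMk (outer z) ≠ Γ.connectedComponentMk x
        · simp only [g, dif_pos h]
          rfl
        · obtain ⟨z, hz⟩ := not_forall_not.1 h
          have key : ∀ φ, g φ (Γ.connectedComponentMk x) = f x := by
            intro φ
            rw [← hz, hg, ← hfa]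
            exact (colouring_iff d₁ d₂ f).1 hf _ _ (SimpleGraph.ConnectedComponent.exact hz)
          dsimp only
          exact key (fun c : L => c.1.lift f
            (fun v w p _ => (colouring_iff d₁ d₂ f).1 hf v w p.reachable))
      right_inv := by
        intro φ
        funext c
        obtain ⟨c, hc⟩ := c
        induction c using SimpleGraph.ConnectedComponent.ind with
        | h v =>
          show g φ (Γ.connectedComponentMk v) = _
          simp only [g, dif_pos hc] }
  rw [Nat.card_congr e, Nat.card_fun, Nat.card_eq_fintype_card (α := Bool), Fintype.card_bool]
  rfl

theorem colourMatrix_mul (d₁ d₂ : Diagram k) :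
    colourMatrix d₁ * colourMatrix d₂ =
      2 ^ Diagram.loops d₁ d₂ • colourMatrix (Diagram.comp d₁ d₂) := by
  classical
  ext a b
  have hsum : (colourMatrix d₁ * colourMatrix d₂) a b =
      Nat.card {c : Fin k → Bool // Compat d₁ (Sum.elim a c) ∧ Compat d₂ (Sum.elim c b)} := by
    simp only [Matrix.mul_apply, colourMatrix, Matrix.of_apply]
    rw [Nat.card_eq_fintype_card, Fintype.card_subtype, Finset.card_filter]
    refine Finset.sum_congr rfl fun c _ => ?_
    split_ifs <;> simp_all
  have e : {c : Fin k → Bool // Compat d₁ (Sum.elim a c) ∧ Compat d₂ (Sum.elim c b)} ≃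
      {f : Fin k ⊕ Fin k ⊕ Fin k → Bool //
        (Compat d₁ (f ∘ upper) ∧ Compat d₂ (f ∘ lower)) ∧ f ∘ outer = Sum.elim a b} :=
    { toFun := fun c => ⟨Sum.elim a (Sum.elim c.1 b), by
        refine ⟨⟨?_, ?_⟩, ?_⟩
        · convert c.2.1 using 1
          funext z; rcases z with z | z <;> rfl
        · exact c.2.2
        · funext z; rcases z with z | z <;> rfl⟩
      invFun := fun f => ⟨fun i => f.1 (.inr (.inl i)), by
        obtain ⟨f, ⟨h1, h2⟩, h3⟩ := f
        constructor
        · convert h1 using 1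
          funext z
          rcases z with z | z
          · exact (congrFun h3 (.inl z)).symm
          · rfl
        · convert h2 using 1
          funext z
          rcases z with z | z
          · rfl
          · exact (congrFun h3 (.inr z)).symm⟩
      left_inv := fun c => rfl
      right_inv := by
        rintro ⟨f, ⟨h1, h2⟩, h3⟩
        apply Subtype.ext
        funext z
        rcases z with z | z | z
        · exact (congrFun h3 (.inl z)).symm
        · rfl
        · exact (congrFun h3 (.inr z)).symm }
  rw [hsum, Nat.card_congr e]
  by_cases h : Compat (Diagram.comp d₁ d₂) (Sum.elim a b)
  · rw [card_colourings d₁ d₂ _ h]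
    simp [colourMatrix, h]
  · have : IsEmpty {f : Fin k ⊕ Fin k ⊕ Fin k → Bool //
        (Compat d₁ (f ∘ upper) ∧ Compat d₂ (f ∘ lower)) ∧ f ∘ outer = Sum.elim a b} := by
      refine ⟨fun f => h fun x => ?_⟩
      rw [← f.2.2]
      exact ((colouring_iff d₁ d₂ f.1).1 f.2.1 _ _ (Diagram.comp_reachable d₁ d₂ x)).symm
    simp [colourMatrix, h]

theorem colourMatrix_id : colourMatrix (Diagram.id k) = 1 := by
  classical
  ext a b
  simp only [colourMatrix, Matrix.of_apply, Matrix.one_apply]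
  congr 1
  simp only [Compat, Diagram.id, Sum.forall, Sum.swap_inl, Sum.elim_inl, Sum.elim_inr,
    Sum.swap_inr, eq_iff_iff]
  constructor
  · rintro ⟨h, -⟩; exact funext fun i => (h i).symm
  · rintro rfl; exact ⟨fun _ => rfl, fun _ => rfl⟩

theorem eq_of_colourMatrix {d d' : Diagram k} {p q : ℕ}
    (h : 2 ^ p • colourMatrix d = 2 ^ q • colourMatrix d') : p = q ∧ d = d' := by
  classical
  have hpt : ∀ f : Fin k ⊕ Fin k → Bool,
      2 ^ p * (if Compat d f then 1 else 0) = 2 ^ q * (if Compat d' f then 1 else 0) := by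
    intro f
    have := congrFun (congrFun h (f ∘ Sum.inl)) (f ∘ Sum.inr)
    simpa [colourMatrix, Sum.elim_comp_inl_inr] using this
  have hpq : p = q := by
    have := hpt fun _ => true
    simp only [Compat, implies_true, if_true, mul_one] at this
    exact Nat.pow_right_injective le_rfl this
  refine ⟨hpq, ?_⟩
  have hc : ∀ f, Compat d f → Compat d' f := by
    intro f hf
    by_contra hf'
    have := hpt f
    simp [hf, hf'] at this
  ext1
  funext x
  let f : Fin k ⊕ Fin k → Bool := fun y => decide (y = x ∨ y = d.mate x)
  have hf : Compat d f := by
    intro y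
    simp only [f, decide_eq_decide]
    constructor
    · rintro (h | h)
      · exact .inr (by rw [← h, d.mate_mate])
      · exact .inl (by rw [← d.mate_mate y, h, d.mate_mate])
    · rintro (rfl | rfl)
      · exact .inr rfl
      · exact .inl (d.mate_mate _)
  have h2 := hc f hf x
  simp only [f, decide_eq_decide, true_or, iff_true] at h2
  exact (h2.resolve_left (d'.mate_ne x)).symm

theorem Diagram.comp_assoc (d₁ d₂ d₃ : Diagram k) :
    Diagram.loops d₁ d₂ + Diagram.loops (Diagram.comp d₁ d₂) d₃ =
      Diagram.loops d₂ d₃ + Diagram.loops d₁ (Diagram.comp d₂ d₃) ∧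
    Diagram.comp (Diagram.comp d₁ d₂) d₃ = Diagram.comp d₁ (Diagram.comp d₂ d₃) := by
  apply eq_of_colourMatrix
  have := Matrix.mul_assoc (colourMatrix d₁) (colourMatrix d₂) (colourMatrix d₃)
  simpa only [colourMatrix_mul, Matrix.smul_mul, Matrix.mul_smul, smul_smul, ← pow_add] using this

theorem Diagram.id_comp (d : Diagram k) :
    Diagram.loops (Diagram.id k) d = 0 ∧ Diagram.comp (Diagram.id k) d = d := by
  apply eq_of_colourMatrix
  rw [← colourMatrix_mul, colourMatrix_id, Matrix.one_mul, pow_zero, one_smul]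

theorem Diagram.comp_id (d : Diagram k) :
    Diagram.loops d (Diagram.id k) = 0 ∧ Diagram.comp d (Diagram.id k) = d := by
  apply eq_of_colourMatrix
  rw [← colourMatrix_mul, colourMatrix_id, Matrix.mul_one, pow_zero, one_smul]

end Assoc

/-- The Brauer algebra `B_k(η)`: the vector space with basis the `k`-diagrams, with
`d₁ d₂ = η ^ (number of closed loops) • (d₁ above d₂)`. -/
def BrauerAlgebra (κ : Type*) [Field κ] (k : ℕ) (_η : κ) : Type _ := Diagram k →₀ κ

namespace BrauerAlgebra

variable {κ : Type*} [Field κ] {k : ℕ} {η : κ}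

noncomputable instance : AddCommGroup (BrauerAlgebra κ k η) :=
  inferInstanceAs (AddCommGroup (Diagram k →₀ κ))

noncomputable instance : Module κ (BrauerAlgebra κ k η) :=
  inferInstanceAs (Module κ (Diagram k →₀ κ))

/-- The basis of `B_k(η)` consisting of the diagrams. -/
noncomputable def basis (κ : Type*) [Field κ] (k : ℕ) (η : κ) :
    Module.Basis (Diagram k) κ (BrauerAlgebra κ k η) :=
  Module.Basis.ofRepr (LinearEquiv.refl κ (Diagram k →₀ κ))

/-- The diagram `d` as an element of `B_k(η)`. -/
noncomputable def ofDiagram (η : κ) (d : Diagram k) : BrauerAlgebra κ k η := basis κ k η d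

/-- The bilinear extension of the multiplication of diagrams. -/
noncomputable def mulLin :
    BrauerAlgebra κ k η →ₗ[κ] BrauerAlgebra κ k η →ₗ[κ] BrauerAlgebra κ k η :=
  (basis κ k η).constr κ fun d₁ => (basis κ k η).constr κ fun d₂ =>
    η ^ Diagram.loops d₁ d₂ • ofDiagram η (Diagram.comp d₁ d₂)

theorem mulLin_ofDiagram (d₁ d₂ : Diagram k) :
    mulLin (ofDiagram η d₁) (ofDiagram η d₂) =
      η ^ Diagram.loops d₁ d₂ • ofDiagram η (Diagram.comp d₁ d₂) := by
  unfold mulLin ofDiagram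
  rw [Module.Basis.constr_basis, Module.Basis.constr_basis]

theorem mulLin_assoc (x y z : BrauerAlgebra κ k η) :
    mulLin (mulLin x y) z = mulLin x (mulLin y z) := by
  have h : (mulLin (κ := κ) (k := k) (η := η)).compr₂ mulLin =
      (LinearMap.llcomp κ _ _ _).flip mulLin ∘ₗ LinearMap.llcomp κ _ _ _ ∘ₗ mulLin := by
    refine (basis κ k η).ext fun d₁ => (basis κ k η).ext fun d₂ => (basis κ k η).ext fun d₃ => ?_
    show mulLin (mulLin (ofDiagram η d₁) (ofDiagram η d₂)) (ofDiagram η d₃) =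
      mulLin (ofDiagram η d₁) (mulLin (ofDiagram η d₂) (ofDiagram η d₃))
    obtain ⟨h1, h2⟩ := Diagram.comp_assoc d₁ d₂ d₃
    simp only [mulLin_ofDiagram, map_smul, LinearMap.smul_apply, smul_smul, ← pow_add, h1, h2]
  exact LinearMap.congr_fun (LinearMap.congr_fun (LinearMap.congr_fun h x) y) z

noncomputable instance : Mul (BrauerAlgebra κ k η) := ⟨fun x y => mulLin x y⟩
noncomputable instance : One (BrauerAlgebra κ k η) := ⟨ofDiagram η (Diagram.id k)⟩

theorem mul_def (x y : BrauerAlgebra κ k η) : x * y = mulLin x y := rfl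

theorem ofDiagram_mul (d₁ d₂ : Diagram k) :
    ofDiagram η d₁ * ofDiagram η d₂ =
      η ^ Diagram.loops d₁ d₂ • ofDiagram η (Diagram.comp d₁ d₂) := mulLin_ofDiagram d₁ d₂

theorem one_mulLin (x : BrauerAlgebra κ k η) : mulLin 1 x = x := by
  have h : mulLin (1 : BrauerAlgebra κ k η) = LinearMap.id := by
    refine (basis κ k η).ext fun d => ?_
    show mulLin (ofDiagram η (Diagram.id k)) (ofDiagram η d) = ofDiagram η d
    rw [mulLin_ofDiagram, (Diagram.id_comp d).1, (Diagram.id_comp d).2, pow_zero, one_smul]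
  rw [h]; rfl

theorem mulLin_one (x : BrauerAlgebra κ k η) : mulLin x 1 = x := by
  have h : mulLin.flip (1 : BrauerAlgebra κ k η) = LinearMap.id := by
    refine (basis κ k η).ext fun d => ?_
    show mulLin (ofDiagram η d) (ofDiagram η (Diagram.id k)) = ofDiagram η d
    rw [mulLin_ofDiagram, (Diagram.comp_id d).1, (Diagram.comp_id d).2, pow_zero, one_smul]
  exact LinearMap.congr_fun h x

noncomputable instance : Ring (BrauerAlgebra κ k η) :=
  { (inferInstance : AddCommGroup (BrauerAlgebra κ k η)) with
    mul := (· * ·)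
    one := 1
    mul_assoc := mulLin_assoc
    one_mul := one_mulLin
    mul_one := mulLin_one
    left_distrib := fun x y z => map_add (mulLin x) y z
    right_distrib := fun x y z => by simp only [mul_def, map_add, LinearMap.add_apply]
    zero_mul := fun x => by simp only [mul_def, map_zero, LinearMap.zero_apply]
    mul_zero := fun x => map_zero (mulLin x) }

noncomputable instance : Algebra κ (BrauerAlgebra κ k η) :=
  Algebra.ofModule
    (fun r x y => by simp only [mul_def, map_smul, LinearMap.smul_apply])
    (fun r x y => map_smul (mulLin x) r y)

end BrauerAlgebra

/-! ### Graded spaces and the orthosymplectic Lie color algebra -/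

/-- A symmetric bicharacter on the abelian group `G` with values in `κ^*`. -/
structure SymmBicharacter (G κ : Type*) [CommGroup G] [Field κ] where
  toFun : G → G → κˣ
  mul_left : ∀ a b c, toFun (a * b) c = toFun a c * toFun b c
  mul_right : ∀ a b c, toFun a (b * c) = toFun a b * toFun a c
  symm : ∀ a b, toFun a b * toFun b a = 1

/-- The value `β(a, b)` as an element of the field. -/
def SymmBicharacter.val {G κ : Type*} [CommGroup G] [Field κ] (β : SymmBicharacter G κ)
    (a b : G) : κ := (β.toFun a b : κ)

section Color

variable {κ : Type*} [Field κ] {G : Type*} [CommGroup G]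
  {V : Type*} [AddCommGroup V] [Module κ V]

/-- A (nondegenerate) `β`-skew-symmetric bilinear form on `V = ⨁ V_a`. -/
structure IsSkewForm (β : SymmBicharacter G κ) (𝒱 : G → Submodule κ V)
    (ω : LinearMap.BilinForm κ V) : Prop where
  nondegenerate : ω.Nondegenerate
  eq_zero : ∀ a b, a ≠ b⁻¹ → ∀ v ∈ 𝒱 a, ∀ w ∈ 𝒱 b, ω v w = 0
  skew : ∀ a b, ∀ v ∈ 𝒱 a, ∀ w ∈ 𝒱 b, ω v w = -β.val b a * ω w v

/-- `gl(V, β)_a`: the endomorphisms that are homogeneous of degree `a`. -/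
def glDeg (𝒱 : G → Submodule κ V) (a : G) : Submodule κ (Module.End κ V) where
  carrier := {x | ∀ b, ∀ v ∈ 𝒱 b, x v ∈ 𝒱 (a * b)}
  add_mem' hx hy b v hv := add_mem (hx b v hv) (hy b v hv)
  zero_mem' _ _ _ := zero_mem _
  smul_mem' r _ hx b v hv := Submodule.smul_mem _ r (hx b v hv)

/-- `spo(V, β)_a`. -/
def spoDeg (β : SymmBicharacter G κ) (𝒱 : G → Submodule κ V) (ω : LinearMap.BilinForm κ V)
    (a : G) : Submodule κ (Module.End κ V) where
  carrier := {x | x ∈ glDeg 𝒱 a ∧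
    ∀ b, ∀ u ∈ 𝒱 b, ∀ v, ω (x u) v + β.val b a * ω u (x v) = 0}
  add_mem' {x y} hx hy := ⟨add_mem hx.1 hy.1, fun b u hu v => by
    have h1 := hx.2 b u hu v
    have h2 := hy.2 b u hu v
    simp only [LinearMap.add_apply, map_add]
    linear_combination h1 + h2⟩
  zero_mem' := ⟨zero_mem _, fun b u hu v => by simp⟩
  smul_mem' r x hx := ⟨Submodule.smul_mem _ r hx.1, fun b u hu v => by
    have h1 := hx.2 b u hu v
    simp only [LinearMap.smul_apply, map_smul, smul_eq_mul]
    linear_combination r * h1⟩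

/-- The (underlying graded space of the) orthosymplectic Lie color algebra
`spo(V, β) = ⨁ spo(V, β)_a` inside `gl(V, β) = End(V)`. -/
def spo (β : SymmBicharacter G κ) (𝒱 : G → Submodule κ V) (ω : LinearMap.BilinForm κ V) :
    Submodule κ (Module.End κ V) := ⨆ a, spoDeg β 𝒱 ω a

/-- `V_(0)`, the sum of the `V_a` with `β(a, a) = 1`. -/
def evenPart (β : SymmBicharacter G κ) (𝒱 : G → Submodule κ V) : Submodule κ V :=
  ⨆ (a : G) (_ : β.val a a = 1), 𝒱 a

/-- `V_(1)`, the sum of the `V_a` with `β(a, a) = -1`. -/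
def oddPart (β : SymmBicharacter G κ) (𝒱 : G → Submodule κ V) : Submodule κ V :=
  ⨆ (a : G) (_ : β.val a a = -1), 𝒱 a

/-- The degree `c` part of `V^{⊗N}`, spanned by the tensors `v₁ ⊗ ⋯ ⊗ v_N` of homogeneous
vectors whose degrees have product `c`. -/
def tensorDeg (𝒱 : G → Submodule κ V) (N : ℕ) (c : G) : Submodule κ (⨂[κ]^N V) :=
  Submodule.span κ {t | ∃ (g : Fin N → G) (v : Fin N → V),
    (∀ i, v i ∈ 𝒱 (g i)) ∧ ∏ i, g i = c ∧ t = PiTensorProduct.tprod κ v}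

variable [Fintype G] [DecidableEq G]
variable (β : SymmBicharacter G κ) (𝒱 : G → Submodule κ V) [DirectSum.Decomposition 𝒱]

/-- The projection of `V = ⨁ V_a` onto its degree `a` component. -/
def gproj (a : G) : Module.End κ V :=
  (𝒱 a).subtype ∘ₗ DirectSum.component κ G (fun i => 𝒱 i) a ∘ₗ
    (DirectSum.decomposeLinearEquiv 𝒱).toLinearMap

/-- The degree `a` component of an endomorphism, for the grading of `gl(V, β)`. -/
noncomputable def endProj (a : G) (x : Module.End κ V) : Module.End κ V :=
  ∑ b, gproj 𝒱 (a * b) ∘ₗ x ∘ₗ gproj 𝒱 b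

/-- The map `v ↦ β(b, a) v` for `v ∈ V_b`: the factor produced when an operator of degree `a`
moves past `v`. -/
noncomputable def twist (a : G) : Module.End κ V := ∑ b, β.val b a • gproj 𝒱 b

/-- The action on `V^{⊗N}` of `x ∈ gl(V, β)`: for `x` homogeneous of degree `a` and homogeneous
`v_j` of degrees `b_j`, `x (v₁ ⊗ ⋯ ⊗ v_N) = ∑ᵢ β(b₁ ⋯ b_{i-1}, a) v₁ ⊗ ⋯ ⊗ x vᵢ ⊗ ⋯ ⊗ v_N`. -/
noncomputable def tensorAct (N : ℕ) (x : Module.End κ V) : Module.End κ (⨂[κ]^N V) :=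
  ∑ a, ∑ i : Fin N, PiTensorProduct.map fun j =>
    if j < i then twist β 𝒱 a else if j = i then endProj 𝒱 a x else LinearMap.id

/-- `Hom_g(V^{⊗k}, V^{⊗k})` for `g = spo(V, β)`: the linear maps that preserve the grading and
commute with the action of `g`. -/
noncomputable def homG (ω : LinearMap.BilinForm κ V) (k : ℕ) :
    Subalgebra κ (Module.End κ (⨂[κ]^k V)) where
  carrier := {φ | (∀ c, ∀ t ∈ tensorDeg 𝒱 k c, φ t ∈ tensorDeg 𝒱 k c) ∧
    ∀ x ∈ spo β 𝒱 ω, ∀ t, φ (tensorAct β 𝒱 k x t) = tensorAct β 𝒱 k x (φ t)}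
  mul_mem' hφ hψ := ⟨fun c t ht => hφ.1 c _ (hψ.1 c t ht), fun x hx t => by
    simp only [Module.End.mul_apply, hφ.2 x hx, hψ.2 x hx]⟩
  add_mem' hφ hψ := ⟨fun c t ht => add_mem (hφ.1 c t ht) (hψ.1 c t ht), fun x hx t => by
    simp only [LinearMap.add_apply, hφ.2 x hx, hψ.2 x hx, map_add]⟩
  algebraMap_mem' r := ⟨fun c t ht => Submodule.smul_mem _ r ht, fun x _ t => by
    simp only [Module.algebraMap_end_apply, map_smul]⟩

/-! ### The braid group action -/

/-- Indices of adjacent transpositions of `N` positions. -/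
abbrev AdjIdx (N : ℕ) := {i : ℕ // i + 1 < N}

def AdjIdx.lo {N : ℕ} (i : AdjIdx N) : Fin N := ⟨i.1, Nat.lt_of_succ_lt i.2⟩
def AdjIdx.hi {N : ℕ} (i : AdjIdx N) : Fin N := ⟨i.1 + 1, i.2⟩

/-- The simple reflection exchanging two adjacent positions. -/
def adjSwap {N : ℕ} (i : AdjIdx N) : Equiv.Perm (Fin N) := Equiv.swap i.lo i.hi

/-- The operator `Ř_i = id ⊗ (-Ř_{V,V}) ⊗ id` on `V^{⊗N}`, where
`Ř_{V,V} (v ⊗ w) = β(b, a) w ⊗ v` for `v ∈ V_a` and `w ∈ V_b`, acting in the positions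
`i`, `i + 1`. -/
noncomputable def braid {N : ℕ} (i : AdjIdx N) : Module.End κ (⨂[κ]^N V) :=
  -∑ a, ∑ b, β.val b a •
    ((PiTensorProduct.reindex κ (fun _ : Fin N => V) (adjSwap i)).toLinearMap ∘ₗ
      PiTensorProduct.map fun j =>
        if j = i.lo then gproj 𝒱 a else if j = i.hi then gproj 𝒱 b else LinearMap.id)

/-- `w` is a reduced expression of `π`: a shortest product of simple reflections equal to `π`. -/
def IsReducedWord {N : ℕ} (w : List (AdjIdx N)) (π : Equiv.Perm (Fin N)) : Prop :=
  (w.map adjSwap).prod = π ∧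
    ∀ w' : List (AdjIdx N), (w'.map adjSwap).prod = π → w.length ≤ w'.length

theorem exists_word {N : ℕ} (π : Equiv.Perm (Fin N)) :
    ∃ w : List (AdjIdx N), (w.map adjSwap).prod = π := by
  rcases N with _ | N
  · exact ⟨[], Subsingleton.elim _ _⟩
  · have hπ : π ∈ Submonoid.closure
        (Set.range fun i : Fin N ↦ Equiv.swap i.castSucc i.succ) := by
      rw [Equiv.Perm.mclosure_swap_castSucc_succ]; trivial
    induction hπ using Submonoid.closure_induction with
    | mem x hx =>
      obtain ⟨i, rfl⟩ := hx
      exact ⟨[⟨i.1, by omega⟩], by simp only [List.map_cons, List.map_nil, List.prod_singleton]; rfl⟩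
    | one => exact ⟨[], rfl⟩
    | mul x y _ _ hx hy =>
      obtain ⟨w, rfl⟩ := hx
      obtain ⟨w', rfl⟩ := hy
      exact ⟨w ++ w', by simp⟩

theorem exists_reducedWord {N : ℕ} (π : Equiv.Perm (Fin N)) :
    ∃ w : List (AdjIdx N), IsReducedWord w π := by
  classical
  have h : ∃ n, ∃ w : List (AdjIdx N), (w.map adjSwap).prod = π ∧ w.length = n :=
    let ⟨w, hw⟩ := exists_word π; ⟨_, w, hw, rfl⟩
  obtain ⟨w, hw, hn⟩ := Nat.find_spec h
  exact ⟨w, hw, fun w' hw' => hn ▸ Nat.find_min' h ⟨w', hw', rfl⟩⟩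

/-- `Ř_π = Ř_{i₁} ⋯ Ř_{i_p}` for a reduced expression `π = s_{i₁} ⋯ s_{i_p}`. (The operator does
not depend on the choice of the reduced expression, because of the braid relations.) -/
noncomputable def braidPerm {N : ℕ} (π : Equiv.Perm (Fin N)) : Module.End κ (⨂[κ]^N V) :=
  ((exists_reducedWord π).choose.map (braid β 𝒱)).prod

/-- The set of left end points of the edges of a one-factor. -/
def OneFactor.lefts {k : ℕ} (f : OneFactor k) : Finset (Fin (k + k)) :=
  Finset.univ.filter fun x => x < f.mate x

theorem OneFactor.card_lefts {k : ℕ} (f : OneFactor k) : (OneFactor.lefts f).card = k := by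
  classical
  have h1 : (OneFactor.lefts f)ᶜ.card = (OneFactor.lefts f).card := by
    refine Finset.card_bij' (fun x _ => f.mate x) (fun x _ => f.mate x) ?_ ?_ ?_ ?_
    · intro x hx
      simp only [lefts, Finset.mem_compl, Finset.mem_filter, Finset.mem_univ, true_and] at hx ⊢
      rw [f.mate_mate]
      exact lt_of_le_of_ne (not_lt.1 hx) (f.mate_ne x)
    · intro x hx
      simp only [lefts, Finset.mem_compl, Finset.mem_filter, Finset.mem_univ, true_and] at hx ⊢
      rw [f.mate_mate]
      exact hx.not_gt
    · intro x _; exact f.mate_mate x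
    · intro x _; exact f.mate_mate x
  have h2 := Finset.card_add_card_compl (OneFactor.lefts f)
  rw [h1, Fintype.card_fin] at h2
  omega

/-- The left end points `ℓ₁ < ⋯ < ℓ_k` of the edges of a one-factor, in increasing order. -/
def OneFactor.left {k : ℕ} (f : OneFactor k) : Fin k ↪o Fin (k + k) :=
  (OneFactor.lefts f).orderEmbOfFin (OneFactor.card_lefts f)

theorem OneFactor.left_lt {k : ℕ} (f : OneFactor k) (i : Fin k) :
    OneFactor.left f i < f.mate (OneFactor.left f i) := by
  have := Finset.orderEmbOfFin_mem (OneFactor.lefts f) (OneFactor.card_lefts f) i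
  exact (Finset.mem_filter.1 this).2

/-- The sequence `(ℓ₁, …, ℓ_k, r_k, …, r₁)` for a one-factor with edges `(ℓᵢ, rᵢ)`. -/
def OneFactor.seq {k : ℕ} (f : OneFactor k) : Fin (k + k) → Fin (k + k) :=
  Fin.append (fun i => OneFactor.left f i) (fun i => f.mate (OneFactor.left f i.rev))

theorem OneFactor.seq_injective {k : ℕ} (f : OneFactor k) :
    Function.Injective (OneFactor.seq f) := by
  have hmate : Function.Injective f.mate := fun x y h => by
    rw [← f.mate_mate x, h, f.mate_mate]
  have hne : ∀ i j, OneFactor.left f i ≠ f.mate (OneFactor.left f j) := by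
    intro i j h
    have h1 := OneFactor.left_lt f i
    rw [h, f.mate_mate] at h1
    exact absurd h1 (OneFactor.left_lt f j).not_gt
  intro x y h
  induction x using Fin.addCases with
  | left i =>
    induction y using Fin.addCases with
    | left j =>
      simp only [seq, Fin.append_left] at h
      rw [(OneFactor.left f).injective h]
    | right j =>
      simp only [seq, Fin.append_left, Fin.append_right] at h
      exact absurd h (hne _ _)
  | right i =>
    induction y using Fin.addCases with
    | left j =>
      simp only [seq, Fin.append_left, Fin.append_right] at h
      exact absurd h.symm (hne _ _)
    | right j =>
      simp only [seq, Fin.append_right] at h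
      rw [Fin.rev_injective ((OneFactor.left f).injective (hmate h))]

/-- The permutation `π_f` of a one-factor `f`, sending `1, …, 2k` to `ℓ₁, …, ℓ_k, r_k, …, r₁`. -/
noncomputable def OneFactor.perm {k : ℕ} (f : OneFactor k) : Equiv.Perm (Fin (k + k)) :=
  Equiv.ofBijective (OneFactor.seq f) (Finite.injective_iff_bijective.1 (OneFactor.seq_injective f))

/-! ### The map `Ψ` -/

variable [FiniteDimensional κ V]

/-- The isomorphism `(V^*)^{⊗k} ≅ (V^{⊗k})^*` under which `f₁ ⊗ ⋯ ⊗ f_k` is the functional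
`v₁ ⊗ ⋯ ⊗ v_k ↦ f_k(v₁) ⋯ f₁(v_k)`; it comes from `(M ⊗ N)^* ≅ N^* ⊗ M^*`. -/
noncomputable def dualTensor (κ V : Type*) [Field κ] [AddCommGroup V] [Module κ V]
    [FiniteDimensional κ V] (k : ℕ) :
    (⨂[κ]^k (Module.Dual κ V)) ≃ₗ[κ] Module.Dual κ (⨂[κ]^k V) :=
  (PiTensorProduct.reindex κ (fun _ : Fin k => Module.Dual κ V) Fin.revPerm).trans
    (PiTensorProduct.dualDistribEquiv (R := κ) (M := fun _ : Fin k => V))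

/-- `1 → V^{⊗k} ⊗ (V^{⊗k})^* ≅ V^{⊗k} ⊗ (V^*)^{⊗k}`. -/
noncomputable def prTilde (κ V : Type*) [Field κ] [AddCommGroup V] [Module κ V]
    [FiniteDimensional κ V] (k : ℕ) :
    κ →ₗ[κ] (⨂[κ]^k V) ⊗[κ] (⨂[κ]^k (Module.Dual κ V)) :=
  LinearMap.lTensor (⨂[κ]^k V) (dualTensor κ V k).symm.toLinearMap ∘ₗ
    coevaluation κ (⨂[κ]^k V)

/-- `(V^*)^{⊗k} ⊗ V^{⊗k} ≅ (V^{⊗k})^* ⊗ V^{⊗k} → 1`. -/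
noncomputable def evTilde (κ V : Type*) [Field κ] [AddCommGroup V] [Module κ V]
    [FiniteDimensional κ V] (k : ℕ) :
    (⨂[κ]^k (Module.Dual κ V)) ⊗[κ] (⨂[κ]^k V) →ₗ[κ] κ :=
  contractLeft κ (⨂[κ]^k V) ∘ₗ
    LinearMap.rTensor (⨂[κ]^k V) (dualTensor κ V k).toLinearMap

/-- The isomorphism `F : V → V^*`, `v ↦ ⟨v, ·⟩`. -/
noncomputable def formIso (ω : LinearMap.BilinForm κ V) (hω : ω.Nondegenerate) :
    V ≃ₗ[κ] Module.Dual κ V := LinearMap.BilinForm.toDual ω hω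

/-- The map `Ψ_d`, as the composite
`V^{⊗k} ≅ 1 ⊗ V^{⊗k} → V^{⊗k} ⊗ (V^*)^{⊗k} ⊗ V^{⊗k} → V^{⊗2k} ⊗ V^{⊗k} → V^{⊗2k} ⊗ V^{⊗k}
  → V^{⊗k} ⊗ (V^*)^{⊗k} ⊗ V^{⊗k} → V^{⊗k} ⊗ 1 ≅ V^{⊗k}`. -/
noncomputable def Psi (ω : LinearMap.BilinForm κ V) (hω : ω.Nondegenerate) {k : ℕ}
    (d : Diagram k) : Module.End κ (⨂[κ]^k V) :=
  let F := formIso ω hω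
  let Fk : (⨂[κ]^k V) →ₗ[κ] ⨂[κ]^k (Module.Dual κ V) :=
    PiTensorProduct.map fun _ => F.toLinearMap
  let Fk' : (⨂[κ]^k (Module.Dual κ V)) →ₗ[κ] ⨂[κ]^k V :=
    PiTensorProduct.map fun _ => F.symm.toLinearMap
  let glue : (⨂[κ]^k V) ⊗[κ] (⨂[κ]^k V) ≃ₗ[κ] ⨂[κ]^(k + k) V := TensorPower.mulEquiv
  (TensorProduct.rid κ (⨂[κ]^k V)).toLinearMap ∘ₗ
  LinearMap.lTensor (⨂[κ]^k V) (evTilde κ V k) ∘ₗ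
  (TensorProduct.assoc κ (⨂[κ]^k V) (⨂[κ]^k (Module.Dual κ V)) (⨂[κ]^k V)).toLinearMap ∘ₗ
  LinearMap.rTensor (⨂[κ]^k V) (LinearMap.lTensor (⨂[κ]^k V) Fk ∘ₗ glue.symm.toLinearMap) ∘ₗ
  LinearMap.rTensor (⨂[κ]^k V) (braidPerm β 𝒱 (OneFactor.perm (unfold d))) ∘ₗ
  LinearMap.rTensor (⨂[κ]^k V) (glue.toLinearMap ∘ₗ LinearMap.lTensor (⨂[κ]^k V) Fk') ∘ₗ
  LinearMap.rTensor (⨂[κ]^k V) (prTilde κ V k) ∘ₗ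
  (TensorProduct.lid κ (⨂[κ]^k V)).symm.toLinearMap

end Color

/-! ### Weights of labelled diagrams -/

section Weight

variable {κ : Type*} [Field κ] {G : Type*} [CommGroup G] {ι : Type*} [Fintype ι] [DecidableEq ι]

/-- The weight of a crossing. The four ends of two crossing edges are counted off
counterclockwise from the bottom left corner of the diagram, and `x`, `y` are the last two of them,
in this order; `c x`, `c y` are the degrees of their labels. The weight is `-β(c x, c y)`, except
that it is `-β(c y, c x)` if `x` is a bottom vertex and `y` is a top vertex (i.e. for a vertical
edge crossing a horizontal edge on the bottom). -/
def crossingWeight (β : SymmBicharacter G κ) {k : ℕ} (c : Fin k ⊕ Fin k → G) :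
    Fin k ⊕ Fin k → Fin k ⊕ Fin k → κ
  | .inr x, .inl y => -β.val (c (.inl y)) (c (.inr x))
  | x, y => -β.val (c x) (c y)

open Classical in
/-- The weight `d_{a,b}` of the `k`-diagram `d` whose top vertices are labelled by the basis
elements with indices `a` and whose bottom vertices are labelled by those with indices `b`. The
`i`-th basis element has degree `c i`, and `F` is the matrix of the form in this basis.

The factors are the weights of the horizontal edges on the top, of the horizontal edges on the
bottom, of the vertical edges, and of the crossings. Two edges cross precisely if their ends
alternate along the boundary; the crossings are indexed by the pairs `p = (x, y)` of the first two
ends of the two edges in counterclockwise order from the bottom left corner. -/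
noncomputable def weight (β : SymmBicharacter G κ) (F : Matrix ι ι κ) (c : ι → G) {k : ℕ}
    (d : Diagram k) (a b : Fin k → ι) : κ :=
  (∏ p : Fin k × Fin k with p.1 < p.2 ∧ d.mate (.inl p.1) = .inl p.2, F (a p.1) (a p.2)) *
  (∏ p : Fin k × Fin k with p.1 < p.2 ∧ d.mate (.inr p.1) = .inr p.2, F⁻¹ (b p.1) (b p.2)) *
  (∏ p : Fin k × Fin k with d.mate (.inl p.1) = .inr p.2, if a p.1 = b p.2 then 1 else 0) *
  (∏ p : (Fin k ⊕ Fin k) × (Fin k ⊕ Fin k) with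
      unfoldVertex k p.1 < unfoldVertex k p.2 ∧
      unfoldVertex k p.2 < unfoldVertex k (d.mate p.1) ∧
      unfoldVertex k (d.mate p.1) < unfoldVertex k (d.mate p.2),
    crossingWeight β (c ∘ Sum.elim a b) (d.mate p.1) (d.mate p.2))

end Weight

end SpoColor

open SpoColor
open scoped TensorProduct

/-! Fix a homogeneous basis of V with Gram matrix F and put K = F⁻¹. A matching f of points on a
line defines a tensor whose coefficient at a labelling is the product of the entries of K over the
edges, read from left to right, and of factors -β over the crossings (`coeff`). The pivotal fact is
that the braid generator Ř_i carries the tensor of f to that of s_i f (`coeff_relabel_swap`): if i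
and i+1 are not joined, the swap creates or removes exactly one crossing, and if they are joined, f
is unchanged and K is β-skew.

The coevaluation followed by F⁻¹ is the tensor of the nested matching (`nested_cups`), and π_d
carries the nested matching to the unfolding of d (`relabel_perm_nested`). Hence Ř_d produces the
tensor of the unfolded diagram, for any word representing π_d. Evaluation then contracts the top
labels with the input through F, which gives the matrix of Ψ_d (`Psi_tprod`). Carrying out the sum
over the intermediate top labels, where KF = 1 collapses most of the factors, yields the
combinatorial weight (`psiEntry_eq_weight`).

For multiplicativity and equivariance it suffices to multiply by generators
(`BrauerAlgebra.ofDiagram_induction`): the adjacent transpositions and one cup-cap diagram at the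
first two vertices. Composition with a transposition is Ř_i. Composition with the cup-cap contracts
two positions by F and inserts K; on a matching tensor this splices the matching (`capCup_coeff`),
because the partners of the two positions can be slid next to them by braid generators, after which
FK = 1 applies. A closed loop contributes the sum of F_{uw} K_{uw} over u and w, which equals -∑
β(c,c) over the degrees c of the basis vectors, that is n - m (`loopValue_eq`). On the diagram side
the same products are found by comparing two-colouring matrices.

Equivariance now concerns only Ř_i (`actCoord_swap`) and the contraction (`actCoord_capCup`). The
former commutes with the action because β is a symmetric bicharacter, the latter because F, and
hence K, is invariant under spo(V, β). -/

namespace SpoColor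

/-! ### Coefficients of the tensor attached to a matching -/

/-- Transport of a matching along a bijection of the vertices. -/
def Matching.relabel {X Y : Type*} (e : X ≃ Y) (f : Matching X) : Matching Y where
  mate y := e (f.mate (e.symm y))
  mate_mate y := by simp [f.mate_mate]
  mate_ne y h := f.mate_ne (e.symm y) (by rw [Equiv.eq_symm_apply]; exact h)

theorem Matching.relabel_mate {X Y : Type*} (e : X ≃ Y) (f : Matching X) (y : Y) :
    (f.relabel e).mate y = e (f.mate (e.symm y)) := rfl

theorem Matching.mate_injective {X : Type*} (f : Matching X) : Function.Injective f.mate :=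
  fun x y h => by rw [← f.mate_mate x, h, f.mate_mate]

theorem Matching.mate_eq_iff {X : Type*} (f : Matching X) {x y : X} :
    f.mate x = y ↔ x = f.mate y :=
  ⟨fun h => by rw [← h, f.mate_mate], fun h => by rw [h, f.mate_mate]⟩

theorem Matching.relabel_relabel {X Y Z : Type*} (e : X ≃ Y) (e' : Y ≃ Z) (f : Matching X) :
    (f.relabel e).relabel e' = f.relabel (e.trans e') := rfl

theorem Matching.relabel_refl {X : Type*} (f : Matching X) : f.relabel (Equiv.refl X) = f := rfl

/-! ### Identities for symmetric bicharacters. -/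

section Bichar

variable {κ : Type*} [Field κ] {G : Type*} [CommGroup G] (β : SymmBicharacter G κ)

namespace SymmBicharacter

theorem val_mul_left (a b c : G) : β.val (a * b) c = β.val a c * β.val b c := by
  simp [val, β.mul_left]

theorem val_mul_right (a b c : G) : β.val a (b * c) = β.val a b * β.val a c := by
  simp [val, β.mul_right]

theorem val_mul_val_symm (a b : G) : β.val a b * β.val b a = 1 := by
  rw [val, val, ← Units.val_mul, β.symm, Units.val_one]

theorem val_ne_zero (a b : G) : β.val a b ≠ 0 := (β.toFun a b).ne_zero

theorem val_one_left (a : G) : β.val 1 a = 1 := by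
  have h := β.val_mul_left 1 1 a
  rw [one_mul] at h
  exact mul_left_cancel₀ (β.val_ne_zero 1 a) (by rw [mul_one, ← h])

theorem val_one_right (a : G) : β.val a 1 = 1 := by
  have h := β.val_mul_val_symm a 1
  rwa [val_one_left, mul_one] at h

theorem val_inv_left (a b : G) : β.val a⁻¹ b = β.val b a := by
  have h : β.val a b * β.val a⁻¹ b = 1 := by
    rw [← val_mul_left, mul_inv_cancel, val_one_left]
  exact mul_left_cancel₀ (β.val_ne_zero a b) (by rw [h, val_mul_val_symm])

theorem val_inv_right (a b : G) : β.val a b⁻¹ = β.val b a := by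
  have h : β.val a b * β.val a b⁻¹ = 1 := by
    rw [← val_mul_right, mul_inv_cancel, val_one_right]
  exact mul_left_cancel₀ (β.val_ne_zero a b) (by rw [h, val_mul_val_symm])

end SymmBicharacter

end Bichar

/-! ### Order and crossings under an adjacent transposition. -/

section Swap

variable {N : ℕ}

theorem swap_lt_swap_iff {i j : Fin N} (hij : i.val + 1 = j.val) (p q : Fin N) :
    Equiv.swap i j p < Equiv.swap i j q ↔ (p < q ∧ ¬ (p = i ∧ q = j)) ∨ (p = j ∧ q = i) := by
  simp only [Equiv.swap_apply_def]
  split_ifs <;> simp only [Fin.ext_iff, Fin.lt_def] at * <;> omega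

/-- The edges through the neighbouring vertices `i`, `j` are different and cross each other; their
first two ends are `p` and `q`. -/
def CrossAt (f : Matching (Fin N)) (i j p q : Fin N) : Prop :=
  (p < q ∧ q < f.mate p ∧ f.mate p < f.mate q) ∧
    ((p = i ∧ q = j) ∨ (q = i ∧ f.mate p = j) ∨ (f.mate p = i ∧ f.mate q = j))

/-- Exchanging two neighbouring ends of distinct edges toggles whether the four ends alternate, so
the two edges cross either before or after the swap. The cases are the possible positions of the
partners of `i` and `j`. -/
theorem exists_crossAt {i j : Fin N} (hij : i.val + 1 = j.val) (f : Matching (Fin N))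
    (h : f.mate i ≠ j) :
    (∃ p q, CrossAt f i j p q) ∨ ∃ p q, CrossAt (f.relabel (Equiv.swap i j)) i j p q := by
  have hi := f.mate_ne i
  have hj := f.mate_ne j
  have hne : f.mate i ≠ f.mate j := fun h' => by
    have := f.mate_injective h'; subst this; omega
  have hji : f.mate j ≠ i := fun h' => h (by rw [← h', f.mate_mate])
  have hsi : (f.relabel (Equiv.swap i j)).mate i = f.mate j := by
    simp [Matching.relabel, Equiv.swap_apply_of_ne_of_ne hji hj]
  have hsj : (f.relabel (Equiv.swap i j)).mate j = f.mate i := by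
    simp [Matching.relabel, Equiv.swap_apply_of_ne_of_ne hi h]
  have hi' := f.mate_mate i
  have hj' := f.mate_mate j
  have hsi' := (f.relabel (Equiv.swap i j)).mate_eq_iff.1 hsi
  have hsj' := (f.relabel (Equiv.swap i j)).mate_eq_iff.1 hsj
  unfold CrossAt
  simp only [ne_eq, Fin.ext_iff] at hi hj hne hji h
  rcases lt_or_gt_of_ne hne with h1 | h1 <;> rcases lt_or_gt_of_ne hi with h2 | h2 <;>
    rcases lt_or_gt_of_ne hj with h3 | h3
  · exact .inl ⟨f.mate i, f.mate j, by simp only [Fin.lt_def, hi', hj', and_self, or_true, and_true]; omega⟩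
  · exact .inr ⟨f.mate i, i, by simp only [Fin.lt_def, ← hsj', hsi, and_self, or_true, and_true, true_or]; omega⟩
  · omega
  · exact .inl ⟨i, j, by simp only [Fin.lt_def, and_self, true_or, and_true]; omega⟩
  · exact .inr ⟨f.mate j, f.mate i, by simp only [Fin.lt_def, ← hsj', ← hsi', and_self, or_true, and_true]; omega⟩
  · omega
  · exact .inl ⟨f.mate j, i, by simp only [Fin.lt_def, hj', and_self, true_or, or_true, and_true]; omega⟩
  · exact .inr ⟨i, j, by simp only [Fin.lt_def, hsi, hsj, and_self, true_or, and_true]; omega⟩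

/-- An adjacent swap reverses the order of no pair other than its own, so it removes the crossing at
`i`, `j` and leaves every other crossing, with its order of ends, intact. -/
theorem crossAt_relabel_iff {i j : Fin N} (hij : i.val + 1 = j.val) (f : Matching (Fin N))
    {p₀ q₀ : Fin N} (h : CrossAt f i j p₀ q₀) (p q : Fin N) :
    (Equiv.swap i j p < Equiv.swap i j q ∧ Equiv.swap i j q < Equiv.swap i j (f.mate p) ∧
      Equiv.swap i j (f.mate p) < Equiv.swap i j (f.mate q)) ↔
    (p < q ∧ q < f.mate p ∧ f.mate p < f.mate q) ∧ ¬ (p = p₀ ∧ q = q₀) := by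
  simp only [swap_lt_swap_iff hij]
  have e := f.mate_mate
  obtain ⟨⟨a1, a2, a3⟩, h⟩ := h
  rcases h with ⟨rfl, rfl⟩ | ⟨rfl, h2⟩ | ⟨h1, h2⟩
  · grind
  · grind
  · grind

end Swap

/-! ### Weights of labelled matchings and their behaviour under adjacent swaps. -/

section Coeff

variable {κ : Type*} [Field κ] {G : Type*} [CommGroup G] (β : SymmBicharacter G κ)
  {ι : Type*} (K : Matrix ι ι κ) (c : ι → G) {N : ℕ}

/-- The product of the weights of all edges, read from left to right. -/
def edgeProd (f : Matching (Fin N)) (l : Fin N → ι) : κ :=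
  ∏ x : Fin N with x < f.mate x, K (l x) (l (f.mate x))

/-- The product of the weights of all crossings. -/
def crossProd (f : Matching (Fin N)) (l : Fin N → ι) : κ :=
  ∏ p : Fin N × Fin N with p.1 < p.2 ∧ p.2 < f.mate p.1 ∧ f.mate p.1 < f.mate p.2,
    -β.val (c (l (f.mate p.1))) (c (l (f.mate p.2)))

/-- The coefficient at the labelling `l` of the tensor attached to the matching `f`. -/
def coeff (f : Matching (Fin N)) (l : Fin N → ι) : κ :=
  edgeProd K f l * crossProd β c f l

variable {K c}

/-- The labels joined by `K` have inverse degrees, and `K` is `β`-skew. -/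
structure IsSkewMatrix (K : Matrix ι ι κ) (c : ι → G) : Prop where
  deg : ∀ i j, K i j ≠ 0 → c j = (c i)⁻¹
  skew : ∀ i j, K i j = -β.val (c j) (c i) * K j i

variable {β}

/-- On the support of the coefficient a crossing weight can be read off at either end of an edge,
since passing to the partner inverts the degree. -/
theorem deg_mate_of_edgeProd_ne_zero (hK : IsSkewMatrix β K c) {f : Matching (Fin N)}
    {l : Fin N → ι} (h : edgeProd K f l ≠ 0) (x : Fin N) : c (l (f.mate x)) = (c (l x))⁻¹ := by
  have h' := Finset.prod_ne_zero_iff.1 h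
  rcases lt_or_gt_of_ne (f.mate_ne x) with hx | hx
  · have := hK.deg _ _ (h' (f.mate x) (by simpa [f.mate_mate] using hx))
    rw [f.mate_mate] at this
    rw [this, inv_inv]
  · exact hK.deg _ _ (h' x (by simpa using hx))

theorem edgeProd_relabel_swap {i j : Fin N} (hij : i.val + 1 = j.val) (f : Matching (Fin N))
    (h : f.mate i ≠ j) (l : Fin N → ι) :
    edgeProd K (f.relabel (Equiv.swap i j)) l = edgeProd K f (l ∘ Equiv.swap i j) := by
  unfold edgeProd
  refine (Finset.prod_equiv (Equiv.swap i j) ?_ ?_).symm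
  · intro x
    have hx : ¬ (x = i ∧ f.mate x = j) := by rintro ⟨rfl, h2⟩; exact h h2
    have hx' : ¬ (x = j ∧ f.mate x = i) := by
      rintro ⟨rfl, h2⟩; exact h (by rw [← h2, f.mate_mate])
    rw [Finset.mem_filter, Finset.mem_filter]
    simp only [Finset.mem_univ, true_and, Matching.relabel_mate,
      Equiv.symm_swap, Equiv.swap_apply_self, swap_lt_swap_iff hij, hx, hx', not_false_eq_true,
      and_true, or_false]
  · intro x _
    simp [Matching.relabel_mate]

/-- The swap destroys exactly one crossing, whose weight is inverse to the factor on the right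
because β(a,b)β(b,a) = 1. -/
theorem coeff_relabel_swap_of_crossAt (hK : IsSkewMatrix β K c) {i j : Fin N}
    (hij : i.val + 1 = j.val) (f : Matching (Fin N)) {p q : Fin N} (h : CrossAt f i j p q)
    (l : Fin N → ι) :
    coeff β K c (f.relabel (Equiv.swap i j)) l =
      -β.val (c (l i)) (c (l j)) * coeff β K c f (l ∘ Equiv.swap i j) := by
  classical
  set s := Equiv.swap i j with hs
  have hne : i ≠ j := by rintro rfl; omega
  have hfij : f.mate i ≠ j := by
    obtain ⟨⟨a1, a2, a3⟩, h⟩ := h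
    have e := f.mate_mate
    rcases h with ⟨rfl, rfl⟩ | ⟨rfl, h2⟩ | ⟨h1, h2⟩ <;> grind
  -- Where the edge product vanishes both sides are zero; elsewhere partners have inverse degrees.
  by_cases h0 : edgeProd K f (l ∘ s) = 0
  · rw [coeff, coeff, edgeProd_relabel_swap hij f hfij, h0]; ring
  have hdeg := deg_mate_of_edgeProd_ne_zero hK h0
  have hcross : crossProd β c f (l ∘ s) =
      -β.val (c (l j)) (c (l i)) * crossProd β c (f.relabel s) l := by
    have h1 : crossProd β c (f.relabel s) l =
        ∏ p ∈ ({p : Fin N × Fin N | p.1 < p.2 ∧ p.2 < f.mate p.1 ∧ f.mate p.1 < f.mate p.2}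
          : Finset _).erase (p, q),
          -β.val (c ((l ∘ s) (f.mate p.1))) (c ((l ∘ s) (f.mate p.2))) := by
      unfold crossProd
      refine (Finset.prod_equiv (Equiv.prodCongr s s) ?_ ?_).symm
      · rintro ⟨x, y⟩
        have := crossAt_relabel_iff hij f h x y
        rw [Finset.mem_erase, Finset.mem_filter, Finset.mem_filter]
        simp only [ne_eq, Prod.mk.injEq, Finset.mem_univ, true_and, Matching.relabel_mate, Equiv.prodCongr_apply, Prod.map_apply,
          Equiv.symm_apply_apply]
        rw [this, and_comm]
      · rintro ⟨x, y⟩ _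
        simp [Matching.relabel_mate]
    rw [h1, crossProd, ← Finset.mul_prod_erase _ _ (a := (p, q)) (by simpa using h.1)]
    congr 1
    -- The crossing weight refers to the last two ends, while `i`, `j` may be the first, the middle
    -- or the last two. Passing to a partner in one argument transposes β, and doing so in both
    -- restores it.
    obtain ⟨-, ⟨rfl, rfl⟩ | ⟨rfl, h2⟩ | ⟨h1, h2⟩⟩ := h
    · rw [hdeg p, hdeg q, β.val_inv_left, β.val_inv_left]
      simp [hs]
    · rw [hdeg q, h2, β.val_inv_right]
      simp [hs]
    · rw [h1, h2]
      simp [hs]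
  rw [coeff, coeff, edgeProd_relabel_swap hij f hfij, hcross]
  linear_combination (-(edgeProd K f (l ∘ s) * crossProd β c (f.relabel s) l)) *
    β.val_mul_val_symm (c (l i)) (c (l j))

/-- In coordinates this says that a braid generator maps the tensor of a matching to the tensor of
the permuted matching. -/
theorem coeff_relabel_swap (hK : IsSkewMatrix β K c) {i j : Fin N}
    (hij : i.val + 1 = j.val) (f : Matching (Fin N)) (l : Fin N → ι) :
    coeff β K c (f.relabel (Equiv.swap i j)) l =
      -β.val (c (l i)) (c (l j)) * coeff β K c f (l ∘ Equiv.swap i j) := by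
  classical
  have hne : i ≠ j := by rintro rfl; omega
  by_cases hfij : f.mate i = j
  · have hfji : f.mate j = i := by rw [← hfij, f.mate_mate]
    have hf : f.relabel (Equiv.swap i j) = f := by
      ext1; funext x
      simp only [Matching.relabel, Equiv.symm_swap]
      by_cases hxi : x = i
      · subst hxi; simp [hfij, hfji]
      by_cases hxj : x = j
      · subst hxj; simp [hfij, hfji]
      rw [Equiv.swap_apply_of_ne_of_ne hxi hxj, Equiv.swap_apply_of_ne_of_ne]
      · rw [Ne, f.mate_eq_iff, hfij]; exact hxj
      · rw [Ne, f.mate_eq_iff, hfji]; exact hxi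
    have hswap : ∀ x, x ≠ i → x ≠ j → (l ∘ Equiv.swap i j) x = l x := fun x h1 h2 => by
      simp [Equiv.swap_apply_of_ne_of_ne h1 h2]
    have hedge : edgeProd K f l = -β.val (c (l j)) (c (l i)) *
        edgeProd K f (l ∘ Equiv.swap i j) := by
      have hmem : i ∈ ({x : Fin N | x < f.mate x} : Finset _) := by
        rw [Finset.mem_filter, hfij, Fin.lt_def]; simp [← hij]
      rw [edgeProd, edgeProd, ← Finset.mul_prod_erase _ _ hmem, ← Finset.mul_prod_erase _ _ hmem,
        ← mul_assoc]
      congr 1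
      · rw [hfij, hK.skew]; simp
      · refine Finset.prod_congr rfl fun x hx => ?_
        simp only [Finset.mem_erase, Finset.mem_filter, Finset.mem_univ, true_and] at hx
        have hxj : x ≠ j := by
          rintro rfl; rw [hfji] at hx; have := hx.2; rw [Fin.lt_def] at this; omega
        rw [hswap x hx.1 hxj, hswap]
        · exact fun h => hxj (by rw [← hfij, ← h, f.mate_mate])
        · exact fun h => hx.1 (by rw [← hfji, ← h, f.mate_mate])
    have hcross : crossProd β c f l = crossProd β c f (l ∘ Equiv.swap i j) := by
      refine Finset.prod_congr rfl fun p hp => ?_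
      simp only [Finset.mem_filter, Finset.mem_univ, true_and, Fin.lt_def] at hp
      have e := f.mate_mate
      rw [hswap (f.mate p.1), hswap (f.mate p.2)] <;> grind
    -- Skewness of `K` gives β with its arguments in the wrong order; as the two degrees are inverse
    -- to each other, both orders give β(x,x).
    by_cases h0 : edgeProd K f (l ∘ Equiv.swap i j) = 0
    · rw [hf, coeff, coeff, hedge, h0]; ring
    · have := deg_mate_of_edgeProd_ne_zero hK h0 i
      rw [hfij] at this
      simp only [Function.comp_apply, Equiv.swap_apply_left, Equiv.swap_apply_right] at this
      rw [hf, coeff, coeff, hedge, hcross, this, β.val_inv_left, β.val_inv_right]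
      ring
  · rcases exists_crossAt hij f hfij with ⟨p, q, h⟩ | ⟨p, q, h⟩
    · exact coeff_relabel_swap_of_crossAt hK hij f h l
    -- If the crossing appears only after the swap, the crossing case is applied to the swapped
    -- matching and solved for the other coefficient.
    · have := coeff_relabel_swap_of_crossAt hK hij _ h (l ∘ Equiv.swap i j)
      have h2 : (f.relabel (Equiv.swap i j)).relabel (Equiv.swap i j) = f := by
        rw [Matching.relabel_relabel]
        simp [← Equiv.Perm.mul_def, Equiv.Perm.one_def, Matching.relabel_refl]
      have h3 : (l ∘ Equiv.swap i j) ∘ Equiv.swap i j = l := by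
        funext x; simp
      rw [h2, h3] at this
      rw [this]
      simp only [Function.comp_apply, Equiv.swap_apply_left, Equiv.swap_apply_right]
      linear_combination (-(coeff β K c (f.relabel (Equiv.swap i j)) l)) *
        β.val_mul_val_symm (c (l i)) (c (l j))

end Coeff

/-! ### Contraction of two vertices -/

section Splice

variable {X : Type*} [DecidableEq X]

/-- The matching obtained from `f` by joining `p` to `q` and the former partners of `p` and `q`
to each other. -/
def Matching.splice (f : Matching X) (p q : X) (hpq : p ≠ q) : Matching X where
  mate x := if x = p then q else if x = q then p else if x = f.mate p then f.mate q else
    if x = f.mate q then f.mate p else f.mate x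
  mate_mate x := by
    have := f.mate_mate
    have := f.mate_ne
    grind
  mate_ne x := by
    have := f.mate_mate
    have := f.mate_ne
    grind

theorem Matching.splice_mate (f : Matching X) (p q : X) (hpq : p ≠ q) (x : X) :
    (f.splice p q hpq).mate x = if x = p then q else if x = q then p else
      if x = f.mate p then f.mate q else if x = f.mate q then f.mate p else f.mate x := rfl

theorem Matching.splice_eq_self (f : Matching X) (p q : X) (hpq : p ≠ q) (h : f.mate p = q) :
    f.splice p q hpq = f := by
  have := f.mate_mate
  ext1; funext x
  rw [f.splice_mate]
  grind

theorem Matching.relabel_splice {Y : Type*} [DecidableEq Y] (e : X ≃ Y) (f : Matching X) (p q : X)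
    (hpq : p ≠ q) :
    (f.splice p q hpq).relabel e = (f.relabel e).splice (e p) (e q) (e.injective.ne hpq) := by
  ext1; funext y
  obtain ⟨x, rfl⟩ := e.surjective y
  simp only [Matching.relabel_mate, Matching.splice_mate, Equiv.symm_apply_apply, apply_ite e,
    e.injective.eq_iff]

end Splice

section Contract

variable {κ : Type*} [Field κ] {G : Type*} [CommGroup G] {β : SymmBicharacter G κ}
  {ι : Type*} [Fintype ι] {K F : Matrix ι ι κ} {c : ι → G} {N : ℕ}

/-- The labelling `l` with the labels of `p` and `q` replaced by `u` and `w`. -/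
def relabelTwo (l : Fin N → ι) (p q : Fin N) (u w : ι) : Fin N → ι :=
  Function.update (Function.update l p u) q w

theorem relabelTwo_apply (l : Fin N → ι) (p q : Fin N) (u w : ι) (x : Fin N) :
    relabelTwo l p q u w x = if x = q then w else if x = p then u else l x := by
  simp [relabelTwo, Function.update_apply]

/-- Contraction of the tensor with coefficients `φ` in the positions `p`, `q` by `F`, followed by
insertion of `K` in these positions. -/
def capCup (K F : Matrix ι ι κ) (p q : Fin N) (φ : (Fin N → ι) → κ) (l : Fin N → ι) : κ :=
  K (l p) (l q) * ∑ u, ∑ w, F u w * φ (relabelTwo l p q u w)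

/-- A swap away from `p` and `q` does not interact with the contraction there; `θ` stands for the
braid factor. -/
theorem capCup_comp_swap {p q i j : Fin N} (hip : i ≠ p) (hiq : i ≠ q) (hjp : j ≠ p)
    (hjq : j ≠ q) (θ : ι → ι → κ) (φ : (Fin N → ι) → κ) (l : Fin N → ι) :
    capCup K F p q (fun l => θ (l i) (l j) * φ (l ∘ Equiv.swap i j)) l =
      θ (l i) (l j) * capCup K F p q φ (l ∘ Equiv.swap i j) := by
  have h : ∀ u w, relabelTwo l p q u w ∘ Equiv.swap i j =
      relabelTwo (l ∘ Equiv.swap i j) p q u w := by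
    intro u w
    funext x
    have hq : Equiv.swap i j x = q ↔ x = q := by
      rw [Equiv.swap_apply_eq_iff, Equiv.swap_apply_of_ne_of_ne hiq.symm hjq.symm]
    have hp : Equiv.swap i j x = p ↔ x = p := by
      rw [Equiv.swap_apply_eq_iff, Equiv.swap_apply_of_ne_of_ne hip.symm hjp.symm]
    simp only [Function.comp_apply, relabelTwo_apply, hq, hp]
  simp only [capCup, h, relabelTwo_apply, hip, hiq, hjp, hjq, if_false, Function.comp_apply,
    Equiv.swap_apply_of_ne_of_ne hip.symm hjp.symm, Equiv.swap_apply_of_ne_of_ne hiq.symm hjq.symm,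
    Finset.mul_sum]
  refine Finset.sum_congr rfl fun u _ => Finset.sum_congr rfl fun w _ => ?_
  ring

/-- The first four points carry the nested edges 0–3 and 1–2, and after splicing the edges 0–1 and
2–3. Neither pair takes part in a crossing, so only the edge weights change, and these are governed
by FK = 1. -/
theorem capCup_coeff_of_nested [DecidableEq ι] (hFK : F * K = 1) {p q r s : Fin N} (hp : p.val = 0)
    (hq : q.val = 1) (hr : r.val = 2) (hs : s.val = 3) (hpq : p ≠ q) (f : Matching (Fin N))
    (hf : f.mate q = r) (hf' : f.mate p = s) (l : Fin N → ι) :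
    capCup K F p q (coeff β K c f) l = coeff β K c (f.splice p q hpq) l := by
  have e := f.mate_mate
  have hrq : f.mate r = q := by rw [← hf, e]
  have hsp : f.mate s = p := by rw [← hf', e]
  have small : ∀ x : Fin N, x.val < 4 → x = p ∨ x = q ∨ x = r ∨ x = s := by
    intro x hx; simp only [Fin.ext_iff]; omega
  have big : ∀ x : Fin N, 4 ≤ x.val ↔ x ≠ p ∧ x ≠ q ∧ x ≠ r ∧ x ≠ s := by
    intro x; simp only [Fin.ext_iff, ne_eq]; omega
  have hbig : ∀ x : Fin N, 4 ≤ x.val → 4 ≤ (f.mate x).val := by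
    intro x hx
    rw [big] at hx ⊢
    grind
  have hg : ∀ x : Fin N, 4 ≤ x.val → (f.splice p q hpq).mate x = f.mate x := by
    intro x hx
    rw [big] at hx
    rw [Matching.splice_mate]
    grind
  have hgp : (f.splice p q hpq).mate p = q := by simp [Matching.splice_mate]
  have hgq : (f.splice p q hpq).mate q = p := by simp [Matching.splice_mate, hpq.symm]
  have hgr : (f.splice p q hpq).mate r = s := by
    rw [Matching.splice_mate, hf, hf', if_neg, if_neg, if_neg, if_pos rfl] <;>
      simp only [Fin.ext_iff] <;> omega
  have hgs : (f.splice p q hpq).mate s = r := by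
    rw [Matching.splice_mate, hf, hf', if_neg, if_neg, if_pos rfl] <;>
      simp only [Fin.ext_iff] <;> omega
  set g := f.splice p q hpq with hgdef
  have hbig' : ∀ x : Fin N, 4 ≤ x.val → 4 ≤ (g.mate x).val := by
    intro x hx; rw [hg x hx]; exact hbig x hx
  set rest : Finset (Fin N) := {x | 4 ≤ x.val ∧ x < f.mate x} with hrest
  have lt : ∀ x y : Fin N, x < y ↔ x.val < y.val := fun _ _ => Iff.rfl
  have hfilt : ({x : Fin N | x < f.mate x} : Finset _) = insert p (insert q rest) := by
    ext x
    rw [Finset.mem_insert, Finset.mem_insert, Finset.mem_filter, Finset.mem_filter]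
    by_cases hx : 4 ≤ x.val
    · have := (big x).1 hx
      simp [hx, this.1, this.2.1]
    · rcases small x (by omega) with rfl | rfl | rfl | rfl
      · simp only [hf', lt, Finset.mem_univ]; simp; omega
      · simp only [hf, lt, Finset.mem_univ]; simp; omega
      · simp only [hrq, lt, Finset.mem_univ, Fin.ext_iff]; omega
      · simp only [hsp, lt, Finset.mem_univ, Fin.ext_iff]; omega
  have gfilt : ({x : Fin N | x < g.mate x} : Finset _) = insert p (insert r rest) := by
    ext x
    rw [Finset.mem_insert, Finset.mem_insert, Finset.mem_filter, Finset.mem_filter]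
    by_cases hx : 4 ≤ x.val
    · have := (big x).1 hx
      simp [hx, this.1, this.2.2.1, hg x hx]
    · rcases small x (by omega) with rfl | rfl | rfl | rfl
      · simp only [hgp, lt, Finset.mem_univ]; simp; omega
      · simp only [hgq, lt, Finset.mem_univ, Fin.ext_iff]; omega
      · simp only [hgr, lt, Finset.mem_univ]; simp; omega
      · simp only [hgs, lt, Finset.mem_univ, Fin.ext_iff]; omega
  have hpn : p ∉ insert q rest := by
    rw [Finset.mem_insert, Finset.mem_filter, Fin.ext_iff]; omega
  have hqn : q ∉ rest := by rw [Finset.mem_filter]; omega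
  have hpn' : p ∉ insert r rest := by
    rw [Finset.mem_insert, Finset.mem_filter, Fin.ext_iff]; omega
  have hrn : r ∉ rest := by rw [Finset.mem_filter]; omega
  have lbig : ∀ x : Fin N, 4 ≤ x.val → ∀ u w, relabelTwo l p q u w x = l x := by
    intro x hx u w
    rw [big] at hx
    simp [relabelTwo_apply, hx.1, hx.2.1]
  have lr : ∀ u w, relabelTwo l p q u w r = l r := fun u w => by
    rw [relabelTwo_apply, if_neg, if_neg] <;> simp only [Fin.ext_iff] <;> omega
  have ls : ∀ u w, relabelTwo l p q u w s = l s := fun u w => by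
    rw [relabelTwo_apply, if_neg, if_neg] <;> simp only [Fin.ext_iff] <;> omega
  have hcross : ∀ x y : Fin N, (x < y ∧ y < f.mate x ∧ f.mate x < f.mate y) →
      4 ≤ x.val ∧ 4 ≤ y.val := by
    rintro x y ⟨h1, h2, h3⟩
    rw [lt] at h1 h2 h3
    by_contra hcon
    by_cases hx : 4 ≤ x.val
    · omega
    · rcases small x (by omega) with rfl | rfl | rfl | rfl
      · rw [hf'] at h2 h3
        rcases small y (by omega) with rfl | rfl | rfl | rfl
        · omega
        · rw [hf] at h3; omega
        · rw [hrq] at h3; omega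
        · omega
      · rw [hf] at h2; omega
      · rw [hrq] at h2; omega
      · rw [hsp] at h2; omega
  have gcross : ∀ x y : Fin N, (x < y ∧ y < g.mate x ∧ g.mate x < g.mate y) →
      4 ≤ x.val ∧ 4 ≤ y.val := by
    rintro x y ⟨h1, h2, h3⟩
    rw [lt] at h1 h2 h3
    by_contra hcon
    by_cases hx : 4 ≤ x.val
    · omega
    · rcases small x (by omega) with rfl | rfl | rfl | rfl
      · rw [hgp] at h2; omega
      · rw [hgq] at h2; omega
      · rw [hgr] at h2; omega
      · rw [hgs] at h2; omega
  have hcr : ∀ u w, crossProd β c f (relabelTwo l p q u w) = crossProd β c g l := by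
    intro u w
    refine Finset.prod_congr ?_ ?_
    · ext ⟨x, y⟩
      rw [Finset.mem_filter, Finset.mem_filter]
      simp only [Finset.mem_univ, true_and]
      constructor
      · intro h
        have := hcross x y h
        rwa [hg x this.1, hg y this.2]
      · intro h
        have := gcross x y h
        rwa [hg x this.1, hg y this.2] at h
    · rintro ⟨x, y⟩ h
      rw [Finset.mem_filter] at h
      have := gcross x y h.2
      simp only [hg x this.1, hg y this.2, lbig _ (hbig x this.1), lbig _ (hbig y this.2)]
  have hed : ∀ u w, edgeProd K f (relabelTwo l p q u w) =
      K u (l s) * (K w (l r) * ∏ x ∈ rest, K (l x) (l (f.mate x))) := by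
    intro u w
    rw [edgeProd, hfilt, Finset.prod_insert hpn, Finset.prod_insert hqn, hf, hf', lr, ls,
      relabelTwo_apply, relabelTwo_apply, if_neg hpq, if_pos rfl, if_pos rfl]
    congr 2
    refine Finset.prod_congr rfl fun x hx => ?_
    rw [Finset.mem_filter] at hx
    rw [lbig _ hx.2.1, lbig _ (hbig x hx.2.1)]
  have ged : edgeProd K g l =
      K (l p) (l q) * (K (l r) (l s) * ∏ x ∈ rest, K (l x) (l (f.mate x))) := by
    rw [edgeProd, gfilt, Finset.prod_insert hpn', Finset.prod_insert hrn, hgp, hgr]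
    congr 2
    refine Finset.prod_congr rfl fun x hx => ?_
    rw [Finset.mem_filter] at hx
    rw [hg x hx.2.1]
  -- The sum over `w` is an entry of FK = 1, which replaces `u` by the label of `r`.
  have hsum : ∑ u, ∑ w, F u w * (K u (l s) * K w (l r)) = K (l r) (l s) := by
    have : ∀ u, ∑ w, F u w * (K u (l s) * K w (l r)) = (F * K) u (l r) * K u (l s) := by
      intro u
      rw [Matrix.mul_apply, Finset.sum_mul]
      exact Finset.sum_congr rfl fun w _ => by ring
    simp [this, hFK, Matrix.one_apply]
  simp only [capCup, coeff, hcr, hed, ged]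
  rw [← hsum]
  simp only [Finset.sum_mul, Finset.mul_sum]
  refine Finset.sum_congr rfl fun u _ => Finset.sum_congr rfl fun w _ => ?_
  ring

/-- Both contraction and splicing commute with an adjacent swap away from `p` and `q`, so the
formula may be checked after such a swap. -/
theorem capCup_coeff_of_relabel (hK : IsSkewMatrix β K c) {p q i j : Fin N} (hpq : p ≠ q)
    (hip : i ≠ p) (hiq : i ≠ q) (hjp : j ≠ p) (hjq : j ≠ q) (hij : i.val + 1 = j.val)
    (f : Matching (Fin N))
    (h : ∀ l, capCup K F p q (coeff β K c (f.relabel (Equiv.swap i j))) l =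
      coeff β K c ((f.relabel (Equiv.swap i j)).splice p q hpq) l) (l : Fin N → ι) :
    capCup K F p q (coeff β K c f) l = coeff β K c (f.splice p q hpq) l := by
  have h2 : (f.relabel (Equiv.swap i j)).relabel (Equiv.swap i j) = f := by
    rw [Matching.relabel_relabel]
    simp [← Equiv.Perm.mul_def, Equiv.Perm.one_def, Matching.relabel_refl]
  have h3 : (f.relabel (Equiv.swap i j)).splice p q hpq =
      (f.splice p q hpq).relabel (Equiv.swap i j) := by
    rw [Matching.relabel_splice]
    simp only [Equiv.swap_apply_of_ne_of_ne hip.symm hjp.symm,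
      Equiv.swap_apply_of_ne_of_ne hiq.symm hjq.symm]
  have h4 : ((f.splice p q hpq).relabel (Equiv.swap i j)).relabel (Equiv.swap i j) =
      f.splice p q hpq := by
    rw [Matching.relabel_relabel]
    simp [← Equiv.Perm.mul_def, Equiv.Perm.one_def, Matching.relabel_refl]
  have h5 : coeff β K c f = fun l => -β.val (c (l i)) (c (l j)) *
      coeff β K c (f.relabel (Equiv.swap i j)) (l ∘ Equiv.swap i j) := by
    funext l
    rw [← coeff_relabel_swap hK hij, h2]
  rw [h5, capCup_comp_swap hip hiq hjp hjq (fun x y => -β.val (c x) (c y)), h, h3,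
    ← coeff_relabel_swap hK hij, h4]

/-- Adjacent swaps slide the partner of `q` to position 2 and then the partner of `p` to position 3,
which is the nested configuration. -/
theorem capCup_coeff [DecidableEq ι] (hK : IsSkewMatrix β K c) (hFK : F * K = 1) {p q : Fin N}
    (hp : p.val = 0) (hq : q.val = 1) (hpq : p ≠ q) (f : Matching (Fin N)) (hf : f.mate p ≠ q)
    (l : Fin N → ι) :
    capCup K F p q (coeff β K c f) l = coeff β K c (f.splice p q hpq) l := by
  have aux : ∀ f : Matching (Fin N), f.mate p ≠ q → (f.mate q).val ≠ 0 ∧ (f.mate q).val ≠ 1 ∧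
      (f.mate p).val ≠ 0 ∧ (f.mate p).val ≠ 1 ∧ (f.mate p).val ≠ (f.mate q).val := by
    intro f hf
    have h1 := f.mate_ne p
    have h2 := f.mate_ne q
    have h3 : f.mate q ≠ p := fun h => hf (by rw [← h, f.mate_mate])
    have h4 : f.mate p ≠ f.mate q := fun h => hpq (f.mate_injective h)
    simp only [ne_eq, Fin.ext_iff] at h1 h2 h3 h4 hf
    omega
  -- Second half of the slide: the partner of `q` is already at 2, and the partner of `p` moves left
  -- without touching it.
  have step1 : ∀ (n : ℕ) (f : Matching (Fin N)), f.mate p ≠ q → (f.mate q).val = 2 →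
      (f.mate p).val = n → ∀ l : Fin N → ι,
        capCup K F p q (coeff β K c f) l = coeff β K c (f.splice p q hpq) l := by
    intro n
    induction n with
    | zero => intro f hf h2 h0; exact absurd h0 (aux f hf).2.2.1
    | succ n ih =>
      intro f hf h2 h1
      have := aux f hf
      by_cases h3 : n = 2
      · subst h3
        exact capCup_coeff_of_nested hFK hp hq h2 h1 hpq f rfl rfl
      · let i : Fin N := ⟨n, by omega⟩
        have hip : i ≠ p := by rw [Ne, Fin.ext_iff]; simp only [i]; omega
        have hiq : i ≠ q := by rw [Ne, Fin.ext_iff]; simp only [i]; omega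
        have hjp : f.mate p ≠ p := f.mate_ne p
        have hiq' : f.mate q ≠ i := by rw [Ne, Fin.ext_iff]; simp only [i]; omega
        have hjq' : f.mate q ≠ f.mate p := by rw [Ne, Fin.ext_iff]; omega
        have hmp : (f.relabel (Equiv.swap i (f.mate p))).mate p = i := by
          rw [Matching.relabel_mate, Equiv.symm_swap,
            Equiv.swap_apply_of_ne_of_ne hip.symm hjp.symm, Equiv.swap_apply_right]
        have hmq : (f.relabel (Equiv.swap i (f.mate p))).mate q = f.mate q := by
          rw [Matching.relabel_mate, Equiv.symm_swap,
            Equiv.swap_apply_of_ne_of_ne hiq.symm hf.symm,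
            Equiv.swap_apply_of_ne_of_ne hiq' hjq']
        refine capCup_coeff_of_relabel hK hpq hip hiq hjp hf (by simp [i, h1]) f ?_
        exact ih _ (by rw [hmp]; exact hiq) (by rw [hmq]; exact h2) (by rw [hmp])
  -- First half of the slide; the partner of `p` may be displaced to the right on the way, which
  -- does no harm.
  have step2 : ∀ (n : ℕ) (f : Matching (Fin N)), f.mate p ≠ q → (f.mate q).val = n →
      ∀ l : Fin N → ι,
        capCup K F p q (coeff β K c f) l = coeff β K c (f.splice p q hpq) l := by
    intro n
    induction n with
    | zero => intro f hf h0; exact absurd h0 (aux f hf).1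
    | succ n ih =>
      intro f hf h1
      have := aux f hf
      by_cases h3 : n = 1
      · subst h3
        exact step1 _ f hf h1 rfl
      · let i : Fin N := ⟨n, by omega⟩
        have hip : i ≠ p := by rw [Ne, Fin.ext_iff]; simp only [i]; omega
        have hiq : i ≠ q := by rw [Ne, Fin.ext_iff]; simp only [i]; omega
        have hjp : f.mate q ≠ p := by rw [Ne, Fin.ext_iff]; omega
        have hjq : f.mate q ≠ q := f.mate_ne q
        have hmq : (f.relabel (Equiv.swap i (f.mate q))).mate q = i := by
          rw [Matching.relabel_mate, Equiv.symm_swap,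
            Equiv.swap_apply_of_ne_of_ne hiq.symm hjq.symm, Equiv.swap_apply_right]
        refine capCup_coeff_of_relabel hK hpq hip hiq hjp hjq (by simp [i, h1]) f ?_
        refine ih _ (fun h => ?_) (by rw [hmq])
        rw [Matching.mate_eq_iff, hmq] at h
        exact hip h.symm
  exact step2 _ f hf rfl l

/-- The edge from `p` to `q` joins the first two points, so it crosses nothing. Contracting it
splits off the value of a closed loop, and the inserted `K` restores the edge. -/
theorem capCup_coeff_of_mate_eq {p q : Fin N} (hp : p.val = 0) (hq : q.val = 1) (hpq : p ≠ q)
    (f : Matching (Fin N)) (hf : f.mate p = q) (l : Fin N → ι) :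
    capCup K F p q (coeff β K c f) l = (∑ u, ∑ w, F u w * K u w) * coeff β K c f l := by
  have hf' : f.mate q = p := by rw [← hf, f.mate_mate]
  have hlt : ∀ x y : Fin N, x < y ↔ x.val < y.val := fun _ _ => Iff.rfl
  have hmem : p ∈ ({x : Fin N | x < f.mate x} : Finset _) := by
    rw [Finset.mem_filter, hf, hlt]; simp; omega
  have hval : ∀ x : Fin N, x ≠ p → x ≠ q → ∀ u w, relabelTwo l p q u w x = l x :=
    fun x h1 h2 u w => by rw [relabelTwo_apply, if_neg h2, if_neg h1]
  have hmate : ∀ x : Fin N, x ≠ p → x ≠ q → f.mate x ≠ p ∧ f.mate x ≠ q := by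
    intro x h1 h2
    exact ⟨fun h => h2 (by rw [← hf, ← h, f.mate_mate]), fun h => h1 (by rw [← hf', ← h, f.mate_mate])⟩
  have hed : ∀ u w, edgeProd K f (relabelTwo l p q u w) = K u w *
      ∏ x ∈ ({x : Fin N | x < f.mate x} : Finset _).erase p, K (l x) (l (f.mate x)) := by
    intro u w
    rw [edgeProd, ← Finset.mul_prod_erase _ _ hmem, hf, relabelTwo_apply, relabelTwo_apply,
      if_neg hpq, if_pos rfl, if_pos rfl]
    congr 1
    refine Finset.prod_congr rfl fun x hx => ?_
    rw [Finset.mem_erase, Finset.mem_filter] at hx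
    have hxq : x ≠ q := by
      rintro rfl; have := hx.2.2; rw [hf', hlt] at this; omega
    rw [hval x hx.1 hxq, hval _ (hmate x hx.1 hxq).1 (hmate x hx.1 hxq).2]
  have hed' : edgeProd K f l = K (l p) (l q) *
      ∏ x ∈ ({x : Fin N | x < f.mate x} : Finset _).erase p, K (l x) (l (f.mate x)) := by
    rw [edgeProd, ← Finset.mul_prod_erase _ _ hmem, hf]
  have hcr : ∀ u w, crossProd β c f (relabelTwo l p q u w) = crossProd β c f l := by
    intro u w
    refine Finset.prod_congr rfl fun x hx => ?_
    rw [Finset.mem_filter] at hx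
    obtain ⟨x, y⟩ := x
    simp only [hlt] at hx
    have hx1 : x ≠ p := by rintro rfl; rw [hf] at hx; omega
    have hx2 : x ≠ q := by rintro rfl; rw [hf'] at hx; omega
    have hy1 : y ≠ p := by rintro rfl; rw [hf] at hx; omega
    have hy2 : y ≠ q := by rintro rfl; rw [hf'] at hx; omega
    simp only [hval _ (hmate x hx1 hx2).1 (hmate x hx1 hx2).2,
      hval _ (hmate y hy1 hy2).1 (hmate y hy1 hy2).2]
  simp only [capCup, coeff, hcr, hed, hed', Finset.sum_mul, Finset.mul_sum]
  refine Finset.sum_congr rfl fun u _ => Finset.sum_congr rfl fun w _ => ?_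
  ring

end Contract

/-! ### Tensors in coordinates -/

section Tens

variable {κ : Type*} [Field κ] {V : Type*} [AddCommGroup V] [Module κ V]
  {ι : Type*} [Fintype ι] (v : Module.Basis ι κ V)

/-- The tensor with the given coefficients in the basis of `V^{⊗N}` formed by the products of the
elements of the basis `v`. -/
noncomputable def tens (N : ℕ) : ((Fin N → ι) → κ) ≃ₗ[κ] ⨂[κ]^N V :=
  haveI := Classical.decEq ι
  (Module.Basis.equivFun (Basis.piTensorProduct fun _ : Fin N => v)).symm

theorem tens_apply {N : ℕ} (φ : (Fin N → ι) → κ) :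
    tens v N φ = ∑ l, φ l • PiTensorProduct.tprod κ fun i => v (l i) := by
  classical
  rw [tens, Module.Basis.equivFun_symm_apply]
  simp only [Basis.piTensorProduct_apply]

theorem tens_single [DecidableEq ι] {N : ℕ} (l : Fin N → ι) :
    tens v N (Pi.single l 1) = PiTensorProduct.tprod κ fun i => v (l i) := by
  rw [tens_apply, Finset.sum_eq_single l]
  · simp
  · intro l' _ h; simp [Pi.single_eq_of_ne h]
  · simp

/-- Linear maps out of a tensor power that agree on products of basis vectors are equal. -/
theorem tens_hom_ext {N : ℕ} {W : Type*} [AddCommGroup W] [Module κ W]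
    {A B : (⨂[κ]^N V) →ₗ[κ] W}
    (h : ∀ l : Fin N → ι, A (PiTensorProduct.tprod κ fun i => v (l i)) =
      B (PiTensorProduct.tprod κ fun i => v (l i))) : A = B := by
  classical
  refine (Basis.piTensorProduct fun _ : Fin N => v).ext fun l => ?_
  rw [Basis.piTensorProduct_apply]
  exact h l

end Tens

/-! ### The braid operators on tensors of matchings. -/

section Braid

variable {κ : Type*} [Field κ] {G : Type*} [CommGroup G] [Fintype G] [DecidableEq G]
  (β : SymmBicharacter G κ) {V : Type*} [AddCommGroup V] [Module κ V]
  (𝒱 : G → Submodule κ V) [DirectSum.Decomposition 𝒱]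

theorem gproj_of_mem {a b : G} {x : V} (hx : x ∈ 𝒱 b) :
    gproj 𝒱 a x = if a = b then x else 0 := by
  have h : gproj 𝒱 a x = (DirectSum.decompose 𝒱 x a : V) := rfl
  rw [h]
  split_ifs with hab
  · subst hab; exact DirectSum.decompose_of_mem_same 𝒱 hx
  · exact DirectSum.decompose_of_mem_ne 𝒱 hx (Ne.symm hab)

theorem braid_tprod {N : ℕ} (i : AdjIdx N) (x : Fin N → V) (g : Fin N → G)
    (hx : ∀ j, x j ∈ 𝒱 (g j)) :
    braid β 𝒱 i (PiTensorProduct.tprod κ x) =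
      -β.val (g i.hi) (g i.lo) • PiTensorProduct.tprod κ (x ∘ adjSwap i) := by
  have hne : i.lo ≠ i.hi := by
    rw [Ne, Fin.ext_iff]; simp [AdjIdx.lo, AdjIdx.hi]
  have hmap : ∀ a b : G, (PiTensorProduct.map (fun j : Fin N =>
      if j = i.lo then gproj 𝒱 a else if j = i.hi then gproj 𝒱 b else LinearMap.id))
        (PiTensorProduct.tprod κ x) =
      if a = g i.lo ∧ b = g i.hi then PiTensorProduct.tprod κ x else 0 := by
    intro a b
    rw [PiTensorProduct.map_tprod]
    split_ifs with h
    · congr 1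
      funext j
      by_cases h1 : j = i.lo
      · subst h1; simp [gproj_of_mem 𝒱 (hx _), h.1]
      · by_cases h2 : j = i.hi
        · subst h2; simp [gproj_of_mem 𝒱 (hx _), h.2, hne.symm]
        · simp [h1, h2]
    · by_cases h1 : a = g i.lo
      · refine MultilinearMap.map_coord_zero _ i.hi ?_
        simp only [hne.symm, if_false, if_true, gproj_of_mem 𝒱 (hx _)]
        exact if_neg fun h2 => h ⟨h1, h2⟩
      · refine MultilinearMap.map_coord_zero _ i.lo ?_
        simp only [if_true, gproj_of_mem 𝒱 (hx _)]
        exact if_neg h1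
  simp only [braid, LinearMap.neg_apply, LinearMap.sum_apply, LinearMap.smul_apply,
    LinearMap.comp_apply, hmap, neg_smul]
  congr 1
  rw [Finset.sum_eq_single (g i.lo), Finset.sum_eq_single (g i.hi)]
  · simp only [and_self, if_true]
    congr 1
    refine (PiTensorProduct.reindex_tprod _ _).trans ?_
    congr 1
  · intro b _ hb; simp [hb]
  · simp
  · intro a _ ha; simp [ha]
  · simp

variable {ι : Type*} [Fintype ι] (v : Module.Basis ι κ V) {c : ι → G}

/-- The coefficient at `l` comes from the labelling with the two labels exchanged, which is why the
arguments of β appear in the order of `l`. -/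
theorem braid_tens (hv : ∀ i, v i ∈ 𝒱 (c i)) {N : ℕ} (i : AdjIdx N) (φ : (Fin N → ι) → κ) :
    braid β 𝒱 i (tens v N φ) =
      tens v N fun l => -β.val (c (l i.lo)) (c (l i.hi)) * φ (l ∘ adjSwap i) := by
  have h : ∀ l : Fin N → ι, braid β 𝒱 i (PiTensorProduct.tprod κ fun j => v (l j)) =
      -β.val (c (l i.hi)) (c (l i.lo)) •
        PiTensorProduct.tprod κ fun j => v ((l ∘ adjSwap i) j) := fun l =>
    braid_tprod β 𝒱 i _ (fun j => c (l j)) fun j => hv (l j)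
  simp only [tens_apply, map_sum, map_smul, h, smul_smul]
  refine Fintype.sum_equiv (Equiv.arrowCongr (adjSwap i) (Equiv.refl ι)) _ _ fun l => ?_
  have hl : (Equiv.arrowCongr (adjSwap i) (Equiv.refl ι)) l = l ∘ adjSwap i := by
    funext j
    simp [Equiv.arrowCongr, adjSwap]
  have hl2 : (l ∘ adjSwap i) ∘ adjSwap i = l := by funext j; simp [adjSwap]
  rw [hl, hl2]
  simp only [Function.comp_apply, adjSwap, Equiv.swap_apply_left, Equiv.swap_apply_right]
  rw [mul_comm]

/-- On tensors of matchings the result depends on the word only through its product, so no braid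
relations are called for. -/
theorem braid_word_tens_coeff {K : Matrix ι ι κ} (hv : ∀ i, v i ∈ 𝒱 (c i))
    (hK : IsSkewMatrix β K c) {N : ℕ} (w : List (AdjIdx N)) (f : Matching (Fin N)) :
    (w.map (braid β 𝒱)).prod (tens v N (coeff β K c f)) =
      tens v N (coeff β K c (f.relabel (w.map adjSwap).prod)) := by
  induction w with
  | nil => simp [Equiv.Perm.one_def, Matching.relabel_refl]
  | cons i w ih =>
    rw [List.map_cons, List.prod_cons, Module.End.mul_apply, ih, braid_tens β 𝒱 v hv]
    congr 1
    funext l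
    rw [List.map_cons, List.prod_cons, Equiv.Perm.mul_def, ← Matching.relabel_relabel, adjSwap,
      coeff_relabel_swap hK rfl]

theorem braidPerm_tens_coeff {K : Matrix ι ι κ} (hv : ∀ i, v i ∈ 𝒱 (c i))
    (hK : IsSkewMatrix β K c) {N : ℕ} (π : Equiv.Perm (Fin N)) (f : Matching (Fin N)) :
    braidPerm β 𝒱 π (tens v N (coeff β K c f)) = tens v N (coeff β K c (f.relabel π)) := by
  rw [braidPerm, braid_word_tens_coeff β 𝒱 v hv hK, (exists_reducedWord π).choose_spec.1]

end Braid

/-! ### The nested one-factor -/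

section Nested

/-- The one-factor joining the `i`-th vertex from the left to the `i`-th vertex from the right. -/
def nested (k : ℕ) : OneFactor k where
  mate := Fin.rev
  mate_mate := Fin.rev_rev
  mate_ne x h := by
    have := congrArg Fin.val h
    rw [Fin.val_rev] at this
    omega

/-- In the sequence ℓ₁, …, ℓ_k, r_k, …, r₁ the two ends of each edge occupy mirror positions, and
mirror positions are what the nested one-factor joins. -/
theorem relabel_perm_nested {k : ℕ} (f : OneFactor k) :
    (nested k).relabel (OneFactor.perm f) = f := by
  have h1 : ∀ i : Fin k, OneFactor.perm f (Fin.castAdd k i) = OneFactor.left f i := fun i => by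
    simp [OneFactor.perm, OneFactor.seq]
  have h2 : ∀ i : Fin k, OneFactor.perm f (Fin.natAdd k i) =
      f.mate (OneFactor.left f i.rev) := fun i => by
    rw [OneFactor.perm, Equiv.ofBijective_apply, OneFactor.seq, Fin.append_right]
  ext1; funext y
  obtain ⟨x, rfl⟩ := (OneFactor.perm f).surjective y
  rw [Matching.relabel_mate, Equiv.symm_apply_apply]
  induction x using Fin.addCases with
  | left i =>
    have : (nested k).mate (Fin.castAdd k i) = Fin.natAdd k i.rev := by
      ext; simp [nested, Fin.val_rev]; omega
    rw [this, h1, h2, Fin.rev_rev]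
  | right i =>
    have : (nested k).mate (Fin.natAdd k i) = Fin.castAdd k i.rev := by
      ext; simp [nested, Fin.val_rev]; omega
    rw [this, h1, h2, f.mate_mate]

theorem coeff_nested {κ : Type*} [Field κ] {G : Type*} [CommGroup G] (β : SymmBicharacter G κ)
    {ι : Type*} (K : Matrix ι ι κ) (c : ι → G) {k : ℕ} (a b : Fin k → ι) :
    coeff β K c (nested k) (Fin.append a b) = ∏ i : Fin k, K (a i) (b i.rev) := by
  have hcross : crossProd β c (nested k) (Fin.append a b) = 1 := by
    rw [crossProd]
    refine Finset.prod_eq_one fun p hp => ?_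
    rw [Finset.mem_filter] at hp
    obtain ⟨-, h1, h2, h3⟩ := hp
    simp only [nested, Fin.rev_lt_rev] at h3
    exact absurd h3 h1.not_gt
  have hfilt : ({x : Fin (k + k) | x < (nested k).mate x} : Finset _) =
      Finset.univ.map (Fin.castAddEmb k) := by
    ext x
    rw [Finset.mem_filter, Finset.mem_map]
    simp only [Finset.mem_univ, true_and, Fin.castAddEmb_apply]
    have hlt : x < (nested k).mate x ↔ x.val < k := by
      rw [Fin.lt_def]; simp only [nested, Fin.val_rev]; omega
    rw [hlt]
    constructor
    · intro h; exact ⟨⟨x, h⟩, rfl⟩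
    · rintro ⟨i, rfl⟩; simp
  rw [coeff, hcross, mul_one, edgeProd, hfilt, Finset.prod_map]
  refine Finset.prod_congr rfl fun i _ => ?_
  have : (nested k).mate (Fin.castAddEmb k i) = Fin.natAdd k i.rev := by
    ext; simp [nested, Fin.val_rev]; omega
  rw [this, Fin.append_right, Fin.castAddEmb_apply, Fin.append_left]

end Nested

/-! ### The map `Ψ_d` in coordinates -/

section PsiCoord

theorem dualTensorHom_sum_coord {κ : Type*} [Field κ] {W : Type*} [AddCommGroup W] [Module κ W]
    {J : Type*} [Fintype J] (b : Module.Basis J κ W) :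
    (dualTensorHom κ W W ∘ₗ (TensorProduct.comm κ W (Module.Dual κ W)).toLinearMap)
      (∑ j, b j ⊗ₜ[κ] b.coord j) = LinearMap.id := by
  ext x
  simp [LinearMap.sum_apply, Module.Basis.sum_repr]

/-- The element ∑ b_j ⊗ b_j^* corresponds to the identity endomorphism, so it does not depend on the
basis and the basis chosen for `coevaluation` may be replaced by any other. -/
theorem coevaluation_one_eq {κ : Type*} [Field κ] {W : Type*} [AddCommGroup W] [Module κ W]
    [FiniteDimensional κ W] {J : Type*} [Fintype J] (b : Module.Basis J κ W) :
    coevaluation κ W 1 = ∑ j, b j ⊗ₜ[κ] b.coord j := by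
  have hinj : Function.Injective
      (dualTensorHom κ W W ∘ₗ (TensorProduct.comm κ W (Module.Dual κ W)).toLinearMap) := by
    intro x y h
    have := (dualTensorHomEquiv κ W W).injective (a₁ := TensorProduct.comm κ _ _ x)
      (a₂ := TensorProduct.comm κ _ _ y) (by simpa using h)
    exact (TensorProduct.comm κ _ _).injective this
  apply hinj
  rw [coevaluation_apply_one, dualTensorHom_sum_coord, dualTensorHom_sum_coord]

variable {κ : Type*} [Field κ] {V : Type*} [AddCommGroup V] [Module κ V] [FiniteDimensional κ V]
  {ι : Type*} [Fintype ι] [DecidableEq ι] (v : Module.Basis ι κ V) {k : ℕ}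

theorem dualTensor_tprod (f : Fin k → Module.Dual κ V) (x : Fin k → V) :
    dualTensor κ V k (PiTensorProduct.tprod κ f) (PiTensorProduct.tprod κ x) =
      ∏ i, f i.rev (x i) := by
  have h1 : dualTensor κ V k (PiTensorProduct.tprod κ f) =
      PiTensorProduct.dualDistrib (R := κ) (M := fun _ : Fin k => V)
        (PiTensorProduct.reindex κ (fun _ : Fin k => Module.Dual κ V) Fin.revPerm
          (PiTensorProduct.tprod κ f)) := rfl
  have h2 : PiTensorProduct.reindex κ (fun _ : Fin k => Module.Dual κ V) Fin.revPerm
      (PiTensorProduct.tprod κ f) = PiTensorProduct.tprod κ fun i => f i.rev :=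
    PiTensorProduct.reindex_tprod _ _
  rw [h1, h2]
  exact PiTensorProduct.dualDistrib_apply _ _

theorem evTilde_tprod (f : Fin k → Module.Dual κ V) (x : Fin k → V) :
    evTilde κ V k (PiTensorProduct.tprod κ f ⊗ₜ PiTensorProduct.tprod κ x) =
      ∏ i, f i.rev (x i) := by
  simp only [evTilde, LinearMap.comp_apply, LinearMap.rTensor_tmul, contractLeft_apply,
    LinearEquiv.coe_coe]
  exact dualTensor_tprod f x

theorem prTilde_one : prTilde κ V k 1 = ∑ b : Fin k → ι,
    (PiTensorProduct.tprod κ fun i => v (b i)) ⊗ₜ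
      (PiTensorProduct.tprod κ fun i => v.coord (b i.rev)) := by
  have h : ∀ b : Fin k → ι,
      (dualTensor κ V k).symm ((Basis.piTensorProduct fun _ : Fin k => v).coord b) =
        PiTensorProduct.tprod κ fun i => v.coord (b i.rev) := by
    intro b
    rw [LinearEquiv.symm_apply_eq]
    refine tens_hom_ext v fun l => ?_
    rw [dualTensor_tprod, Module.Basis.coord_apply, Basis.piTensorProduct_repr_tprod_apply]
    simp
  rw [prTilde, LinearMap.comp_apply,
    coevaluation_one_eq (Basis.piTensorProduct fun _ : Fin k => v), map_sum]
  refine Finset.sum_congr rfl fun b _ => ?_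
  rw [LinearMap.lTensor_tmul, LinearEquiv.coe_coe, h, Basis.piTensorProduct_apply]

variable (ω : LinearMap.BilinForm κ V)

/-- The matrix of a bilinear form. -/
noncomputable abbrev gram : Matrix ι ι κ := Matrix.of fun i j => ω (v i) (v j)

theorem gram_mul_eq_sum (M : Matrix ι ι κ) (i j : ι) :
    (M * gram v ω) i j = ω (∑ u, M i u • v u) (v j) := by
  simp [Matrix.mul_apply]

/-- The coordinates of the images of the dual basis vectors under the inverse of `formIso` form the
rows of an explicit left inverse. -/
theorem gram_inv_mul (hω : ω.Nondegenerate) : (gram v ω)⁻¹ * gram v ω = 1 := by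
  have h : (Matrix.of fun i u => v.repr ((formIso ω hω).symm (v.coord i)) u) * gram v ω = 1 := by
    ext i j
    rw [gram_mul_eq_sum]
    simp only [Matrix.of_apply, v.sum_repr]
    rw [formIso, LinearMap.BilinForm.apply_toDual_symm_apply]
    simp [Matrix.one_apply, Finsupp.single_apply, eq_comm]
  exact Matrix.nonsing_inv_mul _ ((Matrix.isUnit_iff_isUnit_det _).1 (IsUnit.of_mul_eq_one_right _ h))

theorem gram_mul_inv (hω : ω.Nondegenerate) : gram v ω * (gram v ω)⁻¹ = 1 :=
  mul_eq_one_comm.1 (gram_inv_mul v ω hω)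

theorem formIso_symm_coord (hω : ω.Nondegenerate) (i : ι) :
    (formIso ω hω).symm (v.coord i) = ∑ u, (gram v ω)⁻¹ i u • v u := by
  rw [LinearEquiv.symm_apply_eq]
  refine v.ext fun j => ?_
  have h := gram_mul_eq_sum v ω (gram v ω)⁻¹ i j
  rw [gram_inv_mul v ω hω] at h
  rw [formIso, LinearMap.BilinForm.toDual_def, ← h]
  simp [Matrix.one_apply, Finsupp.single_apply, eq_comm]

theorem mulEquiv_tprod {m n : ℕ} (x : Fin m → V) (y : Fin n → V) :
    (TensorPower.mulEquiv : (⨂[κ]^m V) ⊗[κ] (⨂[κ]^n V) ≃ₗ[κ] ⨂[κ]^(m + n) V)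
      (PiTensorProduct.tprod κ x ⊗ₜ PiTensorProduct.tprod κ y) =
        PiTensorProduct.tprod κ (Fin.append x y) :=
  TensorPower.tprod_mul_tprod κ x y

theorem sum_append {M : Type*} [AddCommMonoid M] (φ : (Fin (k + k) → ι) → M) :
    ∑ l, φ l = ∑ b : Fin k → ι, ∑ w : Fin k → ι, φ (Fin.append b w) := by
  rw [← Fintype.sum_prod_type' fun b w => φ (Fin.append b w)]
  exact (Fintype.sum_equiv (Fin.appendEquiv k k) _ _ fun _ => rfl).symm

theorem append_basis (b w : Fin k → ι) :
    Fin.append (fun i => v (b i)) (fun i => v (w i)) = fun i => v (Fin.append b w i) := by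
  funext i
  induction i using Fin.addCases <;> simp only [Fin.append_left, Fin.append_right]

variable {G : Type*} [CommGroup G] (β : SymmBicharacter G κ) (c : ι → G)

/-- The reversed pairing of tensor factors puts the functional dual to the `i`-th vector at the
mirror position, and F⁻¹ turns it into a row of the inverse Gram matrix. -/
theorem nested_cups (hω : ω.Nondegenerate) :
    (TensorPower.mulEquiv : (⨂[κ]^k V) ⊗[κ] (⨂[κ]^k V) ≃ₗ[κ] ⨂[κ]^(k + k) V)
      (LinearMap.lTensor (⨂[κ]^k V)
        (PiTensorProduct.map fun _ => (formIso ω hω).symm.toLinearMap) (prTilde κ V k 1)) =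
    tens v (k + k) (coeff β (gram v ω)⁻¹ c (nested k)) := by
  rw [prTilde_one v, map_sum, map_sum, tens_apply, sum_append]
  refine Finset.sum_congr rfl fun b _ => ?_
  rw [LinearMap.lTensor_tmul, PiTensorProduct.map_tprod]
  simp only [LinearEquiv.coe_coe, formIso_symm_coord v ω hω]
  have h : (PiTensorProduct.tprod κ fun i : Fin k => ∑ u, (gram v ω)⁻¹ (b i.rev) u • v u) =
      ∑ w : Fin k → ι, (∏ i : Fin k, (gram v ω)⁻¹ (b i) (w i.rev)) •
        PiTensorProduct.tprod κ fun i => v (w i) := by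
    rw [MultilinearMap.map_sum]
    refine Finset.sum_congr rfl fun w _ => ?_
    rw [MultilinearMap.map_smul_univ]
    congr 1
    exact Fintype.prod_equiv Fin.revPerm _ _ fun i => by simp
  rw [h, TensorProduct.tmul_sum, map_sum]
  refine Finset.sum_congr rfl fun w _ => ?_
  rw [TensorProduct.tmul_smul, map_smul, mulEquiv_tprod, coeff_nested, append_basis]

variable [Fintype G] [DecidableEq G] (𝒱 : G → Submodule κ V) [DirectSum.Decomposition 𝒱]

/-- The entry of the matrix of `Ψ_d` at the labels `a` of the top and `b` of the bottom. -/
noncomputable def psiEntry (d : Diagram k) (a b : Fin k → ι) : κ :=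
  ∑ w : Fin k → ι, coeff β (gram v ω)⁻¹ c (unfold d) (Fin.append b w) *
    ∏ i : Fin k, gram v ω (w i.rev) (a i)

variable {c}

/-- Of the `k + k` labels of the unfolded tensor the first `k` survive as output, and the last `k`
are paired with the input, in reversed order, through the form. -/
theorem Psi_tprod (hω : ω.Nondegenerate) (hv : ∀ i, v i ∈ 𝒱 (c i))
    (hK : IsSkewMatrix β (gram v ω)⁻¹ c) (d : Diagram k) (a : Fin k → ι) :
    Psi β 𝒱 ω hω d (PiTensorProduct.tprod κ fun i => v (a i)) =
      ∑ b : Fin k → ι, psiEntry v ω β c d a b • PiTensorProduct.tprod κ fun i => v (b i) := by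
  have h1 := nested_cups (k := k) v ω β c hω
  simp only [Psi, LinearMap.comp_apply, LinearEquiv.coe_coe, TensorProduct.lid_symm_apply,
    LinearMap.rTensor_tmul]
  rw [h1, braidPerm_tens_coeff β 𝒱 v hv hK, relabel_perm_nested, tens_apply, sum_append]
  simp only [map_sum, map_smul, TensorProduct.sum_tmul, psiEntry,
    Finset.sum_smul]
  refine Finset.sum_congr rfl fun b _ => Finset.sum_congr rfl fun w _ => ?_
  rw [← append_basis, ← mulEquiv_tprod, LinearEquiv.symm_apply_apply, LinearMap.lTensor_tmul,
    ← TensorProduct.smul_tmul', map_smul, map_smul, map_smul, TensorProduct.assoc_tmul, LinearMap.lTensor_tmul, PiTensorProduct.map_tprod, evTilde_tprod,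
    TensorProduct.rid_tmul, smul_smul]
  congr 2

end PsiCoord

/-! ### The weight formula -/

section SkewForm

variable {κ : Type*} [Field κ] {V : Type*} [AddCommGroup V] [Module κ V] [FiniteDimensional κ V]
  {ι : Type*} [Fintype ι] [DecidableEq ι] (v : Module.Basis ι κ V)
  {ω : LinearMap.BilinForm κ V} {G : Type*} [CommGroup G] {β : SymmBicharacter G κ}
  {𝒱 : G → Submodule κ V} {c : ι → G}

theorem gram_deg (hω : IsSkewForm β 𝒱 ω) (hv : ∀ i, v i ∈ 𝒱 (c i)) {i j : ι}
    (h : gram v ω i j ≠ 0) : c i = (c j)⁻¹ := by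
  by_contra hc
  exact h (hω.eq_zero _ _ hc _ (hv i) _ (hv j))

theorem gram_skew (hω : IsSkewForm β 𝒱 ω) (hv : ∀ i, v i ∈ 𝒱 (c i)) (i j : ι) :
    gram v ω i j = -β.val (c j) (c i) * gram v ω j i :=
  hω.skew _ _ _ (hv i) _ (hv j)

theorem eq_gram_inv (hω : IsSkewForm β 𝒱 ω) {M : Matrix ι ι κ} (h : M * gram v ω = 1) :
    M = (gram v ω)⁻¹ := by
  rw [← mul_one M, ← gram_mul_inv v ω hω.nondegenerate, ← mul_assoc, h, one_mul]

/-- Both properties follow from uniqueness of the inverse: a matrix built to have the property is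
shown to be a left inverse of the Gram matrix. -/
theorem isSkewMatrix_gram_inv (hω : IsSkewForm β 𝒱 ω) (hv : ∀ i, v i ∈ 𝒱 (c i)) :
    IsSkewMatrix β (gram v ω)⁻¹ c := by
  classical
  constructor
  -- Discarding the entries of the wrong degree keeps a left inverse, since the Gram matrix pairs
  -- only inverse degrees.
  · have h : Matrix.of (fun i j => if c j = (c i)⁻¹ then (gram v ω)⁻¹ i j else 0) =
        (gram v ω)⁻¹ := by
      refine eq_gram_inv v hω ?_
      ext i j
      rw [Matrix.mul_apply]
      by_cases hij : c i = c j
      · rw [← gram_inv_mul v ω hω.nondegenerate, Matrix.mul_apply]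
        refine Finset.sum_congr rfl fun u _ => ?_
        by_cases hu : gram v ω u j = 0
        · rw [hu, mul_zero, mul_zero]
        · rw [Matrix.of_apply, if_pos (by rw [hij, gram_deg v hω hv hu])]
      · rw [Matrix.one_apply_ne (by rintro rfl; exact hij rfl)]
        refine Finset.sum_eq_zero fun u _ => ?_
        by_cases hu : gram v ω u j = 0
        · rw [hu, mul_zero]
        · rw [Matrix.of_apply, if_neg, zero_mul]
          rw [gram_deg v hω hv hu]
          exact fun h => hij (inv_injective h).symm
    intro i j hij
    by_contra hc
    rw [← h, Matrix.of_apply, if_neg hc] at hij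
    exact hij rfl
  -- The β-twisted transpose of the inverse is again a left inverse; the diagonal contributes
  -- β(x,x)² = 1.
  · have h : Matrix.of (fun i j => -β.val (c j) (c i) * (gram v ω)⁻¹ j i) =
        (gram v ω)⁻¹ := by
      refine eq_gram_inv v hω ?_
      ext i j
      have h1 : (Matrix.of (fun i j => -β.val (c j) (c i) * (gram v ω)⁻¹ j i) * gram v ω) i j =
          β.val (c i) (c j) * β.val (c j) (c j) * (gram v ω * (gram v ω)⁻¹) j i := by
        rw [Matrix.mul_apply, Matrix.mul_apply, Finset.mul_sum]
        refine Finset.sum_congr rfl fun u _ => ?_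
        rw [Matrix.of_apply, gram_skew v hω hv u j]
        by_cases hu : gram v ω j u = 0
        · rw [hu]; ring
        · have hd : c u = (c j)⁻¹ := by rw [gram_deg v hω hv hu, inv_inv]
          rw [hd, β.val_inv_left, β.val_inv_right]
          ring
      rw [h1, gram_mul_inv v ω hω.nondegenerate]
      by_cases hij : i = j
      · subst hij
        rw [β.val_mul_val_symm, one_mul]
      · rw [Matrix.one_apply_ne (Ne.symm hij), Matrix.one_apply_ne hij, mul_zero]
    intro i j
    conv_lhs => rw [← h]
    rfl

end SkewForm

section Weight

variable {k : ℕ}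

theorem unfoldVertex_inl (i : Fin k) : unfoldVertex k (.inl i) = Fin.natAdd k i.rev := rfl

theorem unfoldVertex_inr (j : Fin k) : unfoldVertex k (.inr j) = Fin.castAdd k j := rfl

theorem unfoldVertex_inl_lt_inl (i j : Fin k) :
    unfoldVertex k (.inl i) < unfoldVertex k (.inl j) ↔ j < i := by
  simp only [unfoldVertex_inl, Fin.lt_def, Fin.val_natAdd, Fin.val_rev]; omega

theorem unfoldVertex_inr_lt_inr (i j : Fin k) :
    unfoldVertex k (.inr i) < unfoldVertex k (.inr j) ↔ i < j := Iff.rfl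

theorem unfoldVertex_inr_lt_inl (i j : Fin k) :
    unfoldVertex k (.inr i) < unfoldVertex k (.inl j) := by
  simp only [unfoldVertex_inl, unfoldVertex_inr, Fin.lt_def, Fin.val_natAdd, Fin.val_castAdd]; omega

theorem append_comp_unfoldVertex {ι : Type*} (b w : Fin k → ι) (x : Fin k ⊕ Fin k) :
    Fin.append b w (unfoldVertex k x) = Sum.elim (fun i => w i.rev) b x := by
  rcases x with i | j
  · rw [unfoldVertex_inl, Fin.append_right]; rfl
  · rw [unfoldVertex_inr, Fin.append_left]; rfl

theorem unfold_mate_unfoldVertex (d : Diagram k) (x : Fin k ⊕ Fin k) :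
    (unfold d).mate (unfoldVertex k x) = unfoldVertex k (d.mate x) := by
  simp [unfold]

variable {κ : Type*} [Field κ] {ι : Type*} [Fintype ι] [DecidableEq ι]

/-- The `i`-th top vertex of `d` is the right end of a horizontal edge. -/
def IsRightTop (d : Diagram k) (i : Fin k) : Prop := ∃ j, j < i ∧ d.mate (.inl i) = .inl j

-- The edge product is reorganised by right ends in the unfolded order. Unfolding reverses the top
-- row, so a horizontal top edge is counted at its left end, and the top vertices without a factor
-- are the right ends.
open Classical in
theorem edgeProd_unfold (K : Matrix ι ι κ) (d : Diagram k) (b w : Fin k → ι) :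
    edgeProd K (unfold d) (Fin.append b w) =
      (∏ p : Fin k × Fin k with p.1 < p.2 ∧ d.mate (.inr p.1) = .inr p.2, K (b p.1) (b p.2)) *
      ∏ i : Fin k, if IsRightTop d i then 1 else
        K (Sum.elim (fun i => w i.rev) b (d.mate (.inl i))) (w i.rev) := by
  have h1 : edgeProd K (unfold d) (Fin.append b w) = ∏ x : Fin k ⊕ Fin k,
      if unfoldVertex k (d.mate x) < unfoldVertex k x then
        K (Sum.elim (fun i => w i.rev) b (d.mate x)) (Sum.elim (fun i => w i.rev) b x) else 1 := by
    rw [edgeProd, Finset.prod_filter]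
    refine (Fintype.prod_equiv ((Function.Involutive.toPerm d.mate d.mate_mate).trans
      (unfoldVertex k)) _ _ fun x => ?_).symm
    have hx : (Function.Involutive.toPerm d.mate d.mate_mate) x = d.mate x := rfl
    simp only [Equiv.trans_apply, hx, unfold_mate_unfoldVertex, d.mate_mate,
      append_comp_unfoldVertex]
  rw [h1, Fintype.prod_sum_type, mul_comm]
  congr 1
  · rw [Finset.prod_filter, Fintype.prod_prod_type_right]
    refine Finset.prod_congr rfl fun j _ => ?_
    rcases hj : d.mate (.inr j) with i | j'
    · rw [if_neg (unfoldVertex_inr_lt_inl j i).not_gt]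
      refine (Finset.prod_eq_one fun j' _ => if_neg ?_).symm
      rintro ⟨-, h⟩
      rw [Matching.mate_eq_iff, hj] at h
      exact absurd h (by simp)
    · simp only [unfoldVertex_inr_lt_inr]
      rw [Fintype.prod_eq_single j']
      · have : d.mate (.inr j') = .inr j := by rw [← hj, d.mate_mate]
        simp [this]
      · rintro x hx
        refine if_neg ?_
        rintro ⟨-, h⟩
        rw [Matching.mate_eq_iff, hj] at h
        exact hx (Sum.inr_injective h)
  · refine Finset.prod_congr rfl fun i _ => ?_
    rcases hi : d.mate (.inl i) with i' | j
    · simp only [unfoldVertex_inl_lt_inl]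
      have hne : i' ≠ i := by rintro rfl; exact d.mate_ne _ hi
      have hr : IsRightTop d i ↔ i' < i := by
        constructor
        · rintro ⟨j, hj, hj'⟩
          rw [hi] at hj'; rwa [Sum.inl_injective hj']
        · exact fun h => ⟨i', h, hi⟩
      by_cases h : i' < i
      · rw [if_neg h.not_gt, if_pos (hr.2 h)]
      · rw [if_pos (lt_of_le_of_ne (not_lt.1 h) hne.symm), if_neg (fun h' => h (hr.1 h'))]
        rfl
    · rw [if_pos (unfoldVertex_inr_lt_inl j i), if_neg]
      · rfl
      · rintro ⟨j', -, h⟩; rw [hi] at h; exact absurd h (by simp)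

-- The sum over the labels `w` of the top vertices factorises once the labels at right ends of top
-- edges are held fixed: every other label occurs in a single product K·F, which sums to a Kronecker
-- delta.
open Classical in
theorem sum_top_labels {K F : Matrix ι ι κ} (hKF : K * F = 1) (d : Diagram k) (a b : Fin k → ι) :
    ∑ w : Fin k → ι, ∏ i : Fin k, (if IsRightTop d i then 1 else
        K (Sum.elim w b (d.mate (.inl i))) (w i)) * F (w i) (a i) =
      ∏ i : Fin k, if IsRightTop d i then F (Sum.elim a b (d.mate (.inl i))) (a i) else
        if ∃ j, d.mate (.inl i) = .inr j then
          (if Sum.elim a b (d.mate (.inl i)) = a i then 1 else 0) else 1 := by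
  -- Splits `w` into its values `w₂` at right top ends and `w₁` elsewhere. The function `X` reads
  -- neighbours off `w₂` alone, since the top partner of a vertex that is not a right end is one.
  let e := Equiv.piEquivPiSubtypeProd (IsRightTop d) (fun _ : Fin k => ι)
  let X : ({i // IsRightTop d i} → ι) → Fin k ⊕ Fin k → ι := fun w₂ =>
    Sum.elim (fun i => if h : IsRightTop d i then w₂ ⟨i, h⟩ else a i) b
  have e2 : ∀ w₂ w₁ (i : {i // IsRightTop d i}), e.symm (w₂, w₁) i = w₂ i := by
    intro w₂ w₁ i
    simp [e, Equiv.piEquivPiSubtypeProd, i.2]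
  have e1 : ∀ w₂ w₁ (i : {i // ¬ IsRightTop d i}), e.symm (w₂, w₁) i = w₁ i := by
    intro w₂ w₁ i
    simp [e, Equiv.piEquivPiSubtypeProd, i.2]
  have hleft : ∀ i : Fin k, ¬ IsRightTop d i → ∀ i', d.mate (.inl i) = .inl i' →
      IsRightTop d i' := by
    intro i hi i' h
    refine ⟨i, lt_of_le_of_ne ?_ ?_, by rw [← h, d.mate_mate]⟩
    · exact not_lt.1 fun h' => hi ⟨i', h', h⟩
    · rintro rfl; exact d.mate_ne _ h
  have eX : ∀ w₂ w₁ (i : {i // ¬ IsRightTop d i}),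
      Sum.elim (e.symm (w₂, w₁)) b (d.mate (.inl i)) = X w₂ (d.mate (.inl i)) := by
    intro w₂ w₁ i
    rcases h : d.mate (.inl i.1) with i' | j
    · have hi' := hleft i i.2 i' h
      simp only [X, Sum.elim_inl, dif_pos hi']
      exact e2 w₂ w₁ ⟨i', hi'⟩
    · rfl
  have inner : ∀ w₂, ∑ w₁, ∏ i : Fin k, (if IsRightTop d i then 1 else
        K (Sum.elim (e.symm (w₂, w₁)) b (d.mate (.inl i))) (e.symm (w₂, w₁) i)) *
          F (e.symm (w₂, w₁) i) (a i) =
      (∏ i : {i // IsRightTop d i}, F (w₂ i) (a i)) *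
        ∏ i : {i // ¬ IsRightTop d i}, if X w₂ (d.mate (.inl i)) = a i then 1 else 0 := by
    intro w₂
    have hδ : ∀ i : {i // ¬ IsRightTop d i},
        (if X w₂ (d.mate (.inl i)) = a i then (1 : κ) else 0) =
          ∑ u, K (X w₂ (d.mate (.inl i))) u * F u (a i) := by
      intro i
      rw [← Matrix.mul_apply, hKF, Matrix.one_apply]
    simp only [hδ]
    rw [Finset.prod_univ_sum, Finset.mul_sum]
    simp only [Fintype.piFinset_univ]
    refine Finset.sum_congr rfl fun w₁ _ => ?_
    rw [← Fintype.prod_subtype_mul_prod_subtype (IsRightTop d)]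
    congr 1
    · refine Finset.prod_congr rfl fun i _ => ?_
      rw [if_pos i.2, one_mul, e2]
    · refine Finset.prod_congr rfl fun i _ => ?_
      rw [if_neg i.2, e1, eX]
  -- The deltas at the left ends of top edges force this value, after which F(`w₂`, `a`) becomes the
  -- weight of the top edge.
  let w₀ : {i // IsRightTop d i} → ι := fun i => Sum.elim a b (d.mate (.inl i))
  rw [← e.symm.sum_comp, Fintype.sum_prod_type]
  simp only [inner]
  rw [Finset.sum_eq_single w₀, ← Fintype.prod_subtype_mul_prod_subtype (IsRightTop d)]
  · congr 1
    · refine Finset.prod_congr rfl fun i _ => ?_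
      rw [if_pos i.2]
    · refine Finset.prod_congr rfl fun i _ => ?_
      rw [if_neg i.2]
      rcases h : d.mate (.inl i.1) with i' | j
      · have hi' := hleft i i.2 i' h
        have hm : d.mate (.inl i') = .inl i.1 := by rw [← h, d.mate_mate]
        simp [X, hi', w₀, hm]
      · simp only [X, Sum.elim_inr, Sum.inr.injEq, exists_eq', if_true]
        congr
  · intro w₂ _ hw
    obtain ⟨i, hi⟩ := Function.ne_iff.1 hw
    obtain ⟨j, hj, hj'⟩ := i.2
    have hm : d.mate (.inl j) = .inl i.1 := by rw [← hj', d.mate_mate]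
    have hnj : ¬ IsRightTop d j := by
      rintro ⟨i', h1, h2⟩
      rw [hm] at h2
      rw [← Sum.inl_injective h2] at h1
      exact h1.not_gt hj
    refine mul_eq_zero_of_right _ (Finset.prod_eq_zero (Finset.mem_univ ⟨j, hnj⟩) (if_neg ?_))
    simp only [X, hm, Sum.elim_inl, dif_pos i.2]
    intro h
    exact hi (by simp only [w₀, hj', Sum.elim_inl]; exact h)
  · simp

variable {V : Type*} [AddCommGroup V] [Module κ V] [FiniteDimensional κ V]
  (v : Module.Basis ι κ V)
  {ω : LinearMap.BilinForm κ V} {G : Type*} [CommGroup G] {β : SymmBicharacter G κ}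
  {𝒱 : G → Submodule κ V} {c : ι → G}

/-- Wherever the form factors are nonzero, the intermediate top labels have degrees inverse to the
input labels. The crossing factor is therefore constant on the support of the sum, and only edge
factors remain to be summed. -/
theorem psiEntry_eq_weight (hω : IsSkewForm β 𝒱 ω) (hv : ∀ i, v i ∈ 𝒱 (c i)) (d : Diagram k)
    (a b : Fin k → ι) : psiEntry v ω β c d a b = weight β (gram v ω) c d a b := by
  classical
  set C : κ := ∏ p : (Fin k ⊕ Fin k) × (Fin k ⊕ Fin k) with
      unfoldVertex k p.1 < unfoldVertex k p.2 ∧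
      unfoldVertex k p.2 < unfoldVertex k (d.mate p.1) ∧
      unfoldVertex k (d.mate p.1) < unfoldVertex k (d.mate p.2),
    crossingWeight β (c ∘ Sum.elim a b) (d.mate p.1) (d.mate p.2) with hC
  have hcross : ∀ w : Fin k → ι, (∏ i : Fin k, gram v ω (w i.rev) (a i)) ≠ 0 →
      crossProd β c (unfold d) (Fin.append b w) = C := by
    intro w hw
    have hdeg : ∀ i, c (w i.rev) = (c (a i))⁻¹ := fun i =>
      gram_deg v hω hv (Finset.prod_ne_zero_iff.1 hw i (Finset.mem_univ i))
    rw [crossProd, hC]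
    refine (Finset.prod_equiv (Equiv.prodCongr (unfoldVertex k) (unfoldVertex k)) ?_ ?_).symm
    · rintro ⟨x, y⟩
      rw [Finset.mem_filter, Finset.mem_filter]
      simp only [Finset.mem_univ, true_and, Equiv.prodCongr_apply, Prod.map_apply,
        unfold_mate_unfoldVertex]
    · rintro ⟨x, y⟩ hxy
      rw [Finset.mem_filter] at hxy
      simp only [Equiv.prodCongr_apply, Prod.map_apply,
        unfold_mate_unfoldVertex, append_comp_unfoldVertex]
      have h3 := hxy.2.2.2
      simp only at h3
      -- Inverting both degrees preserves β; inverting only the second transposes it, which accounts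
      -- for the exceptional case of `crossingWeight`. A top vertex never precedes a bottom vertex.
      rcases hx : d.mate x with i | j <;> rcases hy : d.mate y with i' | j'
      · simp [crossingWeight, hdeg, β.val_inv_left]
      · rw [hx, hy] at h3
        exact absurd h3 (unfoldVertex_inr_lt_inl _ _).not_gt
      · simp [crossingWeight, hdeg, β.val_inv_right]
      · simp [crossingWeight]
  have hterm : ∀ w : Fin k → ι, coeff β (gram v ω)⁻¹ c (unfold d) (Fin.append b w) *
      ∏ i : Fin k, gram v ω (w i.rev) (a i) =
      edgeProd (gram v ω)⁻¹ (unfold d) (Fin.append b w) *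
        (∏ i : Fin k, gram v ω (w i.rev) (a i)) * C := by
    intro w
    by_cases hw : (∏ i : Fin k, gram v ω (w i.rev) (a i)) = 0
    · rw [hw]; ring
    · rw [coeff, hcross w hw]; ring
  have hsum : ∑ w : Fin k → ι, edgeProd (gram v ω)⁻¹ (unfold d) (Fin.append b w) *
      (∏ i : Fin k, gram v ω (w i.rev) (a i)) =
      (∏ p : Fin k × Fin k with p.1 < p.2 ∧ d.mate (.inr p.1) = .inr p.2,
        (gram v ω)⁻¹ (b p.1) (b p.2)) *
      ∏ i : Fin k, if IsRightTop d i then gram v ω (Sum.elim a b (d.mate (.inl i))) (a i) else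
        if ∃ j, d.mate (.inl i) = .inr j then
          (if Sum.elim a b (d.mate (.inl i)) = a i then 1 else 0) else 1 := by
    rw [← sum_top_labels (gram_inv_mul v ω hω.nondegenerate), Finset.mul_sum]
    refine Fintype.sum_equiv (Equiv.arrowCongr Fin.revPerm (Equiv.refl ι)) _ _ fun w => ?_
    have hw : (Equiv.arrowCongr Fin.revPerm (Equiv.refl ι)) w = fun i => w i.rev := by
      funext i; simp [Equiv.arrowCongr]
    rw [hw, edgeProd_unfold, Finset.prod_mul_distrib, mul_assoc]
  have hprod : (∏ i : Fin k, if IsRightTop d i then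
        gram v ω (Sum.elim a b (d.mate (.inl i))) (a i) else
        if ∃ j, d.mate (.inl i) = .inr j then
          (if Sum.elim a b (d.mate (.inl i)) = a i then (1 : κ) else 0) else 1) =
      (∏ p : Fin k × Fin k with p.1 < p.2 ∧ d.mate (.inl p.1) = .inl p.2,
        gram v ω (a p.1) (a p.2)) *
      ∏ p : Fin k × Fin k with d.mate (.inl p.1) = .inr p.2, if a p.1 = b p.2 then 1 else 0 := by
    rw [Finset.prod_filter, Finset.prod_filter, Fintype.prod_prod_type_right,
      Fintype.prod_prod_type, ← Finset.prod_mul_distrib]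
    refine Finset.prod_congr rfl fun i _ => ?_
    rcases hi : d.mate (.inl i) with i' | j
    · have hm : d.mate (.inl i') = .inl i := by rw [← hi, d.mate_mate]
      have hr : IsRightTop d i ↔ i' < i := by
        constructor
        · rintro ⟨j, hj, hj'⟩
          rw [hi] at hj'; rwa [Sum.inl_injective hj']
        · exact fun h => ⟨i', h, hi⟩
      rw [Fintype.prod_eq_single i']
      · simp [hi, hm, hr]
      · intro x hx
        refine if_neg ?_
        rintro ⟨-, h⟩
        rw [Matching.mate_eq_iff, hi] at h
        exact hx (Sum.inl_injective h)
    · have hr : ¬ IsRightTop d i := by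
        rintro ⟨j', -, h⟩; rw [hi] at h; exact absurd h (by simp)
      have h1 : ∀ x, d.mate (.inl x) ≠ .inl i := by
        intro x h
        rw [Matching.mate_eq_iff, hi] at h
        exact absurd h (by simp)
      simp [hi, hr, h1, eq_comm]
  rw [psiEntry, weight]
  simp only [hterm]
  rw [← Finset.sum_mul, hsum, hprod]
  ring

end Weight

/-! ### Composition with the generators -/

section Generators

variable {κ : Type*} [Field κ] {V : Type*} [AddCommGroup V] [Module κ V] [FiniteDimensional κ V]
  {ι : Type*} [Fintype ι] [DecidableEq ι] (v : Module.Basis ι κ V)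
  {ω : LinearMap.BilinForm κ V} {G : Type*} [CommGroup G] {β : SymmBicharacter G κ} {k : ℕ}

/-- Permutation of the bottom vertices of a diagram. -/
def Diagram.permBot (σ : Equiv.Perm (Fin k)) (d : Diagram k) : Diagram k :=
  Matching.relabel (Equiv.sumCongr (Equiv.refl _) σ) d

theorem unfold_eq_relabel (d : Diagram k) : unfold d = Matching.relabel (unfoldVertex k) d := rfl

theorem unfold_id : unfold (Diagram.id k) = nested k := by
  ext1; funext y
  obtain ⟨x, rfl⟩ := (unfoldVertex k).surjective y
  rw [unfold_mate_unfoldVertex]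
  rcases x with i | j
  · ext; simp [Diagram.id, unfoldVertex_inl, unfoldVertex_inr, nested, Fin.val_rev]; omega
  · ext; simp [Diagram.id, unfoldVertex_inl, unfoldVertex_inr, nested, Fin.val_rev]; omega

theorem swap_castAdd (i j x : Fin k) : Equiv.swap (Fin.castAdd k i) (Fin.castAdd k j)
    (Fin.castAdd k x) = Fin.castAdd k (Equiv.swap i j x) := by
  simp only [Equiv.swap_apply_def, (Fin.castAdd_injective k k).eq_iff, apply_ite (Fin.castAdd k)]

theorem swap_castAdd_natAdd (i j x : Fin k) : Equiv.swap (Fin.castAdd k i) (Fin.castAdd k j)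
    (Fin.natAdd k x) = Fin.natAdd k x := by
  refine Equiv.swap_apply_of_ne_of_ne ?_ ?_ <;>
    · rw [Ne, Fin.ext_iff, Fin.val_natAdd, Fin.val_castAdd]; omega

theorem unfold_permBot_swap (i j : Fin k) (d : Diagram k) :
    unfold (d.permBot (Equiv.swap i j)) =
      (unfold d).relabel (Equiv.swap (Fin.castAdd k i) (Fin.castAdd k j)) := by
  rw [Diagram.permBot, unfold_eq_relabel, unfold_eq_relabel, Matching.relabel_relabel,
    Matching.relabel_relabel]
  congr 1
  ext1 x
  rcases x with x | x
  · simp only [Equiv.trans_apply, Equiv.sumCongr_apply, Sum.map_inl, Equiv.refl_apply,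
      unfoldVertex_inl, swap_castAdd_natAdd]
  · simp only [Equiv.trans_apply, Equiv.sumCongr_apply, Sum.map_inr, unfoldVertex_inr,
      swap_castAdd]

theorem append_comp_swap (i j : Fin k) (b w : Fin k → ι) :
    Fin.append b w ∘ Equiv.swap (Fin.castAdd k i) (Fin.castAdd k j) =
      Fin.append (b ∘ Equiv.swap i j) w := by
  funext x
  induction x using Fin.addCases with
  | left x => rw [Function.comp_apply, swap_castAdd, Fin.append_left, Fin.append_left]; rfl
  | right x => rw [Function.comp_apply, swap_castAdd_natAdd, Fin.append_right, Fin.append_right]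

theorem relabelTwo_append (p q : Fin k) (b w : Fin k → ι) (u z : ι) :
    relabelTwo (Fin.append b w) (Fin.castAdd k p) (Fin.castAdd k q) u z =
      Fin.append (relabelTwo b p q u z) w := by
  funext x
  rw [relabelTwo_apply]
  induction x using Fin.addCases with
  | left x =>
    rw [Fin.append_left, Fin.append_left, relabelTwo_apply]
    simp only [(Fin.castAdd_injective k k).eq_iff]
  | right x =>
    rw [Fin.append_right, Fin.append_right, if_neg, if_neg] <;>
      · rw [Fin.ext_iff, Fin.val_natAdd, Fin.val_castAdd]; omega

theorem psiEntry_id (hω : ω.Nondegenerate) (c : ι → G) (a b : Fin k → ι) :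
    psiEntry v ω β c (Diagram.id k) a b = if b = a then 1 else 0 := by
  have h : ∀ w : Fin k → ι,
      coeff β (gram v ω)⁻¹ c (unfold (Diagram.id k)) (Fin.append b w) *
        ∏ i : Fin k, gram v ω (w i.rev) (a i) =
      ∏ i : Fin k, (gram v ω)⁻¹ (b i) (w i.rev) * gram v ω (w i.rev) (a i) := by
    intro w
    rw [unfold_id, coeff_nested, Finset.prod_mul_distrib]
  have h2 : ∑ w : Fin k → ι, ∏ i : Fin k, (gram v ω)⁻¹ (b i) (w i.rev) *
        gram v ω (w i.rev) (a i) =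
      ∑ w : Fin k → ι, ∏ i : Fin k, (gram v ω)⁻¹ (b i) (w i) * gram v ω (w i) (a i) :=
    Fintype.sum_equiv (Equiv.arrowCongr Fin.revPerm (Equiv.refl ι)) _ _ fun w => by
      simp [Equiv.arrowCongr]
  rw [psiEntry]
  simp only [h]
  have h3 := Finset.prod_univ_sum (fun _ : Fin k => (Finset.univ : Finset ι))
    fun i u => (gram v ω)⁻¹ (b i) u * gram v ω u (a i)
  rw [Fintype.piFinset_univ] at h3
  rw [h2, ← h3]
  simp only [← Matrix.mul_apply, gram_inv_mul v ω hω, Matrix.one_apply]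
  rw [Finset.prod_ite_zero]
  simp [funext_iff]

variable {c : ι → G}

theorem psiEntry_permBot_swap (hK : IsSkewMatrix β (gram v ω)⁻¹ c) {i j : Fin k}
    (hij : i.val + 1 = j.val) (d : Diagram k) (a b : Fin k → ι) :
    psiEntry v ω β c (d.permBot (Equiv.swap i j)) a b =
      -β.val (c (b i)) (c (b j)) * psiEntry v ω β c d a (b ∘ Equiv.swap i j) := by
  rw [psiEntry, psiEntry, Finset.mul_sum]
  refine Finset.sum_congr rfl fun w _ => ?_
  rw [unfold_permBot_swap, coeff_relabel_swap hK (by simpa using hij), append_comp_swap,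
    Fin.append_left, Fin.append_left, mul_assoc]

/-- `capCup` as a linear map. -/
def capCupLin (K F : Matrix ι ι κ) {N : ℕ} (p q : Fin N) :
    ((Fin N → ι) → κ) →ₗ[κ] ((Fin N → ι) → κ) where
  toFun := capCup K F p q
  map_add' φ ψ := by
    funext l
    simp only [capCup, Pi.add_apply, mul_add, Finset.sum_add_distrib]
  map_smul' r φ := by
    funext l
    simp only [capCup, Pi.smul_apply, smul_eq_mul, RingHom.id_apply, Finset.mul_sum]
    refine Finset.sum_congr rfl fun u _ => Finset.sum_congr rfl fun w _ => ?_
    ring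

/-- The entry is a linear combination of coefficients of the unfolded tensor, so contracting bottom
vertices of the diagram is contracting among the first positions of that tensor. -/
theorem capCup_psiEntry (K F : Matrix ι ι κ) (p q : Fin k) (d : Diagram k) (a b : Fin k → ι) :
    capCup K F p q (psiEntry v ω β c d a) b =
      ∑ w : Fin k → ι, capCup K F (Fin.castAdd k p) (Fin.castAdd k q)
        (coeff β (gram v ω)⁻¹ c (unfold d)) (Fin.append b w) *
          ∏ i : Fin k, gram v ω (w i.rev) (a i) := by
  have h1 : psiEntry v ω β c d a = ∑ w : Fin k → ι, (∏ i : Fin k, gram v ω (w i.rev) (a i)) •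
      fun b => coeff β (gram v ω)⁻¹ c (unfold d) (Fin.append b w) := by
    funext b
    rw [Finset.sum_apply, psiEntry]
    exact Finset.sum_congr rfl fun w _ => mul_comm _ _
  have h2 : capCup K F p q (psiEntry v ω β c d a) = capCupLin K F p q (psiEntry v ω β c d a) := rfl
  rw [h2, h1, map_sum, Finset.sum_apply]
  refine Finset.sum_congr rfl fun w _ => ?_
  rw [map_smul, Pi.smul_apply, smul_eq_mul, mul_comm]
  congr 1
  simp only [capCupLin, LinearMap.coe_mk, AddHom.coe_mk, capCup, relabelTwo_append,
    Fin.append_left]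

theorem unfold_splice (d : Diagram k) {p q : Fin k} (hpq : p ≠ q) :
    unfold (Matching.splice d (.inr p) (.inr q) (Sum.inr_injective.ne hpq)) =
      (unfold d).splice (Fin.castAdd k p) (Fin.castAdd k q)
        ((Fin.castAdd_injective k k).ne hpq) := by
  rw [unfold_eq_relabel, Matching.relabel_splice]
  rfl

theorem capCup_psiEntry_splice (hω : ω.Nondegenerate) (hK : IsSkewMatrix β (gram v ω)⁻¹ c)
    {p q : Fin k} (hp : p.val = 0) (hq : q.val = 1) (hpq : p ≠ q) (d : Diagram k)
    (hd : d.mate (.inr p) ≠ .inr q) (a : Fin k → ι) :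
    capCup (gram v ω)⁻¹ (gram v ω) p q (psiEntry v ω β c d a) =
      psiEntry v ω β c (Matching.splice d (.inr p) (.inr q) (Sum.inr_injective.ne hpq)) a := by
  funext b
  rw [capCup_psiEntry, psiEntry, unfold_splice d hpq]
  refine Finset.sum_congr rfl fun w _ => ?_
  rw [capCup_coeff hK (gram_mul_inv v ω hω) (by simpa using hp) (by simpa using hq)]
  rw [← unfoldVertex_inr, ← unfoldVertex_inr, unfold_mate_unfoldVertex]
  exact (unfoldVertex k).injective.ne hd

/-- The value of a closed loop. -/
noncomputable def loopValue (ω : LinearMap.BilinForm κ V) : κ :=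
  ∑ u, ∑ w, gram v ω u w * (gram v ω)⁻¹ u w

theorem capCup_psiEntry_of_mate_eq {p q : Fin k} (hp : p.val = 0) (hq : q.val = 1) (hpq : p ≠ q)
    (d : Diagram k) (hd : d.mate (.inr p) = .inr q) (a : Fin k → ι) :
    capCup (gram v ω)⁻¹ (gram v ω) p q (psiEntry v ω β c d a) =
      loopValue v ω • psiEntry v ω β c d a := by
  funext b
  rw [capCup_psiEntry, Pi.smul_apply, psiEntry, Finset.smul_sum]
  refine Finset.sum_congr rfl fun w _ => ?_
  rw [capCup_coeff_of_mate_eq (by simpa using hp) (by simpa using hq)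
    ((Fin.castAdd_injective k k).ne hpq), smul_eq_mul, mul_assoc]
  · rfl
  · rw [← unfoldVertex_inr, ← unfoldVertex_inr, unfold_mate_unfoldVertex, hd]

variable [Fintype G] [DecidableEq G] {𝒱 : G → Submodule κ V} [DirectSum.Decomposition 𝒱]

theorem Psi_tprod_eq_tens (hω : IsSkewForm β 𝒱 ω) (hv : ∀ i, v i ∈ 𝒱 (c i)) (d : Diagram k)
    (a : Fin k → ι) :
    Psi β 𝒱 ω hω.nondegenerate d (PiTensorProduct.tprod κ fun i => v (a i)) =
      tens v k (psiEntry v ω β c d a) := by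
  rw [Psi_tprod v ω β 𝒱 hω.nondegenerate hv (isSkewMatrix_gram_inv v hω hv), tens_apply]

theorem Psi_id (hω : IsSkewForm β 𝒱 ω) (hv : ∀ i, v i ∈ 𝒱 (c i)) :
    Psi β 𝒱 ω hω.nondegenerate (Diagram.id k) = 1 := by
  refine tens_hom_ext v fun a => ?_
  have h : psiEntry v ω β c (Diagram.id k) a = Pi.single a 1 := by
    funext b
    rw [psiEntry_id v hω.nondegenerate, Pi.single_apply]
  rw [Psi_tprod_eq_tens v hω hv, h, tens_single]
  rfl

theorem Psi_permBot_adjSwap (hω : IsSkewForm β 𝒱 ω) (hv : ∀ i, v i ∈ 𝒱 (c i)) (i : AdjIdx k)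
    (d : Diagram k) :
    Psi β 𝒱 ω hω.nondegenerate (d.permBot (adjSwap i)) =
      braid β 𝒱 i * Psi β 𝒱 ω hω.nondegenerate d := by
  refine tens_hom_ext v fun a => ?_
  rw [Module.End.mul_apply, Psi_tprod_eq_tens v hω hv, Psi_tprod_eq_tens v hω hv,
    braid_tens β 𝒱 v hv]
  congr 1
  funext b
  exact psiEntry_permBot_swap v (isSkewMatrix_gram_inv v hω hv) rfl d a b

/-- The endomorphism of `V^{⊗N}` with coordinate form `capCup`. -/
noncomputable def contraction (ω : LinearMap.BilinForm κ V) {N : ℕ} (p q : Fin N) :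
    Module.End κ (⨂[κ]^N V) :=
  (tens v N).toLinearMap ∘ₗ capCupLin (gram v ω)⁻¹ (gram v ω) p q ∘ₗ (tens v N).symm.toLinearMap

theorem contraction_tens {N : ℕ} (p q : Fin N) (φ : (Fin N → ι) → κ) :
    contraction v ω p q (tens v N φ) = tens v N (capCup (gram v ω)⁻¹ (gram v ω) p q φ) := by
  simp only [contraction, LinearMap.comp_apply, LinearEquiv.coe_coe, LinearEquiv.symm_apply_apply]
  rfl

theorem contraction_mul_Psi (hω : IsSkewForm β 𝒱 ω) (hv : ∀ i, v i ∈ 𝒱 (c i)) {p q : Fin k}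
    (hp : p.val = 0) (hq : q.val = 1) (hpq : p ≠ q) (d : Diagram k) :
    contraction v ω p q * Psi β 𝒱 ω hω.nondegenerate d =
      (if d.mate (.inr p) = .inr q then loopValue v ω else 1) • Psi β 𝒱 ω hω.nondegenerate
        (Matching.splice d (.inr p) (.inr q) (Sum.inr_injective.ne hpq)) := by
  refine tens_hom_ext v fun a => ?_
  rw [Module.End.mul_apply, LinearMap.smul_apply, Psi_tprod_eq_tens v hω hv,
    Psi_tprod_eq_tens v hω hv, contraction_tens]
  split_ifs with h
  · rw [Matching.splice_eq_self _ _ _ _ h, ← map_smul,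
      capCup_psiEntry_of_mate_eq v hp hq hpq d h]
  · rw [one_smul, capCup_psiEntry_splice v hω.nondegenerate (isSkewMatrix_gram_inv v hω hv) hp hq
      hpq d h]

end Generators

/-! ### The generators preserve the grading and commute with the action -/

section Action

variable {κ : Type*} [Field κ] {G : Type*} [CommGroup G] {β : SymmBicharacter G κ}
  {ι : Type*} [Fintype ι] {c : ι → G} {N : ℕ}

/-- The action of the matrix `X`, homogeneous of degree `a`, on the coordinates of tensors. -/
def actCoord (β : SymmBicharacter G κ) (c : ι → G) (a : G) (X : Matrix ι ι κ)
    (φ : (Fin N → ι) → κ) (l : Fin N → ι) : κ :=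
  ∑ i : Fin N, (∏ j : Fin N with j < i, β.val (c (l j)) a) *
    ∑ u, X (l i) u * φ (Function.update l i u)

/-- The summand at position `x` on one side matches the summand at the swapped position on the
other. -/
theorem actCoord_swap {a : G} {X : Matrix ι ι κ} (hX : ∀ u w, X u w ≠ 0 → c u = a * c w)
    {i j : Fin N} (hij : i.val + 1 = j.val) (φ : (Fin N → ι) → κ) (l : Fin N → ι) :
    actCoord β c a X (fun l => -β.val (c (l i)) (c (l j)) * φ (l ∘ Equiv.swap i j)) l =
      -β.val (c (l i)) (c (l j)) * actCoord β c a X φ (l ∘ Equiv.swap i j) := by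
  classical
  have hne : i ≠ j := by rintro rfl; omega
  set s := Equiv.swap i j with hs
  have hupd : ∀ x u, Function.update l x u ∘ s = Function.update (l ∘ s) (s x) u := by
    intro x u
    funext y
    simp only [Function.comp_apply, Function.update_apply, hs, Equiv.swap_apply_eq_iff]
  rw [actCoord, actCoord, Finset.mul_sum]
  refine Fintype.sum_equiv s _ _ fun x => ?_
  have hsx : (l ∘ s) (s x) = l x := by simp [hs]
  rw [hsx, Finset.mul_sum, Finset.mul_sum, Finset.mul_sum]
  refine Finset.sum_congr rfl fun u _ => ?_
  rw [hupd]
  by_cases h0 : X (l x) u = 0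
  · rw [h0]; ring
  have hprod : (∏ y : Fin N with y < s x, β.val (c ((l ∘ s) y)) a) =
      ∏ y : Fin N with s y < s x, β.val (c (l y)) a := by
    refine Finset.prod_equiv s ?_ ?_
    · intro y; simp [hs]
    · intro y _; rfl
  -- If the operator acts at one of the swapped positions, it shifts that degree by `a`; the
  -- resulting change of the braid factor is compensated by the factor the operator gains or loses
  -- in passing the other position.
  have key : β.val (c (Function.update l x u i)) (c (Function.update l x u j)) *
        (∏ y : Fin N with y < x, β.val (c (l y)) a) =
      β.val (c (l i)) (c (l j)) * ∏ y : Fin N with s y < s x, β.val (c (l y)) a := by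
    have hd := hX _ _ h0
    by_cases hxi : x = i
    · subst hxi
      have hset : Finset.univ.filter (fun y => s y < s x) =
          insert j (Finset.univ.filter fun y => y < x) := by
        ext y
        rw [Finset.mem_insert, Finset.mem_filter, Finset.mem_filter, hs, swap_lt_swap_iff hij]
        simp only [Finset.mem_univ, true_and, and_true, Fin.ext_iff, Fin.lt_def]
        omega
      rw [hset, Finset.prod_insert (by rw [Finset.mem_filter, Fin.lt_def]; omega),
        Function.update_self, Function.update_of_ne hne.symm, hd, β.val_mul_left]
      linear_combination (-β.val (c u) (c (l j)) * ∏ y : Fin N with y < x, β.val (c (l y)) a) *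
        β.val_mul_val_symm a (c (l j))
    by_cases hxj : x = j
    · subst hxj
      have hset : Finset.univ.filter (fun y => y < x) =
          insert i (Finset.univ.filter fun y => s y < s x) := by
        ext y
        rw [Finset.mem_insert, Finset.mem_filter, Finset.mem_filter, hs, swap_lt_swap_iff hij]
        simp only [Finset.mem_univ, true_and, and_true, Fin.ext_iff, Fin.lt_def]
        omega
      rw [hset, Finset.prod_insert, Function.update_self, Function.update_of_ne hne, hd,
        β.val_mul_right]
      · ring
      · rw [Finset.mem_filter, hs, swap_lt_swap_iff hij]
        rintro ⟨-, ⟨-, h⟩ | ⟨h, -⟩⟩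
        exacts [h ⟨rfl, rfl⟩, hne h]
    · have hset : Finset.univ.filter (fun y => s y < s x) =
          Finset.univ.filter fun y => y < x := by
        ext y
        rw [Finset.mem_filter, Finset.mem_filter, hs, swap_lt_swap_iff hij]
        simp only [hxi, hxj, Finset.mem_univ, true_and, and_false, not_false_eq_true, and_true,
          or_false]
      rw [hset, Function.update_of_ne (Ne.symm hxi), Function.update_of_ne (Ne.symm hxj)]
  rw [hprod]
  linear_combination (-(X (l x) u * φ (Function.update (l ∘ s) (s x) u))) * key

theorem sum_eq_add_add_erase {M : Type*} [AddCommMonoid M] {J : Type*} [Fintype J] [DecidableEq J]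
    {p q : J} (hpq : p ≠ q) (f : J → M) :
    ∑ i, f i = f p + (f q + ∑ i ∈ (Finset.univ.erase p).erase q, f i) := by
  rw [← Finset.add_sum_erase _ f (Finset.mem_univ p),
    ← Finset.add_sum_erase _ f (Finset.mem_erase.2 ⟨hpq.symm, Finset.mem_univ q⟩)]

/-- The terms acting on the inserted pair cancel by invariance of `K`, those acting on the
contracted pair by invariance of `F`. Acting to the right of a pair of inverse degrees produces no
factor from it, so the remaining terms agree. -/
theorem actCoord_capCup {K F : Matrix ι ι κ} (hK : IsSkewMatrix β K c)
    (hF : ∀ i j, F i j ≠ 0 → c j = (c i)⁻¹) {a : G} {X : Matrix ι ι κ}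
    (hXF : ∀ s t, ∑ u, (X u s * F u t + β.val (c s) a * (F s u * X u t)) = 0)
    (hXK : ∀ s t, ∑ u, (X s u * K u t + β.val (c s) a * (K s u * X t u)) = 0)
    {p q : Fin N} (hp : p.val = 0) (hq : q.val = 1) (φ : (Fin N → ι) → κ) (l : Fin N → ι) :
    actCoord β c a X (capCup K F p q φ) l = capCup K F p q (actCoord β c a X φ) l := by
  classical
  have hpq : p ≠ q := by rintro rfl; omega
  have hltp : ∀ j : Fin N, ¬ j < p := by intro j; rw [Fin.lt_def]; omega
  have hltq : ({j | j < q} : Finset (Fin N)) = {p} := by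
    ext j; rw [Finset.mem_filter, Finset.mem_singleton, Fin.lt_def, Fin.ext_iff]; simp; omega
  -- The prefix factor without `p` and `q`, whose contributions β(g,a) and β(g⁻¹,a) cancel.
  let R : Fin N → κ := fun i => ∏ j ∈ ((({j | j < i} : Finset (Fin N)).erase p).erase q),
    β.val (c (l j)) a
  have hbig : ∀ i : Fin N, i ≠ p → i ≠ q → p < i ∧ q < i := by
    intro i; simp only [ne_eq, Fin.ext_iff, Fin.lt_def]; omega
  have hR : ∀ (m : Fin N → ι) (i : Fin N), i ≠ p → i ≠ q → (∀ j, j ≠ p → j ≠ q → m j = l j) →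
      c (m q) = (c (m p))⁻¹ → (∏ j : Fin N with j < i, β.val (c (m j)) a) = R i := by
    intro m i h1 h2 hm hinv
    obtain ⟨h3, h4⟩ := hbig i h1 h2
    have hmp : p ∈ ({j | j < i} : Finset (Fin N)) := by rw [Finset.mem_filter]; simpa using h3
    have hmq : q ∈ ({j | j < i} : Finset (Fin N)).erase p := by
      rw [Finset.mem_erase, Finset.mem_filter]; exact ⟨hpq.symm, by simpa using h4⟩
    rw [← Finset.mul_prod_erase _ _ hmp, ← Finset.mul_prod_erase _ _ hmq, hinv, β.val_inv_left,
      ← mul_assoc, β.val_mul_val_symm, one_mul]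
    refine Finset.prod_congr rfl fun j hj => ?_
    rw [Finset.mem_erase, Finset.mem_erase] at hj
    rw [hm j hj.2.1 hj.1]
  have hrp : ∀ (m : Fin N → ι) u w, relabelTwo m p q u w p = u := fun m u w => by
    rw [relabelTwo_apply, if_neg hpq, if_pos rfl]
  have hrq : ∀ (m : Fin N → ι) u w, relabelTwo m p q u w q = w := fun m u w => by
    rw [relabelTwo_apply, if_pos rfl]
  have hro : ∀ (m : Fin N → ι) u w j, j ≠ p → j ≠ q → relabelTwo m p q u w j = m j :=
    fun m u w j h1 h2 => by rw [relabelTwo_apply, if_neg h2, if_neg h1]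
  have hup : ∀ u w z, Function.update (relabelTwo l p q u w) p z = relabelTwo l p q z w := by
    intro u w z; funext j
    simp only [Function.update_apply, relabelTwo_apply]
    split_ifs with h1 h2 <;> first | rfl | exact absurd (h1.symm.trans h2) hpq
  have huq : ∀ u w z, Function.update (relabelTwo l p q u w) q z = relabelTwo l p q u z := by
    intro u w z; funext j
    simp only [Function.update_apply, relabelTwo_apply]
    split_ifs <;> rfl
  have huo : ∀ u w i z, i ≠ p → i ≠ q → Function.update (relabelTwo l p q u w) i z =
      relabelTwo (Function.update l i z) p q u w := by
    intro u w i z h1 h2; funext j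
    simp only [Function.update_apply, relabelTwo_apply]
    split_ifs with h3 h4 h5 <;> first
      | rfl
      | exact absurd (h3.symm.trans h4) h2
      | exact absurd (h3.symm.trans h5) h1
  have hsp : ∀ z u w, relabelTwo (Function.update l p z) p q u w = relabelTwo l p q u w := by
    intro z u w; simp [relabelTwo]
  have hsq : ∀ z u w, relabelTwo (Function.update l q z) p q u w = relabelTwo l p q u w := by
    intro z u w; funext j
    simp only [relabelTwo_apply, Function.update_apply]
    split_ifs <;> rfl
  let S : (Fin N → ι) → κ := fun m => ∑ u, ∑ w, F u w * φ (relabelTwo m p q u w)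
  -- The common value of both sides up to the factor `K (l p) (l q)`: contract first, then act at
  -- the other positions.
  let T : κ := ∑ i ∈ (Finset.univ.erase p).erase q, R i * ∑ z, X (l i) z * S (Function.update l i z)
  have hleft : actCoord β c a X (capCup K F p q φ) l = K (l p) (l q) * T := by
    rw [actCoord, sum_eq_add_add_erase hpq]
    have e1 : (∏ j : Fin N with j < p, β.val (c (l j)) a) *
        ∑ u, X (l p) u * capCup K F p q φ (Function.update l p u) =
        (∑ u, X (l p) u * K u (l q)) * S l := by
      rw [Finset.prod_eq_one (fun j hj => absurd (Finset.mem_filter.1 hj).2 (hltp j)), one_mul,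
        Finset.sum_mul]
      refine Finset.sum_congr rfl fun u _ => ?_
      rw [capCup, Function.update_self, Function.update_of_ne hpq.symm, mul_assoc]
      simp only [hsp, S]
    have e2 : (∏ j : Fin N with j < q, β.val (c (l j)) a) *
        ∑ u, X (l q) u * capCup K F p q φ (Function.update l q u) =
        (∑ u, β.val (c (l p)) a * (K (l p) u * X (l q) u)) * S l := by
      rw [hltq, Finset.prod_singleton, Finset.sum_mul, Finset.mul_sum]
      refine Finset.sum_congr rfl fun u _ => ?_
      rw [capCup, Function.update_self, Function.update_of_ne hpq]
      simp only [hsq, S]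
      ring
    have e3 : ∀ i ∈ (Finset.univ.erase p).erase q,
        (∏ j : Fin N with j < i, β.val (c (l j)) a) *
          ∑ u, X (l i) u * capCup K F p q φ (Function.update l i u) =
        K (l p) (l q) * (R i * ∑ z, X (l i) z * S (Function.update l i z)) := by
      intro i hi
      rw [Finset.mem_erase, Finset.mem_erase] at hi
      have hcc : ∀ u, capCup K F p q φ (Function.update l i u) =
          K (l p) (l q) * S (Function.update l i u) := fun u => by
        rw [capCup, Function.update_of_ne (Ne.symm hi.2.1), Function.update_of_ne (Ne.symm hi.1)]
      by_cases h0 : K (l p) (l q) = 0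
      · simp [hcc, h0]
      · rw [hR l i hi.2.1 hi.1 (fun _ _ _ => rfl) (hK.deg _ _ h0)]
        simp only [hcc, Finset.mul_sum]
        exact Finset.sum_congr rfl fun z _ => by ring
    have hX0 := hXK (l p) (l q)
    rw [Finset.sum_add_distrib] at hX0
    rw [e1, e2, Finset.sum_congr rfl e3, ← add_assoc, ← add_mul, hX0, zero_mul, zero_add,
      ← Finset.mul_sum]
  have hright : ∑ u, ∑ w, F u w * actCoord β c a X φ (relabelTwo l p q u w) = T := by
    have e0 : ∀ u w, F u w * actCoord β c a X φ (relabelTwo l p q u w) =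
        (∑ z, F u w * X u z * φ (relabelTwo l p q z w)) +
        ((∑ z, β.val (c u) a * (F u w * X w z) * φ (relabelTwo l p q u z)) +
        ∑ i ∈ (Finset.univ.erase p).erase q, R i *
          ∑ z, X (l i) z * (F u w * φ (relabelTwo (Function.update l i z) p q u w))) := by
      intro u w
      rw [actCoord, sum_eq_add_add_erase hpq, mul_add, mul_add]
      congr 1
      · rw [Finset.prod_eq_one (fun j hj => absurd (Finset.mem_filter.1 hj).2 (hltp j)), one_mul,
          Finset.mul_sum]
        refine Finset.sum_congr rfl fun z _ => ?_
        rw [hrp, hup, mul_assoc]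
      congr 1
      · rw [hltq, Finset.prod_singleton, Finset.mul_sum, Finset.mul_sum]
        refine Finset.sum_congr rfl fun z _ => ?_
        rw [hrp, hrq, huq]
        ring
      · rw [Finset.mul_sum]
        refine Finset.sum_congr rfl fun i hi => ?_
        rw [Finset.mem_erase, Finset.mem_erase] at hi
        by_cases h0 : F u w = 0
        · simp [h0]
        · rw [hR _ i hi.2.1 hi.1 (fun j h1 h2 => hro l u w j h1 h2)
            (by rw [hrp, hrq]; exact hF _ _ h0), hro l u w i hi.2.1 hi.1]
          simp only [huo u w i _ hi.2.1 hi.1, Finset.mul_sum]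
          exact Finset.sum_congr rfl fun z _ => by ring
    simp only [e0, Finset.sum_add_distrib]
    have e1 : ∑ u, ∑ w, ∑ z, F u w * X u z * φ (relabelTwo l p q z w) =
        ∑ s, ∑ t, (∑ u, X u s * F u t) * φ (relabelTwo l p q s t) := by
      have : ∀ u, ∑ w, ∑ z, F u w * X u z * φ (relabelTwo l p q z w) =
          ∑ s, ∑ t, X u s * F u t * φ (relabelTwo l p q s t) := by
        intro u
        rw [Finset.sum_comm]
        exact Finset.sum_congr rfl fun s _ => Finset.sum_congr rfl fun t _ => by ring
      simp only [this, Finset.sum_mul]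
      rw [Finset.sum_comm]
      exact Finset.sum_congr rfl fun s _ => Finset.sum_comm
    have e2 : ∑ u, ∑ w, ∑ z, β.val (c u) a * (F u w * X w z) * φ (relabelTwo l p q u z) =
        ∑ s, ∑ t, (∑ u, β.val (c s) a * (F s u * X u t)) * φ (relabelTwo l p q s t) := by
      refine Finset.sum_congr rfl fun s _ => ?_
      rw [Finset.sum_comm]
      simp only [Finset.sum_mul]
    have e3 : ∑ u, ∑ w, ∑ i ∈ (Finset.univ.erase p).erase q, R i *
        ∑ z, X (l i) z * (F u w * φ (relabelTwo (Function.update l i z) p q u w)) = T := by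
      have : ∀ u, ∑ w, ∑ i ∈ (Finset.univ.erase p).erase q, R i *
          ∑ z, X (l i) z * (F u w * φ (relabelTwo (Function.update l i z) p q u w)) =
          ∑ i ∈ (Finset.univ.erase p).erase q, R i *
          ∑ z, X (l i) z * ∑ w, (F u w * φ (relabelTwo (Function.update l i z) p q u w)) := by
        intro u
        rw [Finset.sum_comm]
        refine Finset.sum_congr rfl fun i _ => ?_
        rw [← Finset.mul_sum, Finset.sum_comm]
        simp only [Finset.mul_sum]
      simp only [this]
      rw [Finset.sum_comm]
      refine Finset.sum_congr rfl fun i _ => ?_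
      rw [← Finset.mul_sum, Finset.sum_comm]
      simp only [← Finset.mul_sum, S]
    rw [e1, e2, e3, ← add_assoc, ← Finset.sum_add_distrib]
    simp only [← Finset.sum_add_distrib, ← add_mul, hXF, zero_mul, Finset.sum_const_zero, zero_add]
  rw [hleft, capCup, hright]

end Action

/-! ### The action in coordinates and membership of the generators in `homG`. -/

section HomG

variable {κ : Type*} [Field κ] {V : Type*} [AddCommGroup V] [Module κ V]
  {ι : Type*} [Fintype ι] (v : Module.Basis ι κ V)
  {ω : LinearMap.BilinForm κ V} {G : Type*} [CommGroup G] [Fintype G] [DecidableEq G]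
  {β : SymmBicharacter G κ} {𝒱 : G → Submodule κ V} [DirectSum.Decomposition 𝒱] {c : ι → G}
  {N : ℕ}

theorem twist_of_mem {a b : G} {y : V} (hy : y ∈ 𝒱 b) : twist β 𝒱 a y = β.val b a • y := by
  rw [twist, LinearMap.sum_apply, Finset.sum_eq_single b]
  · rw [LinearMap.smul_apply, gproj_of_mem 𝒱 hy, if_pos rfl]
  · intro b' _ hb
    rw [LinearMap.smul_apply, gproj_of_mem 𝒱 hy, if_neg hb, smul_zero]
  · simp

theorem endProj_of_mem {a a' b : G} {x : Module.End κ V} (hx : x ∈ glDeg 𝒱 a) {y : V}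
    (hy : y ∈ 𝒱 b) : endProj 𝒱 a' x y = if a' = a then x y else 0 := by
  rw [endProj, LinearMap.sum_apply, Finset.sum_eq_single b]
  · simp only [LinearMap.comp_apply]
    rw [gproj_of_mem 𝒱 hy, if_pos rfl, gproj_of_mem 𝒱 (hx b y hy)]
    simp only [mul_left_inj]
  · intro b' _ hb
    simp only [LinearMap.comp_apply]
    rw [gproj_of_mem 𝒱 hy, if_neg hb, map_zero, map_zero]
  · simp

theorem tensorAct_tprod (hv : ∀ i, v i ∈ 𝒱 (c i)) (x : Module.End κ V) (l : Fin N → ι) :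
    tensorAct β 𝒱 N x (PiTensorProduct.tprod κ fun i => v (l i)) =
      ∑ a, ∑ i : Fin N, (∏ j : Fin N with j < i, β.val (c (l j)) a) •
        PiTensorProduct.tprod κ (Function.update (fun j => v (l j)) i
          (endProj 𝒱 a x (v (l i)))) := by
  simp only [tensorAct, LinearMap.sum_apply, PiTensorProduct.map_tprod]
  refine Finset.sum_congr rfl fun a _ => Finset.sum_congr rfl fun i _ => ?_
  rw [Finset.prod_filter, ← MultilinearMap.map_smul_univ]
  congr 1
  funext j
  by_cases h1 : j < i
  · rw [if_pos h1, if_pos h1, twist_of_mem (hv _), Function.update_of_ne h1.ne]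
  · by_cases h2 : j = i
    · subst h2; simp
    · simp [h1, h2]

theorem endProj_add (a : G) (x y : Module.End κ V) :
    endProj 𝒱 a (x + y) = endProj 𝒱 a x + endProj 𝒱 a y := by
  simp only [endProj, LinearMap.add_comp, LinearMap.comp_add, Finset.sum_add_distrib]

theorem tensorAct_add (hv : ∀ i, v i ∈ 𝒱 (c i)) (x y : Module.End κ V) :
    tensorAct β 𝒱 N (x + y) = tensorAct β 𝒱 N x + tensorAct β 𝒱 N y := by
  refine tens_hom_ext v fun l => ?_
  rw [LinearMap.add_apply, tensorAct_tprod v hv, tensorAct_tprod v hv, tensorAct_tprod v hv]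
  simp only [endProj_add, LinearMap.add_apply, MultilinearMap.map_update_add, smul_add,
    Finset.sum_add_distrib]

/-- The matrix of an endomorphism. -/
noncomputable def endMatrix (x : Module.End κ V) : Matrix ι ι κ :=
  Matrix.of fun u w => v.repr (x (v w)) u

theorem sum_endMatrix (x : Module.End κ V) (w : ι) : ∑ u, endMatrix v x u w • v u = x (v w) :=
  v.sum_repr (x (v w))

/-- The graded projection fixes `y` and deletes its coordinates along basis vectors of other
degrees. -/
theorem deg_of_repr_ne_zero (hv : ∀ i, v i ∈ 𝒱 (c i)) {g : G} {y : V} (hy : y ∈ 𝒱 g) {u : ι}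
    (hu : v.repr y u ≠ 0) : c u = g := by
  by_contra hc
  have h1 : gproj 𝒱 g y = y := by rw [gproj_of_mem 𝒱 hy, if_pos rfl]
  have h2 : gproj 𝒱 g y = ∑ w, (if g = c w then v.repr y w else 0) • v w := by
    conv_lhs => rw [← v.sum_repr y]
    rw [map_sum]
    refine Finset.sum_congr rfl fun w _ => ?_
    rw [map_smul, gproj_of_mem 𝒱 (hv w)]
    split_ifs <;> simp
  have h3 : v.repr y u = if g = c u then v.repr y u else 0 := by
    have := v.repr_sum_self fun w => if g = c w then v.repr y w else 0
    rw [← h2, h1] at this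
    exact congrFun this u
  rw [if_neg (Ne.symm hc)] at h3
  exact hu h3

theorem endMatrix_deg (hv : ∀ i, v i ∈ 𝒱 (c i)) {a : G} {x : Module.End κ V}
    (hx : x ∈ glDeg 𝒱 a) (u w : ι) (h : endMatrix v x u w ≠ 0) : c u = a * c w :=
  deg_of_repr_ne_zero v hv (hx _ _ (hv w)) h

theorem tensorAct_tens (hv : ∀ i, v i ∈ 𝒱 (c i)) {a : G} {x : Module.End κ V}
    (hx : x ∈ glDeg 𝒱 a) (φ : (Fin N → ι) → κ) :
    tensorAct β 𝒱 N x (tens v N φ) = tens v N (actCoord β c a (endMatrix v x) φ) := by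
  classical
  have h : ∀ l : Fin N → ι, tensorAct β 𝒱 N x (PiTensorProduct.tprod κ fun i => v (l i)) =
      ∑ i : Fin N, ∑ u, ((∏ j : Fin N with j < i, β.val (c (l j)) a) * endMatrix v x u (l i)) •
        PiTensorProduct.tprod κ fun j => v (Function.update l i u j) := by
    intro l
    rw [tensorAct_tprod v hv, Finset.sum_eq_single a]
    · refine Finset.sum_congr rfl fun i _ => ?_
      rw [endProj_of_mem hx (hv _), if_pos rfl, ← sum_endMatrix, MultilinearMap.map_update_sum,
        Finset.smul_sum]
      refine Finset.sum_congr rfl fun u _ => ?_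
      rw [MultilinearMap.map_update_smul, smul_smul]
      congr 2
      funext j
      by_cases hj : j = i
      · subst hj; simp
      · simp [hj]
    · intro a' _ ha'
      refine Finset.sum_eq_zero fun i _ => ?_
      rw [endProj_of_mem hx (hv _), if_neg ha', MultilinearMap.map_update_zero, smul_zero]
    · simp
  simp only [tens_apply, map_sum, map_smul, h, Finset.smul_sum, actCoord, Finset.sum_smul,
    Finset.mul_sum]
  rw [Finset.sum_comm]
  conv_rhs => rw [Finset.sum_comm]
  refine Finset.sum_congr rfl fun i _ => ?_
  rw [← Fintype.sum_prod_type', ← Fintype.sum_prod_type']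
  -- Exchanges the label at position `i` with the free index, turning a sum over source labellings
  -- into one over target labellings.
  let e : (Fin N → ι) × ι ≃ (Fin N → ι) × ι :=
    Function.Involutive.toPerm (fun p => (Function.update p.1 i p.2, p.1 i)) fun p => by
      simp
  refine Fintype.sum_equiv e _ _ fun p => ?_
  have he : e p = (Function.update p.1 i p.2, p.1 i) := rfl
  have hp : (∏ j : Fin N with j < i, β.val (c (Function.update p.1 i p.2 j)) a) =
      ∏ j : Fin N with j < i, β.val (c (p.1 j)) a := by
    refine Finset.prod_congr rfl fun j hj => ?_
    rw [Function.update_of_ne (Finset.mem_filter.1 hj).2.ne]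
  rw [he, smul_smul]
  simp only [hp, Function.update_self, Function.update_idem, Function.update_eq_self]
  congr 1
  ring

theorem tens_mem_tensorDeg (hv : ∀ i, v i ∈ 𝒱 (c i)) {g : G} {φ : (Fin N → ι) → κ}
    (h : ∀ l, φ l ≠ 0 → ∏ i, c (l i) = g) : tens v N φ ∈ tensorDeg 𝒱 N g := by
  rw [tens_apply]
  refine Submodule.sum_mem _ fun l _ => ?_
  by_cases h0 : φ l = 0
  · rw [h0, zero_smul]; exact Submodule.zero_mem _
  · exact Submodule.smul_mem _ _
      (Submodule.subset_span ⟨fun i => c (l i), _, fun i => hv _, h l h0, rfl⟩)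

theorem exists_tens_of_mem_tensorDeg (hv : ∀ i, v i ∈ 𝒱 (c i)) {g : G} {t : ⨂[κ]^N V}
    (ht : t ∈ tensorDeg 𝒱 N g) :
    ∃ φ, tens v N φ = t ∧ ∀ l, φ l ≠ 0 → ∏ i, c (l i) = g := by
  induction ht using Submodule.span_induction with
  | mem t ht =>
    obtain ⟨d, x, hx, hd, rfl⟩ := ht
    refine ⟨fun l => ∏ i, v.repr (x i) (l i), ?_, ?_⟩
    · rw [tens_apply]
      conv_rhs => rw [show x = fun i => ∑ u, v.repr (x i) u • v u from
        funext fun i => (v.sum_repr (x i)).symm]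
      rw [MultilinearMap.map_sum]
      exact Finset.sum_congr rfl fun l _ => (MultilinearMap.map_smul_univ _ _ _).symm
    · intro l hl
      rw [← hd]
      exact Finset.prod_congr rfl fun i _ =>
        deg_of_repr_ne_zero v hv (hx i) (Finset.prod_ne_zero_iff.1 hl i (Finset.mem_univ i))
  | zero => exact ⟨0, map_zero _, fun l h => absurd rfl h⟩
  | add t t' _ _ h h' =>
    obtain ⟨φ, rfl, h⟩ := h
    obtain ⟨φ', rfl, h'⟩ := h'
    refine ⟨φ + φ', map_add _ _ _, fun l hl => ?_⟩
    by_cases h0 : φ l = 0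
    · refine h' l fun h1 => hl ?_
      rw [Pi.add_apply, h0, h1, add_zero]
    · exact h l h0
  | smul r t _ h =>
    obtain ⟨φ, rfl, h⟩ := h
    refine ⟨r • φ, map_smul _ _ _, fun l hl => h l fun h0 => hl ?_⟩
    rw [Pi.smul_apply, h0, smul_zero]

/-- A criterion for membership in `homG` in coordinates. -/
theorem mem_homG_of_coord (hv : ∀ i, v i ∈ 𝒱 (c i)) {A : Module.End κ (⨂[κ]^N V)}
    (T : ((Fin N → ι) → κ) → (Fin N → ι) → κ) (hA : ∀ φ, A (tens v N φ) = tens v N (T φ))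
    (hdeg : ∀ g φ, (∀ l, φ l ≠ 0 → ∏ i, c (l i) = g) → ∀ l, T φ l ≠ 0 → ∏ i, c (l i) = g)
    (hact : ∀ a, ∀ x ∈ spoDeg β 𝒱 ω a, ∀ φ l,
      T (actCoord β c a (endMatrix v x) φ) l = actCoord β c a (endMatrix v x) (T φ) l) :
    A ∈ homG β 𝒱 ω N := by
  constructor
  · intro g t ht
    obtain ⟨φ, rfl, hφ⟩ := exists_tens_of_mem_tensorDeg v hv ht
    rw [hA]
    exact tens_mem_tensorDeg v hv (hdeg g φ hφ)
  · intro x hx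
    refine Submodule.iSup_induction (spoDeg β 𝒱 ω)
      (motive := fun x => ∀ t, A (tensorAct β 𝒱 N x t) = tensorAct β 𝒱 N x (A t)) hx ?_ ?_ ?_
    · intro a x hx t
      obtain ⟨φ, rfl⟩ := (tens v N).surjective t
      rw [hA, tensorAct_tens v hv hx.1, tensorAct_tens v hv hx.1, hA]
      congr 1
      funext l
      exact hact a x hx φ l
    · intro t
      have : tensorAct β 𝒱 N (0 : Module.End κ V) = 0 := by
        have := tensorAct_add (β := β) (N := N) v hv 0 0
        rw [add_zero] at this
        exact left_eq_add.1 this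
      rw [this, LinearMap.zero_apply, map_zero, LinearMap.zero_apply]
    · intro x y hx hy t
      rw [tensorAct_add v hv, LinearMap.add_apply, LinearMap.add_apply, map_add, hx, hy]

theorem braid_mem_homG (hv : ∀ i, v i ∈ 𝒱 (c i)) (i : AdjIdx N) :
    braid β 𝒱 i ∈ homG β 𝒱 ω N := by
  refine mem_homG_of_coord v hv _ (braid_tens β 𝒱 v hv i) ?_ ?_
  · intro g φ h l hl
    rw [← h _ (right_ne_zero_of_mul hl)]
    exact (Equiv.prod_comp (adjSwap i) fun j => c (l j)).symm
  · intro a x hx φ l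
    exact (actCoord_swap (endMatrix_deg v hv hx.1) rfl φ l).symm

variable [FiniteDimensional κ V] [DecidableEq ι]

theorem contraction_mem_homG (hω : IsSkewForm β 𝒱 ω) (hv : ∀ i, v i ∈ 𝒱 (c i)) {p q : Fin N}
    (hp : p.val = 0) (hq : q.val = 1) : contraction v ω p q ∈ homG β 𝒱 ω N := by
  have hpq : p ≠ q := by rintro rfl; omega
  have hK := isSkewMatrix_gram_inv v hω hv
  have hF : ∀ i j, gram v ω i j ≠ 0 → c j = (c i)⁻¹ := fun i j h => by
    rw [gram_deg v hω hv h, inv_inv]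
  refine mem_homG_of_coord v hv _ (contraction_tens v p q) ?_ ?_
  -- The labels removed at `p`, `q` have degrees of product 1, and so do those inserted, so the
  -- total degree is unchanged.
  · intro g φ h l hl
    have h1 := left_ne_zero_of_mul hl
    obtain ⟨u, -, hu⟩ := Finset.exists_ne_zero_of_sum_ne_zero (right_ne_zero_of_mul hl)
    obtain ⟨w, -, hw⟩ := Finset.exists_ne_zero_of_sum_ne_zero hu
    rw [← h _ (right_ne_zero_of_mul hw)]
    have hmem : q ∈ Finset.univ.erase p := Finset.mem_erase.2 ⟨hpq.symm, Finset.mem_univ q⟩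
    rw [← Finset.mul_prod_erase _ _ (Finset.mem_univ p), ← Finset.mul_prod_erase _ _ hmem,
      ← Finset.mul_prod_erase _ _ (Finset.mem_univ p), ← Finset.mul_prod_erase _ _ hmem,
      ← mul_assoc, ← mul_assoc]
    congr 1
    · rw [relabelTwo_apply, relabelTwo_apply, if_neg hpq, if_pos rfl, if_pos rfl,
        hF _ _ (left_ne_zero_of_mul hw), hK.deg _ _ h1, mul_inv_cancel, mul_inv_cancel]
    · refine Finset.prod_congr rfl fun j hj => ?_
      rw [Finset.mem_erase, Finset.mem_erase] at hj
      rw [relabelTwo_apply, if_neg hj.1, if_neg hj.2.1]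
  · intro a x hx φ l
    set X := endMatrix v x with hX
    -- The defining identity of spo(V, β) on basis vectors, written with the matrix of `x`.
    have h1 : ∀ s t, ∑ u, (X u s * gram v ω u t + β.val (c s) a * (gram v ω s u * X u t)) = 0 := by
      intro s t
      have := hx.2 (c s) (v s) (hv s) (v t)
      rw [← sum_endMatrix v x s, ← sum_endMatrix v x t] at this
      simp only [map_sum, map_smul, LinearMap.sum_apply, LinearMap.smul_apply, smul_eq_mul,
        Finset.mul_sum, ← Finset.sum_add_distrib] at this
      rw [← this]
      refine Finset.sum_congr rfl fun u _ => ?_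
      simp only [Matrix.of_apply, hX]
      ring
    refine (actCoord_capCup hK hF h1 ?_ hp hq φ l).symm
    set D : Matrix ι ι κ := Matrix.diagonal fun s => β.val (c s) a with hD
    set D' : Matrix ι ι κ := Matrix.diagonal fun s => β.val a (c s) with hD'
    set F := gram v ω
    have hKF := gram_inv_mul v ω hω.nondegenerate
    have hFK := gram_mul_inv v ω hω.nondegenerate
    have e1 : X.transpose * F + D * F * X = 0 := by
      ext s t
      rw [Matrix.add_apply, Matrix.mul_apply, Matrix.mul_apply, ← Finset.sum_add_distrib,
        Matrix.zero_apply, ← h1 s t]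
      refine Finset.sum_congr rfl fun u _ => ?_
      rw [hD, Matrix.diagonal_mul, Matrix.transpose_apply]
      ring
    -- The form pairs inverse degrees, so moving the diagonal twist past `F` transposes β. This and
    -- `e3` convert invariance of `F`, conjugated by its inverse, into invariance of F⁻¹.
    have e2 : D * F = F * D' := by
      ext s t
      rw [hD, hD', Matrix.diagonal_mul, Matrix.mul_diagonal]
      by_cases h0 : F s t = 0
      · rw [h0]; ring
      · rw [hF _ _ h0, β.val_inv_right]; ring
    have e3 : D * D' = 1 := by
      rw [hD, hD', Matrix.diagonal_mul_diagonal, ← Matrix.diagonal_one]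
      congr 1
      funext s
      exact β.val_mul_val_symm _ _
    have e4 : F⁻¹ * X.transpose + D' * X * F⁻¹ = 0 := by
      have := congrArg (fun M => F⁻¹ * M * F⁻¹) e1
      simp only [mul_add, add_mul, mul_zero, zero_mul] at this
      rw [e2] at this
      calc F⁻¹ * X.transpose + D' * X * F⁻¹
          = F⁻¹ * X.transpose * (F * F⁻¹) + (F⁻¹ * F) * D' * X * F⁻¹ := by rw [hFK, hKF, mul_one, one_mul]
        _ = F⁻¹ * (X.transpose * F) * F⁻¹ + F⁻¹ * (F * D' * X) * F⁻¹ := by simp only [mul_assoc]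
        _ = 0 := this
    have e5 : X * F⁻¹ + D * (F⁻¹ * X.transpose) = 0 := by
      have := congrArg (fun M => D * M) e4
      simp only [mul_add, mul_zero, ← mul_assoc] at this
      rw [e3, one_mul] at this
      rw [add_comm, ← mul_assoc]
      exact this
    intro s t
    have := congrFun (congrFun e5 s) t
    rw [Matrix.add_apply, Matrix.mul_apply, hD, Matrix.diagonal_mul, Matrix.mul_apply,
      Finset.mul_sum, ← Finset.sum_add_distrib] at this
    exact this

end HomG

/-! ### Products of diagrams with the generators -/

section Brauer

variable {k : ℕ}

/-- Permutation of the top vertices of a diagram. -/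
def Diagram.permTop (σ : Equiv.Perm (Fin k)) (d : Diagram k) : Diagram k :=
  Matching.relabel (Equiv.sumCongr σ (Equiv.refl _)) d

theorem compat_relabel {X Y : Type*} (e : X ≃ Y) (d : Matching X) (f : Y → Bool) :
    Compat (d.relabel e) f ↔ Compat d (f ∘ e) := by
  simp only [Compat, Matching.relabel_mate, Function.comp_apply]
  rw [← e.forall_congr_right]
  simp only [Equiv.symm_apply_apply]

theorem colourMatrix_permBot (σ : Equiv.Perm (Fin k)) (d : Diagram k) (a b : Fin k → Bool) :
    colourMatrix (d.permBot σ) a b = colourMatrix d a (b ∘ σ) := by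
  have h : Sum.elim a b ∘ Equiv.sumCongr (Equiv.refl (Fin k)) σ = Sum.elim a (b ∘ σ) := by
    funext x; rcases x with x | x <;> rfl
  have h2 := compat_relabel (Equiv.sumCongr (Equiv.refl (Fin k)) σ) d (Sum.elim a b)
  rw [h] at h2
  classical
  simp only [colourMatrix, Matrix.of_apply]
  exact if_congr h2 rfl rfl

theorem colourMatrix_permTop (σ : Equiv.Perm (Fin k)) (d : Diagram k) (a b : Fin k → Bool) :
    colourMatrix (d.permTop σ) a b = colourMatrix d (a ∘ σ) b := by
  have h : Sum.elim a b ∘ Equiv.sumCongr σ (Equiv.refl (Fin k)) = Sum.elim (a ∘ σ) b := by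
    funext x; rcases x with x | x <;> rfl
  have h2 := compat_relabel (Equiv.sumCongr σ (Equiv.refl (Fin k))) d (Sum.elim a b)
  rw [h] at h2
  classical
  simp only [colourMatrix, Matrix.of_apply]
  exact if_congr h2 rfl rfl

/-- A colouring matrix scaled by a power of 2 determines both the diagram and the exponent, so
products of diagrams can be found without tracing paths. -/
theorem loops_comp_eq {d₁ d₂ d : Diagram k} {m : ℕ}
    (h : colourMatrix d₁ * colourMatrix d₂ = 2 ^ m • colourMatrix d) :
    Diagram.loops d₁ d₂ = m ∧ Diagram.comp d₁ d₂ = d :=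
  eq_of_colourMatrix (by rw [← colourMatrix_mul, h])

theorem comp_permBot_id (σ : Equiv.Perm (Fin k)) (d : Diagram k) :
    Diagram.loops d ((Diagram.id k).permBot σ) = 0 ∧
      Diagram.comp d ((Diagram.id k).permBot σ) = d.permBot σ := by
  apply loops_comp_eq
  ext a b
  rw [pow_zero, one_smul, colourMatrix_permBot, Matrix.mul_apply]
  simp only [colourMatrix_permBot, colourMatrix_id, Matrix.one_apply]
  simp

theorem permBot_swap_id_comp (i j : Fin k) (d : Diagram k) :
    Diagram.loops ((Diagram.id k).permBot (Equiv.swap i j)) d = 0 ∧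
      Diagram.comp ((Diagram.id k).permBot (Equiv.swap i j)) d =
        d.permTop (Equiv.swap i j) := by
  apply loops_comp_eq
  ext a b
  have h : ∀ x : Fin k → Bool, a = x ∘ Equiv.swap i j ↔ x = a ∘ Equiv.swap i j := by
    intro x
    constructor <;> rintro rfl <;> (funext y; simp)
  rw [pow_zero, one_smul, colourMatrix_permTop, Matrix.mul_apply]
  simp only [colourMatrix_permBot, colourMatrix_id, Matrix.one_apply, h]
  simp

/-- The colouring `g` with the colours of `p` and `q` replaced by `u`. -/
def colourTwo {X : Type*} [DecidableEq X] (g : X → Bool) (p q : X) (u : Bool) : X → Bool :=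
  fun x => if x = p ∨ x = q then u else g x

/-- Giving `p` and `q` a common auxiliary colour makes their former partners agree; the new edge
imposes the separate condition on `g`. -/
theorem compat_splice_iff {X : Type*} [DecidableEq X] (f : Matching X) {p q : X} (hpq : p ≠ q)
    (g : X → Bool) :
    Compat (f.splice p q hpq) g ↔ g p = g q ∧ ∃ u, Compat f (colourTwo g p q u) := by
  have e := f.mate_mate
  have n := f.mate_ne
  by_cases hf : f.mate p = q
  · rw [f.splice_eq_self p q hpq hf]
    constructor
    · intro h
      refine ⟨by rw [← hf, h], true, fun x => ?_⟩
      have := h x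
      simp only [colourTwo]
      grind
    · rintro ⟨h, u, hu⟩ x
      have := hu x
      simp only [colourTwo] at this
      grind
  · constructor
    · intro h
      have h1 := h p
      rw [f.splice_mate] at h1
      refine ⟨by grind, g (f.mate p), fun x => ?_⟩
      have h2 := h x
      have h3 := h (f.mate p)
      rw [f.splice_mate] at h2 h3
      simp only [colourTwo]
      grind
    · rintro ⟨h, u, hu⟩ x
      have h2 := hu x
      have h3 := hu p
      have h4 := hu q
      simp only [colourTwo] at h2 h3 h4
      rw [f.splice_mate]
      grind

/-- If `p` is joined to `q`, the auxiliary colour is free, which gives the factor 2 of a closed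
loop. Otherwise the partner of `p` dictates it. -/
theorem sum_compat_colourTwo {X : Type*} [DecidableEq X] (f : Matching X) (p q : X)
    (g : X → Bool) [∀ u, Decidable (Compat f (colourTwo g p q u))]
    [Decidable (∃ u, Compat f (colourTwo g p q u))] :
    ∑ u, (if Compat f (colourTwo g p q u) then 1 else 0) =
      2 ^ (if f.mate p = q then 1 else 0) * if ∃ u, Compat f (colourTwo g p q u) then 1 else 0 := by
  have e := f.mate_mate
  by_cases hf : f.mate p = q
  · have h : Compat f (colourTwo g p q true) ↔ Compat f (colourTwo g p q false) := by
      have : ∀ u u', Compat f (colourTwo g p q u) → Compat f (colourTwo g p q u') := by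
        intro u u' h x
        have := h x
        simp only [colourTwo] at this ⊢
        grind
      exact ⟨this _ _, this _ _⟩
    simp only [Fintype.sum_bool, Bool.exists_bool, h, hf, or_self, if_true]
    split_ifs <;> rfl
  · have h : ∀ u, Compat f (colourTwo g p q u) → u = g (f.mate p) := by
      intro u hu
      have := hu p
      have := f.mate_ne p
      simp only [colourTwo] at *
      grind
    have h' : ¬ (Compat f (colourTwo g p q true) ∧ Compat f (colourTwo g p q false)) := by
      rintro ⟨h1, h2⟩
      have := (h _ h1).trans (h _ h2).symm
      simp at this
    simp only [Fintype.sum_bool, Bool.exists_bool, hf, if_false, pow_zero, one_mul]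
    by_cases h1 : Compat f (colourTwo g p q true) <;>
      by_cases h2 : Compat f (colourTwo g p q false) <;> simp_all

/-- The diagram with a cup at the top and the bottom vertices `p`, `q`, all other edges being
vertical. -/
def Diagram.cupCap {p q : Fin k} (hpq : p ≠ q) : Diagram k :=
  Matching.splice (Diagram.id k) (.inr p) (.inr q) (Sum.inr_injective.ne hpq)

theorem compat_id_iff (a b : Fin k → Bool) : Compat (Diagram.id k) (Sum.elim a b) ↔ a = b := by
  simp only [Compat, Diagram.id, Sum.forall, Sum.swap_inl, Sum.elim_inl, Sum.elim_inr,
    Sum.swap_inr]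
  constructor
  · rintro ⟨h, -⟩; exact funext fun i => (h i).symm
  · rintro rfl; exact ⟨fun _ => rfl, fun _ => rfl⟩

theorem colourTwo_inr (a b : Fin k → Bool) (p q : Fin k) (u : Bool) :
    colourTwo (Sum.elim a b) (.inr p) (.inr q) u = Sum.elim a (colourTwo b p q u) := by
  funext x; rcases x with x | x <;> simp [colourTwo]

theorem colourTwo_inl (a b : Fin k → Bool) (p q : Fin k) (u : Bool) :
    colourTwo (Sum.elim a b) (.inl p) (.inl q) u = Sum.elim (colourTwo a p q u) b := by
  funext x; rcases x with x | x <;> simp [colourTwo]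

theorem compat_cupCap_iff {p q : Fin k} (hpq : p ≠ q) (a b : Fin k → Bool) :
    Compat (Diagram.cupCap hpq) (Sum.elim a b) ↔ b p = b q ∧ ∃ u, a = colourTwo b p q u := by
  simp only [Diagram.cupCap, compat_splice_iff, colourTwo_inr, compat_id_iff, Sum.elim_inr]

theorem compat_cupCap_iff' {p q : Fin k} (hpq : p ≠ q) (a b : Fin k → Bool) :
    Compat (Diagram.cupCap hpq) (Sum.elim a b) ↔ a p = a q ∧ ∃ u, b = colourTwo a p q u := by
  rw [compat_cupCap_iff]
  have : ∀ a b : Fin k → Bool, (b p = b q ∧ ∃ u, a = colourTwo b p q u) →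
      (a p = a q ∧ ∃ u, b = colourTwo a p q u) := by
    rintro a b ⟨h, u, rfl⟩
    refine ⟨by simp [colourTwo], b p, ?_⟩
    funext x
    simp only [colourTwo]
    grind
  exact ⟨this a b, this b a⟩

theorem sum_colourTwo {M : Type*} [AddCommMonoid M] {p q : Fin k} (b : Fin k → Bool)
    [DecidablePred fun c : Fin k → Bool => ∃ u, c = colourTwo b p q u]
    (φ : (Fin k → Bool) → M) :
    ∑ c, (if ∃ u, c = colourTwo b p q u then φ c else 0) = ∑ u, φ (colourTwo b p q u) := by
  classical
  have hinj : Function.Injective (colourTwo b p q) := fun u u' h => by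
    simpa [colourTwo] using congrFun h p
  rw [← Finset.sum_filter]
  refine Eq.trans (Finset.sum_congr ?_ fun _ _ => rfl) (Finset.sum_map Finset.univ ⟨_, hinj⟩ φ)
  ext c
  simp only [Finset.mem_filter, Finset.mem_univ, true_and, Finset.mem_map,
    Function.Embedding.coeFn_mk, eq_comm]

/-- The diagrammatic counterpart of `contraction_mul_Psi`: a loop appears exactly when `d` already
joins the two bottom vertices. -/
theorem comp_cupCap {p q : Fin k} (hpq : p ≠ q) (d : Diagram k) :
    Diagram.loops d (Diagram.cupCap hpq) = (if d.mate (.inr p) = .inr q then 1 else 0) ∧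
      Diagram.comp d (Diagram.cupCap hpq) =
        Matching.splice d (.inr p) (.inr q) (Sum.inr_injective.ne hpq) := by
  classical
  apply loops_comp_eq
  ext a b
  rw [Matrix.mul_apply, Matrix.smul_apply, smul_eq_mul]
  simp only [colourMatrix, Matrix.of_apply, compat_cupCap_iff', compat_splice_iff, colourTwo_inr,
    Sum.elim_inr]
  have h1 := sum_compat_colourTwo d (.inr p) (.inr q) (Sum.elim a b)
  simp only [colourTwo_inr] at h1
  have h2 : ∀ c : Fin k → Bool, (c p = c q ∧ ∃ u, b = colourTwo c p q u) ↔
      (b p = b q ∧ ∃ u, c = colourTwo b p q u) := by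
    intro c
    rw [← compat_cupCap_iff' hpq, compat_cupCap_iff hpq]
  simp only [h2]
  by_cases hb : b p = b q
  · simp only [hb, true_and, mul_ite, mul_one, mul_zero]
    rw [sum_colourTwo b]
    rw [h1, mul_ite, mul_one, mul_zero]
  · simp [hb]

theorem cupCap_comp {p q : Fin k} (hpq : p ≠ q) (d : Diagram k)
    (hd : d.mate (.inl p) ≠ .inl q) :
    Diagram.loops (Diagram.cupCap hpq) d = 0 ∧
      Diagram.comp (Diagram.cupCap hpq) d =
        Matching.splice d (.inl p) (.inl q) (Sum.inl_injective.ne hpq) := by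
  classical
  apply loops_comp_eq
  ext a b
  rw [Matrix.mul_apply, Matrix.smul_apply, smul_eq_mul]
  simp only [colourMatrix, Matrix.of_apply, compat_splice_iff, colourTwo_inl, Sum.elim_inl]
  have h1 := sum_compat_colourTwo d (.inl p) (.inl q) (Sum.elim a b)
  simp only [colourTwo_inl, if_neg hd] at h1
  simp only [compat_cupCap_iff']
  by_cases ha : a p = a q
  · simp only [ha, true_and, ite_mul, one_mul, zero_mul]
    rw [sum_colourTwo a]
    rw [h1]
  · simp [ha]

end Brauer

/-! ### Generation of the Brauer algebra by transpositions and cup-cap diagrams. -/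

section Induction

variable {κ : Type*} [Field κ] {k : ℕ} {η : κ}

namespace BrauerAlgebra

theorem ofDiagram_mul_swap (d : Diagram k) (σ : Equiv.Perm (Fin k)) :
    ofDiagram η d * ofDiagram η ((Diagram.id k).permBot σ) = ofDiagram η (d.permBot σ) := by
  rw [ofDiagram_mul, (comp_permBot_id σ d).1, (comp_permBot_id σ d).2, pow_zero, one_smul]

theorem ofDiagram_swap_mul (d : Diagram k) (i j : Fin k) :
    ofDiagram η ((Diagram.id k).permBot (Equiv.swap i j)) * ofDiagram η d =
      ofDiagram η (d.permTop (Equiv.swap i j)) := by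
  rw [ofDiagram_mul, (permBot_swap_id_comp i j d).1, (permBot_swap_id_comp i j d).2, pow_zero,
    one_smul]

/-- Number of the top vertices lying on horizontal edges. -/
noncomputable def topEdges (d : Diagram k) : ℕ :=
  Nat.card {i : Fin k // (d.mate (.inl i)).isLeft}

theorem topEdges_permTop (σ : Equiv.Perm (Fin k)) (d : Diagram k) :
    topEdges (d.permTop σ) = topEdges d := by
  refine Nat.card_congr (σ.symm.subtypeEquiv fun i => ?_)
  have h : (d.permTop σ).mate (.inl i) =
      Equiv.sumCongr σ (Equiv.refl _) (d.mate (.inl (σ.symm i))) := rfl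
  rw [h]
  rcases d.mate (.inl (σ.symm i)) with x | x <;> simp

/-- A property of elements of the Brauer algebra that is stable under multiplication holds for all
diagrams if it holds for the generators. -/
theorem ofDiagram_induction (P : BrauerAlgebra κ k η → Prop) (one : P 1)
    (mul : ∀ x y, P x → P y → P (x * y))
    (swap : ∀ i : AdjIdx k, P (ofDiagram η ((Diagram.id k).permBot (adjSwap i))))
    (cup : ∀ (p q : Fin k) (hpq : p ≠ q), p.val = 0 → q.val = 1 →
      P (ofDiagram η (Diagram.cupCap hpq))) (d : Diagram k) : P (ofDiagram η d) := by
  have hperm : ∀ (σ : Equiv.Perm (Fin k)) (d : Diagram k), P (ofDiagram η d) →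
      P (ofDiagram η (d.permTop σ)) := by
    intro σ d hd
    obtain ⟨w, rfl⟩ := exists_word σ
    induction w with
    | nil =>
      have h : d.permTop ((List.map adjSwap ([] : List (AdjIdx k))).prod) = d := by
        ext1; funext x
        rw [Diagram.permTop, Matching.relabel_mate]
        rcases x with x | x
        · simp [← Equiv.Perm.inv_def]
        · simp
      rwa [h]
    | cons i w ih =>
      have h : d.permTop ((i :: w).map adjSwap).prod =
          (d.permTop (w.map adjSwap).prod).permTop (adjSwap i) := by
        rw [Diagram.permTop, Diagram.permTop, Diagram.permTop, Matching.relabel_relabel]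
        congr 1
        ext x
        rcases x with x | x <;> simp
      rw [h, adjSwap, ← ofDiagram_swap_mul]
      exact mul _ _ (swap i) ih
  have hback : ∀ (σ : Equiv.Perm (Fin k)) (d : Diagram k), (d.permTop σ).permTop σ⁻¹ = d := by
    intro σ d
    rw [Diagram.permTop, Diagram.permTop, Matching.relabel_relabel]
    convert Matching.relabel_refl d
    ext x
    rcases x with x | x <;> simp
  -- Each step factors off a cup-cap diagram, leaving a diagram with fewer horizontal top ends;
  -- diagrams with none are permutations.
  induction hn : topEdges d using Nat.strong_induction_on generalizing d with
  | _ n ih =>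
  by_cases hd : ∃ i j, d.mate (.inl i) = .inl j
  · obtain ⟨i, j, hij⟩ := hd
    have hne : i ≠ j := by rintro rfl; exact d.mate_ne _ hij
    have hk : 2 ≤ k := by
      have := i.isLt; have := j.isLt
      have : i.val ≠ j.val := fun h => hne (Fin.ext h)
      omega
    let p : Fin k := ⟨0, by omega⟩
    let q : Fin k := ⟨1, by omega⟩
    have hpq : p ≠ q := by simp [p, q, Fin.ext_iff]
    obtain ⟨σ, hσi, hσj⟩ : ∃ σ : Equiv.Perm (Fin k), σ i = p ∧ σ j = q := by
      refine ⟨(Equiv.swap i p).trans (Equiv.swap (Equiv.swap i p j) q), ?_, by simp⟩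
      rw [Equiv.trans_apply, Equiv.swap_apply_left]
      refine Equiv.swap_apply_of_ne_of_ne (fun h => hne ?_) hpq
      exact (Equiv.swap i p).injective ((Equiv.swap_apply_left i p).trans h)
    rw [← hback σ d]
    apply hperm
    set f := d.permTop σ with hf
    have hfp : f.mate (.inl p) = .inl q := by
      rw [hf, Diagram.permTop, Matching.relabel_mate]
      simp [← hσi, ← hσj, hij]
    have hfn : topEdges f = n := by rw [hf, topEdges_permTop, hn]
    -- If every bottom vertex went up, the bottom row would map injectively, hence bijectively, to
    -- the top row, and `p` would not lie on a horizontal edge.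
    obtain ⟨r, r', hr⟩ : ∃ r r', f.mate (.inr r) = .inr r' := by
      by_contra hcon
      push Not at hcon
      have h1 : ∀ x, ∃ y, f.mate (.inr x) = .inl y := by
        intro x
        rcases hx : f.mate (.inr x) with y | y
        · exact ⟨y, rfl⟩
        · exact absurd hx (hcon x y)
      choose g hg using h1
      have hginj : Function.Injective g := by
        intro x y h
        have := (hg x).trans ((congrArg Sum.inl h).trans (hg y).symm)
        exact Sum.inr_injective (f.mate_injective this)
      obtain ⟨x, hx⟩ := (Finite.injective_iff_surjective.1 hginj) p
      have := hg x
      rw [hx, Matching.mate_eq_iff, hfp] at this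
      exact absurd this (by simp)
    have hpr : (Sum.inl p : Fin k ⊕ Fin k) ≠ .inr r := by simp
    -- The top edge `p`–`q` and the bottom edge `r`–`r'` are replaced by vertical edges `p`–`r` and
    -- `q`–`r'`; the cup-cap diagram placed above restores the original edges.
    set d' : Diagram k := Matching.splice f (.inl p) (.inr r) hpr with hd'
    have hd'p : d'.mate (.inl p) ≠ .inl q := by
      rw [hd', Matching.splice_mate, if_pos rfl]; simp
    have hcomp := cupCap_comp hpq d' hd'p
    have hsp : Matching.splice d' (.inl p) (.inl q) (Sum.inl_injective.ne hpq) = f := by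
      have e := f.mate_mate
      have hpq' : (Sum.inl p : Fin k ⊕ Fin k) ≠ .inl q := by simpa using hpq
      have hqr : (Sum.inl q : Fin k ⊕ Fin k) ≠ .inr r := by simp
      have hpr' : (Sum.inl p : Fin k ⊕ Fin k) ≠ .inr r' := by simp
      have hqr' : (Sum.inl q : Fin k ⊕ Fin k) ≠ .inr r' := by simp
      have hrr' : (Sum.inr r : Fin k ⊕ Fin k) ≠ .inr r' := fun h => f.mate_ne _ (hr.trans h.symm)
      have hfq : f.mate (.inl q) = .inl p := by rw [← hfp, e]
      have hfr' : f.mate (.inr r') = .inr r := by rw [← hr, e]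
      ext1; funext x
      simp only [Matching.splice_mate, hd', hfp, hr]
      grind
    have hmulf : ofDiagram η (Diagram.cupCap hpq) * ofDiagram η d' = ofDiagram η f := by
      rw [ofDiagram_mul, hcomp.1, hcomp.2, pow_zero, one_smul, hsp]
    rw [← hmulf]
    refine mul _ _ (cup p q hpq rfl rfl) (ih (topEdges d') ?_ d' rfl)
    rw [← hfn, topEdges, topEdges]
    have hsub : ∀ x, (d'.mate (.inl x)).isLeft → (f.mate (.inl x)).isLeft ∧ x ≠ p := by
      intro x hx
      rw [hd', Matching.splice_mate, hfp, hr] at hx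
      by_cases h1 : x = p
      · subst h1; simp at hx
      by_cases h2 : x = q
      · subst h2; simp [h1] at hx
      · simpa [h1, h2] using hx
    have hlt : {x | (d'.mate (.inl x)).isLeft} ⊂ {x | (f.mate (.inl x)).isLeft} := by
      refine ⟨fun x hx => (hsub x hx).1, fun h => ?_⟩
      have : p ∈ {x | (f.mate (.inl x)).isLeft} := by simp [hfp]
      exact (hsub p (h this)).2 rfl
    exact Set.ncard_lt_ncard hlt
  · push Not at hd
    have h1 : ∀ x, ∃ y, d.mate (.inl x) = .inr y := by
      intro x
      rcases hx : d.mate (.inl x) with y | y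
      · exact absurd hx (hd x y)
      · exact ⟨y, rfl⟩
    choose g hg using h1
    have hginj : Function.Injective g := by
      intro x y h
      have := (hg x).trans ((congrArg Sum.inr h).trans (hg y).symm)
      exact Sum.inl_injective (d.mate_injective this)
    let σ : Equiv.Perm (Fin k) := Equiv.ofBijective g (Finite.injective_iff_bijective.1 hginj)
    have hσ : d = (Diagram.id k).permTop σ⁻¹ := by
      ext1; funext x
      have hσg : ∀ x, σ x = g x := fun _ => rfl
      rw [Diagram.permTop, Matching.relabel_mate]
      rcases x with x | x
      · rw [hg, ← hσg]
        rfl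
      · obtain ⟨y, rfl⟩ := σ.surjective x
        rw [hσg, (d.mate_eq_iff).2 (hg y).symm]
        simp [Diagram.id, ← hσg]
    rw [hσ]
    exact hperm _ _ one

end BrauerAlgebra

end Induction

/-! ### Homogeneous bases and the value of a closed loop. -/

section Dimension

variable {κ : Type*} [Field κ] {V : Type*} [AddCommGroup V] [Module κ V]
  {ι : Type*} [Fintype ι] (v : Module.Basis ι κ V)
  {ω : LinearMap.BilinForm κ V} {G : Type*} [CommGroup G] [Fintype G] [DecidableEq G]
  {β : SymmBicharacter G κ} {𝒱 : G → Submodule κ V} [DirectSum.Decomposition 𝒱] {c : ι → G}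

theorem finrank_iSup_homogeneous (hv : ∀ i, v i ∈ 𝒱 (c i)) (p : G → Prop)
    [DecidablePred p] :
    Module.finrank κ (⨆ (a : G) (_ : p a), 𝒱 a : Submodule κ V) =
      (Finset.univ.filter fun u => p (c u)).card := by
  have h : (⨆ (a : G) (_ : p a), 𝒱 a : Submodule κ V) =
      Submodule.span κ (Set.range fun u : {u // p (c u)} => v u) := by
    apply le_antisymm
    · refine iSup₂_le fun a ha y hy => ?_
      rw [← v.sum_repr y]
      refine Submodule.sum_mem _ fun u _ => ?_
      by_cases h0 : v.repr y u = 0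
      · rw [h0, zero_smul]; exact Submodule.zero_mem _
      · have hu : p (c u) := by rwa [deg_of_repr_ne_zero v hv hy h0]
        exact Submodule.smul_mem _ _ (Submodule.subset_span ⟨⟨u, hu⟩, rfl⟩)
    · rw [Submodule.span_le]
      rintro _ ⟨u, rfl⟩
      exact Submodule.mem_iSup_of_mem (c u) (Submodule.mem_iSup_of_mem u.2 (hv u))
  rw [h]
  exact (finrank_span_eq_card (v.linearIndependent.comp _ Subtype.val_injective)).trans
    (Fintype.card_subtype _)

theorem exists_homogeneous_basis [FiniteDimensional κ V] (𝒱 : G → Submodule κ V)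
    [DirectSum.Decomposition 𝒱] :
    ∃ (n : ℕ) (v : Module.Basis (Fin n) κ V) (c : Fin n → G), ∀ i, v i ∈ 𝒱 (c i) := by
  have hi := DirectSum.Decomposition.isInternal 𝒱
  let b := hi.collectedBasis fun a => Module.finBasis κ (𝒱 a)
  let e := Fintype.equivFin (Σ a, Fin (Module.finrank κ (𝒱 a)))
  exact ⟨_, b.reindex e, fun i => (e.symm i).1, fun i => by
    rw [Module.Basis.reindex_apply]
    exact hi.collectedBasis_mem _ _⟩

variable [DecidableEq ι]

/-- Skewness of F⁻¹ transposes its entry at the cost of -β(c,c), after which the inner sum is a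
diagonal entry of FF⁻¹ = 1. -/
theorem loopValue_eq_sum (hω : IsSkewForm β 𝒱 ω) (hv : ∀ i, v i ∈ 𝒱 (c i)) :
    loopValue v ω = -∑ u, β.val (c u) (c u) := by
  have : FiniteDimensional κ V := v.finiteDimensional_of_finite
  rw [loopValue, ← Finset.sum_neg_distrib]
  refine Finset.sum_congr rfl fun u _ => ?_
  have h : ∀ w, gram v ω u w * (gram v ω)⁻¹ u w =
      -β.val (c u) (c u) * (gram v ω u w * (gram v ω)⁻¹ w u) := by
    intro w
    by_cases h0 : gram v ω u w = 0
    · rw [h0]; ring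
    · rw [(isSkewMatrix_gram_inv v hω hv).skew u w]
      have h1 := gram_deg v hω hv h0
      have h2 : c w = (c u)⁻¹ := by rw [h1, inv_inv]
      rw [h2, β.val_inv_left]
      ring
  rw [Finset.sum_congr rfl fun w _ => h w, ← Finset.mul_sum, ← Matrix.mul_apply,
    gram_mul_inv v ω hω.nondegenerate, Matrix.one_apply_eq, mul_one]

/-- Since β(c,c)² = 1, every basis vector is even or odd and contributes -1 or 1. Characteristic 0
keeps the two cases apart. -/
theorem loopValue_eq [CharZero κ] (hω : IsSkewForm β 𝒱 ω) (hv : ∀ i, v i ∈ 𝒱 (c i)) :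
    loopValue v ω =
      (Module.finrank κ (oddPart β 𝒱) : κ) - (Module.finrank κ (evenPart β 𝒱) : κ) := by
  classical
  rw [loopValue_eq_sum v hω hv, oddPart, evenPart,
    finrank_iSup_homogeneous v hv (fun a => β.val a a = -1),
    finrank_iSup_homogeneous v hv (fun a => β.val a a = 1), Finset.card_filter, Finset.card_filter]
  push_cast
  rw [← Finset.sum_neg_distrib, ← Finset.sum_sub_distrib]
  refine Finset.sum_congr rfl fun u _ => ?_
  have hne : (1 : κ) ≠ -1 := by
    intro h
    have : (2 : κ) = 0 := by linear_combination h
    exact two_ne_zero this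
  rcases mul_self_eq_one_iff.1 (β.val_mul_val_symm (c u) (c u)) with h | h
  · rw [h, if_neg hne, if_pos rfl]; ring
  · rw [h, if_neg hne.symm, if_pos rfl]; ring

end Dimension

/-! ### The representation of the Brauer algebra. -/

section Representation

variable {κ : Type*} [Field κ] {V : Type*} [AddCommGroup V] [Module κ V] [FiniteDimensional κ V]
  {ι : Type*} [Fintype ι] [DecidableEq ι] (v : Module.Basis ι κ V)
  {ω : LinearMap.BilinForm κ V} {G : Type*} [CommGroup G] [Fintype G] [DecidableEq G]
  {β : SymmBicharacter G κ} {𝒱 : G → Submodule κ V} [DirectSum.Decomposition 𝒱] {c : ι → G}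
  {k : ℕ} {η : κ}

variable (β 𝒱 k η) in
/-- The linear extension of `d ↦ Ψ_d` to the Brauer algebra. -/
noncomputable def psiLin (hω : ω.Nondegenerate) :
    BrauerAlgebra κ k η →ₗ[κ] Module.End κ (⨂[κ]^k V) :=
  (BrauerAlgebra.basis κ k η).constr κ fun d => Psi β 𝒱 ω hω d

theorem psiLin_ofDiagram (hω : ω.Nondegenerate) (d : Diagram k) :
    psiLin β 𝒱 k η hω (BrauerAlgebra.ofDiagram η d) = Psi β 𝒱 ω hω d :=
  Module.Basis.constr_basis _ _ _ _

theorem psiLin_one (hω : IsSkewForm β 𝒱 ω) (hv : ∀ i, v i ∈ 𝒱 (c i)) :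
    psiLin β 𝒱 k η hω.nondegenerate 1 = 1 :=
  (psiLin_ofDiagram hω.nondegenerate (Diagram.id k)).trans (Psi_id v hω hv)

theorem psiLin_mul_of_forall_ofDiagram (hω : ω.Nondegenerate) {y : BrauerAlgebra κ k η}
    {A : Module.End κ (⨂[κ]^k V)}
    (h : ∀ d, psiLin β 𝒱 k η hω (BrauerAlgebra.ofDiagram η d * y) = A * Psi β 𝒱 ω hω d)
    (x : BrauerAlgebra κ k η) :
    psiLin β 𝒱 k η hω (x * y) = A * psiLin β 𝒱 k η hω x := by
  have h1 : psiLin β 𝒱 k η hω ∘ₗ LinearMap.mulRight κ y =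
      LinearMap.mulLeft κ A ∘ₗ psiLin β 𝒱 k η hω := by
    refine (BrauerAlgebra.basis κ k η).ext fun d => ?_
    refine (h d).trans ?_
    rw [← psiLin_ofDiagram (η := η)]
    rfl
  exact LinearMap.congr_fun h1 x

/-- Compatibility with right multiplication by a fixed element, for all left factors at once, is
stable under products; hence it passes from generators to all diagrams, and so does membership in
`homG`. -/
theorem psiLin_mul_and_mem (hω : IsSkewForm β 𝒱 ω) (hv : ∀ i, v i ∈ 𝒱 (c i))
    (hη : loopValue v ω = η) (d : Diagram k) :
    (∀ x, psiLin β 𝒱 k η hω.nondegenerate (x * BrauerAlgebra.ofDiagram η d) =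
        Psi β 𝒱 ω hω.nondegenerate d * psiLin β 𝒱 k η hω.nondegenerate x) ∧
      Psi β 𝒱 ω hω.nondegenerate d ∈ homG β 𝒱 ω k := by
  have hn := hω.nondegenerate
  have key := BrauerAlgebra.ofDiagram_induction (η := η) (k := k)
    (fun y => (∀ x, psiLin β 𝒱 k η hω.nondegenerate (x * y) =
      psiLin β 𝒱 k η hω.nondegenerate y * psiLin β 𝒱 k η hω.nondegenerate x) ∧
        psiLin β 𝒱 k η hω.nondegenerate y ∈ homG β 𝒱 ω k) ?_ ?_ ?_ ?_ d
  · rwa [psiLin_ofDiagram] at key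
  · rw [psiLin_one v hω hv]
    exact ⟨fun x => by rw [mul_one, one_mul], one_mem _⟩
  · rintro x y ⟨hx, hx'⟩ ⟨hy, hy'⟩
    refine ⟨fun z => ?_, ?_⟩
    · rw [← mul_assoc, hy, hx, hy, mul_assoc]
    · rw [hy]; exact mul_mem hy' hx'
  · intro i
    have h1 : Psi β 𝒱 ω hω.nondegenerate ((Diagram.id k).permBot (adjSwap i)) = braid β 𝒱 i := by
      rw [Psi_permBot_adjSwap v hω hv, Psi_id v hω hv, mul_one]
    rw [psiLin_ofDiagram, h1]
    refine ⟨psiLin_mul_of_forall_ofDiagram _ fun d => ?_, braid_mem_homG v hv i⟩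
    rw [BrauerAlgebra.ofDiagram_mul_swap, psiLin_ofDiagram, Psi_permBot_adjSwap v hω hv]
  · intro p q hpq hp hq
    -- The contraction formula applied to the identity diagram, which joins no two bottom vertices.
    have h1 : Psi β 𝒱 ω hω.nondegenerate (Diagram.cupCap hpq) = contraction v ω p q := by
      have := contraction_mul_Psi v hω hv hp hq hpq (Diagram.id k)
      rw [Psi_id v hω hv, mul_one, if_neg (by simp [Diagram.id]), one_smul] at this
      exact this.symm
    rw [psiLin_ofDiagram, h1]
    refine ⟨psiLin_mul_of_forall_ofDiagram _ fun d => ?_, contraction_mem_homG v hω hv hp hq⟩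
    rw [BrauerAlgebra.ofDiagram_mul, (comp_cupCap hpq d).1, (comp_cupCap hpq d).2, map_smul,
      psiLin_ofDiagram, contraction_mul_Psi v hω hv hp hq hpq, hη]
    split_ifs <;> simp

theorem psiLin_mem_homG (hω : IsSkewForm β 𝒱 ω) (hv : ∀ i, v i ∈ 𝒱 (c i))
    (hη : loopValue v ω = η) (x : BrauerAlgebra κ k η) :
    psiLin β 𝒱 k η hω.nondegenerate x ∈ homG β 𝒱 ω k := by
  have h : ⊤ ≤ (Subalgebra.toSubmodule (homG β 𝒱 ω k)).comap
      (psiLin β 𝒱 k η hω.nondegenerate) := by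
    rw [← (BrauerAlgebra.basis κ k η).span_eq, Submodule.span_le]
    rintro _ ⟨d, rfl⟩
    have h1 := (psiLin_mul_and_mem v hω hv hη d).2
    rwa [← psiLin_ofDiagram (η := η)] at h1
  exact h trivial

theorem psiLin_mul (hω : IsSkewForm β 𝒱 ω) (hv : ∀ i, v i ∈ 𝒱 (c i))
    (hη : loopValue v ω = η) (x y : BrauerAlgebra κ k η) :
    psiLin β 𝒱 k η hω.nondegenerate (x * y) =
      psiLin β 𝒱 k η hω.nondegenerate y * psiLin β 𝒱 k η hω.nondegenerate x := by
  have h : psiLin β 𝒱 k η hω.nondegenerate ∘ₗ LinearMap.mulLeft κ x =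
      LinearMap.mulRight κ (psiLin β 𝒱 k η hω.nondegenerate x) ∘ₗ
        psiLin β 𝒱 k η hω.nondegenerate := by
    refine (BrauerAlgebra.basis κ k η).ext fun d => ?_
    refine ((psiLin_mul_and_mem v hω hv hη d).1 x).trans ?_
    rw [← psiLin_ofDiagram (η := η)]
    rfl
  exact LinearMap.congr_fun h y

/-- The representation of the Brauer algebra on `V^{⊗k}`, with endomorphisms written on the
right. -/
noncomputable def brauerRep (hω : IsSkewForm β 𝒱 ω) (hv : ∀ i, v i ∈ 𝒱 (c i))
    (hη : loopValue v ω = η) : BrauerAlgebra κ k η →ₐ[κ] (homG β 𝒱 ω k)ᵐᵒᵖ :=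
  AlgHom.ofLinearMap
    ((MulOpposite.opLinearEquiv κ).toLinearMap ∘ₗ
      (psiLin β 𝒱 k η hω.nondegenerate).codRestrict (Subalgebra.toSubmodule (homG β 𝒱 ω k))
        (psiLin_mem_homG v hω hv hη))
    (MulOpposite.unop_injective (Subtype.ext (psiLin_one v hω hv)))
    fun x y => MulOpposite.unop_injective (Subtype.ext (psiLin_mul v hω hv hη x y))

end Representation

end SpoColor

theorem theorem2p16 {κ : Type*} [Field κ] [CharZero κ] {G : Type*} [CommGroup G] [Fintype G]
    [DecidableEq G] (β : SymmBicharacter G κ) {V : Type*} [AddCommGroup V] [Module κ V]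
    [FiniteDimensional κ V] (𝒱 : G → Submodule κ V) [DirectSum.Decomposition 𝒱]
    (ω : LinearMap.BilinForm κ V) (hω : IsSkewForm β 𝒱 ω) (k : ℕ) :
    ((∀ d : Diagram k, Psi β 𝒱 ω hω.nondegenerate d ∈ homG β 𝒱 ω k) ∧
      ∀ {ι : Type*} [Fintype ι] [DecidableEq ι] (v : Module.Basis ι κ V) (c : ι → G),
        (∀ i, v i ∈ 𝒱 (c i)) → ∀ (d : Diagram k) (a : Fin k → ι),
        Psi β 𝒱 ω hω.nondegenerate d (PiTensorProduct.tprod κ fun i => v (a i)) =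
          ∑ b : Fin k → ι, weight β (Matrix.of fun i j => ω (v i) (v j)) c d a b •
            (PiTensorProduct.tprod κ fun i => v (b i))) ∧
    ∃ Ψ : BrauerAlgebra κ k
          ((Module.finrank κ (oddPart β 𝒱) : κ) - (Module.finrank κ (evenPart β 𝒱) : κ)) →ₐ[κ]
        (homG β 𝒱 ω k)ᵐᵒᵖ,
      ∀ d : Diagram k,
        ((MulOpposite.unop (Ψ (BrauerAlgebra.ofDiagram _ d)) : homG β 𝒱 ω k) :
            Module.End κ (⨂[κ]^k V)) = Psi β 𝒱 ω hω.nondegenerate d := by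
  obtain ⟨n, v, c, hv⟩ := exists_homogeneous_basis 𝒱
  -- One homogeneous basis suffices for membership and for the homomorphism; the matrix formula is
  -- then proved for an arbitrary one.
  refine ⟨⟨fun d => (psiLin_mul_and_mem v hω hv rfl d).2, ?_⟩,
    brauerRep v hω hv (loopValue_eq v hω hv), fun d => psiLin_ofDiagram hω.nondegenerate d⟩
  intro ι _ _ v c hv d a
  rw [Psi_tprod v ω β 𝒱 hω.nondegenerate hv (isSkewMatrix_gram_inv v hω hv)]
  exact Finset.sum_congr rfl fun b _ => by rw [psiEntry_eq_weight v hω hv]
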